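/- Let $T$ be a rooted tree with $n\ge 1$ nodes, numbered $1,\dots,n$, with root $1$. The tree is given in memory by its number of nodes and, for each node, pointers to its parent, its first child and its next sibling; the sibling pointers fix an order of the children of each node. Write $\mathrm{dist}$ for the distance in $T$. A node $a$ is an ancestor of $v$ if it lies on the path from $1$ to $v$; the lowest common ancestor (LCA) of $u,v$ is the common ancestor that is closest to $u$ and $v$; the level ancestor for $(v,d)$ with $0\le d\le\mathrm{dist}(1,v)$ is the ancestor of $v$ at distance $d$ from the root. Running time is counted on a word RAM with $w$-bit words (each arithmetic, bitwise, shift or comparison operation, memory access, variable access, assignment, test and procedure call counts one step). $\textsc{ComputeDistance}$ is the recursive depth-first search from the root that maintains a timer: it starts with timer $0$ and $\mathrm{dist}(1,1)\leftarrow 0$; on entering $v$ it sets $t_{in}(v)\leftarrow$ timer and increases the timer by $1$; for each child $u$ of $v$, in order, it sets $\mathrm{dist}(1,u)\leftarrow\mathrm{dist}(1,v)+1$ and recurses on $u$; on leaving $v$ it sets $t_{out}(v)\leftarrow$ timer and increases the timer by $1$. $\textsc{Preprocessing}$ runs $\textsc{LCA\_Preprocessing}$, then $\textsc{LA\_Preprocessing}$,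 then sets $\mathrm{dist}(1,1)\leftarrow 0$ and runs $\textsc{ComputeDistance}$. **Theorem.** There are procedures $\textsc{LCA\_Preprocessing}()$, $\textsc{LA\_Preprocessing}()$, $\textsc{LCA}(u,v)$, $\textsc{LA}(v,d)$ and a constant $C$ such that, for every rooted tree $T$ with $n$ nodes, every word length $w$ with $2^w\ge Cn$, and all initial contents of the rest of the memory: 1. $\textsc{LCA\_Preprocessing}$ halts within $Cn$ steps, and after it each call $\textsc{LCA}(u,v)$ returns the lowest common ancestor of $u$ and $v$ within $C$ steps; 2. $\textsc{LA\_Preprocessing}$ halts within $Cn$ steps, and after it each call $\textsc{LA}(v,d)$ with $0\le d\le\mathrm{dist}(1,v)$ returns the level ancestor for $(v,d)$ within $C$ steps; 3. $\textsc{Preprocessing}$ halts within $Cn$ steps, that is, it has time complexity $O(n)$. After it, $\textsc{LCA}$ and $\textsc{LA}$ answer as in 1 and 2, and the memory holds $\mathrm{dist}(1,v)$ for every node $v$, together with the entry times $t_{in}(v)$ and exit times $t_{out}(v)$ of the depth-first traversal. None of the three preprocessing procedures changes the stored tree, and the calls of $\textsc{LCA}$ and $\textsc{LA}$ leave the memory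 unchanged. -/

import Mathlib

/-! ## A word RAM with a step count -/

namespace WordRAM

/-- The unit-cost operations of a word RAM. -/
inductive BinOp
  | add | sub | mul | div | mod | and | or | xor | shl | shr | lt | eq

/-- The operations on `w`-bit words (numbers below `2 ^ w`): arithmetic is modulo `2 ^ w`,
comparisons return `1` or `0`, and `x / 0 = 0`, `x mod 0 = x`. -/
def BinOp.eval (w : ℕ) : BinOp → ℕ → ℕ → ℕ
  | .add, a, b => (a + b) % 2 ^ w
  | .sub, a, b => (a + 2 ^ w - b) % 2 ^ w
  | .mul, a, b => (a * b) % 2 ^ w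
  | .div, a, b => a / b
  | .mod, a, b => a % b
  | .and, a, b => a &&& b
  | .or, a, b => a ||| b
  | .xor, a, b => a ^^^ b
  | .shl, a, b => (a <<< b) % 2 ^ w
  | .shr, a, b => a >>> b
  | .lt, a, b => if a < b then 1 else 0
  | .eq, a, b => if a = b then 1 else 0

/-- Expressions: constants, local variables, array accesses and operations. -/
inductive Term
  | const (k : ℕ)
  | var (x : ℕ)
  | load (A : ℕ) (i : Term)
  | op (o : BinOp) (a b : Term)

/-- The memory: `M A i` is the word stored at index `i` of the array named `A`. -/
abbrev Memory := ℕ → ℕ → ℕ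

/-- The local variables of the procedure that is being executed. -/
abbrev Locals := ℕ → ℕ

/-- Every memory cell holds a `w`-bit word. -/
def IsWords (w : ℕ) (M : Memory) : Prop := ∀ A i, M A i < 2 ^ w

/-- Writing the value `x` at index `i` of the array `A`. -/
def Memory.write (M : Memory) (A i x : ℕ) : Memory :=
  Function.update M A (Function.update (M A) i x)

/-- The value of an expression. -/
def Term.eval (w : ℕ) (L : Locals) (M : Memory) : Term → ℕ
  | .const k => k % 2 ^ w
  | .var x => L x
  | .load A i => M A (i.eval w L M)
  | .op o a b => o.eval w (a.eval w L M) (b.eval w L M)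

/-- The number of steps for evaluating an expression: one for each constant, variable, array
access and operation that occurs in it. -/
def Term.cost : Term → ℕ
  | .const _ => 1
  | .var _ => 1
  | .load _ i => i.cost + 1
  | .op _ a b => a.cost + b.cost + 1

/-- Commands. `call x p args` calls the procedure number `p` by value and assigns the returned
word to the local variable `x`. -/
inductive Cmd
  | skip
  | assign (x : ℕ) (e : Term)
  | store (A : ℕ) (i e : Term)
  | seq (c d : Cmd)
  | cond (e : Term) (c d : Cmd)
  | loop (e : Term) (c : Cmd)
  | call (x p : ℕ) (args : List Term)

infixr:60 " ;; " => Cmd.seq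

/-- A program is a finite list of procedure bodies, which may call each other recursively. -/
abbrev Program := List Cmd

/-- The local variables on entering a procedure: the arguments in the variables `0, 1, …`, and
`0` in all others. -/
def frame (args : List ℕ) : Locals := fun i => args.getD i 0

/-- `Exec P w c L M t L' M'`: with the procedures of `P` and words of `w` bits, the command `c`,
started with local variables `L` and memory `M`, halts after exactly `t` steps with local variables
`L'` and memory `M'`. A condition counts as true when it is nonzero. A called procedure gets its
own local variables, and the word that it returns is the final value of its variable `0`. -/
inductive Exec (P : Program) (w : ℕ) :
    Cmd → Locals → Memory → ℕ → Locals → Memory → Prop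
  | skip (L : Locals) (M : Memory) : Exec P w .skip L M 1 L M
  | assign (x : ℕ) (e : Term) (L : Locals) (M : Memory) :
      Exec P w (.assign x e) L M (e.cost + 1) (Function.update L x (e.eval w L M)) M
  | store (A : ℕ) (i e : Term) (L : Locals) (M : Memory) :
      Exec P w (.store A i e) L M (i.cost + e.cost + 1) L
        (M.write A (i.eval w L M) (e.eval w L M))
  | seq {c d : Cmd} {L L' L'' : Locals} {M M' M'' : Memory} {t t' : ℕ}
      (h : Exec P w c L M t L' M') (h' : Exec P w d L' M' t' L'' M'') :
      Exec P w (.seq c d) L M (t + t') L'' M''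
  | condTrue {e : Term} {c d : Cmd} {L L' : Locals} {M M' : Memory} {t : ℕ}
      (he : e.eval w L M ≠ 0) (h : Exec P w c L M t L' M') :
      Exec P w (.cond e c d) L M (e.cost + 1 + t) L' M'
  | condFalse {e : Term} {c d : Cmd} {L L' : Locals} {M M' : Memory} {t : ℕ}
      (he : e.eval w L M = 0) (h : Exec P w d L M t L' M') :
      Exec P w (.cond e c d) L M (e.cost + 1 + t) L' M'
  | loopTrue {e : Term} {c : Cmd} {L L' L'' : Locals} {M M' M'' : Memory} {t t' : ℕ}
      (he : e.eval w L M ≠ 0) (h : Exec P w c L M t L' M')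
      (h' : Exec P w (.loop e c) L' M' t' L'' M'') :
      Exec P w (.loop e c) L M (e.cost + 1 + t + t') L'' M''
  | loopFalse {e : Term} {c : Cmd} {L : Locals} {M : Memory} (he : e.eval w L M = 0) :
      Exec P w (.loop e c) L M (e.cost + 1) L M
  | call {x p : ℕ} {args : List Term} {body : Cmd} {L L' : Locals} {M M' : Memory} {t : ℕ}
      (hp : P[p]? = some body)
      (h : Exec P w body (frame (args.map fun e => e.eval w L M)) M t L' M') :
      Exec P w (.call x p args) L M ((args.map Term.cost).sum + 1 + t)
        (Function.update L x (L' 0)) M'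

/-- The procedure number `p`, called with the words `args` on the memory `M`, halts after exactly
`t` steps, returns the word `r` and leaves the memory `M'`. -/
def Runs (P : Program) (w p : ℕ) (args : List ℕ) (M : Memory) (t r : ℕ) (M' : Memory) : Prop :=
  ∃ body L', P[p]? = some body ∧ Exec P w body (frame args) M t L' M' ∧ L' 0 = r

end WordRAM

/-! ## Rooted trees -/

namespace RootedTree

section Notions

variable {V : Type*} (T : SimpleGraph V) (r : V)

/-- `a` is an ancestor of `v` in the tree `T` with root `r`: it lies on the path from `r` to `v`. -/
def IsAncestor (a v : V) : Prop := ∃ p : T.Walk r v, p.IsPath ∧ a ∈ p.support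

/-- `p` is the parent of `v`: the first node after `v` on the path from `v` to the root `r`. -/
def IsParent (p v : V) : Prop := ∃ q : T.Walk v r, q.IsPath ∧ ¬ q.Nil ∧ q.snd = p

/-- `z` is the lowest common ancestor of `u` and `v`: the common ancestor that is closest to both. -/
def IsLCA (u v z : V) : Prop :=
  IsAncestor T r z u ∧ IsAncestor T r z v ∧
    ∀ z', IsAncestor T r z' u → IsAncestor T r z' v →
      T.dist z u ≤ T.dist z' u ∧ T.dist z v ≤ T.dist z' v

/-- `z` is the ancestor of `v` at distance `d` from the root. -/
def IsLevelAncestor (v : V) (d : ℕ) (z : V) : Prop := IsAncestor T r z v ∧ T.dist r z = d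

/-- `tin v` and `tout v` are the values of a timer on entering and on leaving `v` in the depth-first
traversal from `r` that visits the children of each node in the order of the list `children v`,
where the timer starts at `0` and is increased by one after each event of entering or leaving a
node. -/
structure IsDFSTimes (children : V → List V) (tin tout : V → ℕ) : Prop where
  root : tin r = 0
  leaf : ∀ v, children v = [] → tout v = tin v + 1
  first : ∀ v u l, children v = u :: l → tin u = tin v + 1
  next : ∀ v l u u' l', children v = l ++ u :: u' :: l' → tin u' = tout u + 1
  last : ∀ v l u, children v = l ++ [u] → tout v = tout u + 1

end Notions

open WordRAM

/-! ### The tree in memory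

The tree has the nodes `0, …, n - 1` of `Fin n` and the root `0`. In memory they are numbered
`1, …, n`, so that the root has the number `1`, and the number `0` stands for "no node". -/

/-- Array whose cell `0` holds the number of nodes. -/
abbrev sizeArr : ℕ := 0
/-- Array of the parents. -/
abbrev parentArr : ℕ := 1
/-- Array of the first children. -/
abbrev firstChildArr : ℕ := 2
/-- Array of the next siblings. -/
abbrev nextSiblingArr : ℕ := 3
/-- Array of the distances from the root. -/
abbrev distArr : ℕ := 4
/-- Array of the entry times. -/
abbrev tinArr : ℕ := 5
/-- Array of the exit times. -/
abbrev toutArr : ℕ := 6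
/-- Array whose cell `0` is the global timer. -/
abbrev timerArr : ℕ := 7

section Encoding

variable {n : ℕ} [NeZero n]

/-- The number of a node in memory. -/
def node (v : Fin n) : ℕ := v + 1

/-- The number of the first node of a list, or `0` for the empty list. -/
def headNode : List (Fin n) → ℕ
  | [] => 0
  | u :: _ => node u

/-- The memory `M` holds the tree `T` with root `0` in the left-child right-sibling representation,
that is, with pointers from each node to its parent, to its first child and to its next sibling.
`children v` is the list of all children of `v`, without repetition, in the order of the
pointers. -/
structure Represents (T : SimpleGraph (Fin n)) (children : Fin n → List (Fin n))
    (M : Memory) : Prop where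
  nodup : ∀ v, (children v).Nodup
  mem_children : ∀ v u, u ∈ children v ↔ IsParent T 0 v u
  size : M sizeArr 0 = n
  parent : ∀ v u, IsParent T 0 v u → M parentArr (node u) = node v
  parent_root : M parentArr (node (0 : Fin n)) = 0
  firstChild : ∀ v, M firstChildArr (node v) = headNode (children v)
  nextSibling : ∀ v l u l', children v = l ++ u :: l' →
    M nextSiblingArr (node u) = headNode l'
  nextSibling_root : M nextSiblingArr (node (0 : Fin n)) = 0

end Encoding

/-! ### The procedures -/

/-- Number of the procedure `ComputeDistanceBase(v)`. -/
abbrev computeDistanceBaseProc : ℕ := 0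
/-- Number of the procedure `ComputeDistance(v)`. -/
abbrev computeDistanceProc : ℕ := 1
/-- Number of the procedure `Preprocessing()`. -/
abbrev preprocessingProc : ℕ := 2
/-- Number of the procedure `LCA_Preprocessing()`. -/
abbrev lcaPreprocessingProc : ℕ := 3
/-- Number of the procedure `LA_Preprocessing()`. -/
abbrev laPreprocessingProc : ℕ := 4
/-- Number of the procedure `LCA(u, v)`. -/
abbrev lcaProc : ℕ := 5
/-- Number of the procedure `LA(v, d)`. -/
abbrev laProc : ℕ := 6

/-- The current value of the timer. -/
def timer : Term := .load timerArr (.const 0)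

/-- `timer ← timer + 1` -/
def incTimer : Cmd := .store timerArr (.const 0) (.op .add timer (.const 1))

/-- `ComputeDistanceBase(v)`: the recursive depth-first search from the node `v`. The local variable
`0` is `v`, the local variable `1` runs through the children `u` of `v`, and the local variable `2`
receives the (unused) result of the recursive calls. -/
def computeDistanceBase : Cmd :=
  .store tinArr (.var 0) timer ;;
  incTimer ;;
  .assign 1 (.load firstChildArr (.var 0)) ;;
  .loop (.var 1)
    (.store distArr (.var 1) (.op .add (.load distArr (.var 0)) (.const 1)) ;;
     .call 2 computeDistanceBaseProc [.var 1] ;;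
     .assign 1 (.load nextSiblingArr (.var 1))) ;;
  .store toutArr (.var 0) timer ;;
  incTimer

/-- `ComputeDistance(v)`, which is called for the root `v = 1` only. -/
def computeDistance : Cmd :=
  .store timerArr (.const 0) (.const 0) ;;
  .store distArr (.const 1) (.const 0) ;;
  .call 1 computeDistanceBaseProc [.const 1]

/-- `Preprocessing()`: preprocessing for the LCA problem, preprocessing for the level ancestor
problem, and one depth-first search from the root. -/
def preprocessing : Cmd :=
  .call 0 lcaPreprocessingProc [] ;;
  .call 0 laPreprocessingProc [] ;;
  .store distArr (.const 1) (.const 0) ;;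
  .call 0 computeDistanceProc [.const 1]

/-- The whole program, for given procedures `LCA_Preprocessing()`, `LA_Preprocessing()`,
`LCA(u, v)` and `LA(v, d)` and a list `aux` of further procedures that they may call. -/
def program (lcaPre laPre lca la : Cmd) (aux : List Cmd) : Program :=
  [computeDistanceBase, computeDistance, preprocessing, lcaPre, laPre, lca, la] ++ aux

section Queries

variable {n : ℕ} [NeZero n]

/-- On the memory `M`, the procedure `LCA(u, v)` returns the lowest common ancestor of any two nodes
in at most `C` steps, and it leaves the memory as it was. -/
def AnswersLCA (P : Program) (w C : ℕ) (T : SimpleGraph (Fin n)) (M : Memory) : Prop :=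
  ∀ u v : Fin n, ∃ t z, Runs P w lcaProc [node u, node v] M t (node z) M ∧ t ≤ C ∧
    IsLCA T 0 u v z

/-- On the memory `M`, the procedure `LA(v, d)` returns the ancestor of `v` at distance `d` from the
root, for any node `v` and any `d` up to the depth of `v`, in at most `C` steps, and it leaves the
memory as it was. -/
def AnswersLA (P : Program) (w C : ℕ) (T : SimpleGraph (Fin n)) (M : Memory) : Prop :=
  ∀ (v : Fin n) (d : ℕ), d ≤ T.dist 0 v →
    ∃ t z, Runs P w laProc [node v, d] M t (node z) M ∧ t ≤ C ∧ IsLevelAncestor T 0 v d z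

end Queries

end RootedTree

open WordRAM RootedTree

namespace WordRAM

/-! ### Words and program logic -/

/-! Both query problems are solved on one preorder numbering, in which each node visits a child of
greatest height first. `DepthSeq` records what is needed: all positions after the parent of `i` and
up to `i` have depth at least `D i`, and a node of positive height is directly followed by its
highest child.

LCA reduces to range minima and level ancestors. For positions `i < j`, the least depth `m` on `i +
1, …, j` is attained at an ancestor of `j` whose parent is the LCA, so the LCA is the ancestor of
`j` at depth `m - 1` (`DepthSeq.lca_of_isMin`). For the minima, the positions are cut into blocks of
length `b` about half of `log n`. Runs of whole blocks are covered by two windows of a power-of-two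
number of blocks, whose minima form a table with `O(n / b * log n) = O(n)` cells. Inside a block, a
mask marks the ancestors of `i` in its block. The first ancestor from `l` on has the least depth on
`l, …, i`, so the lowest bit of the shifted mask gives the minimum (`DepthSeq.isMin_block`). There
are only `O(√n)` masks, so the positions of their bits can be tabulated.

For level ancestors, an answer in the block of `i` is a selected bit of the same mask
(`DepthSeq.iterate_near`). Otherwise it is also the ancestor at that depth of the first position of
the block (`DepthSeq.iterate_far`). Hence jumps by powers of two are stored for block starts only,
again in `O(n)` cells. The largest possible jump `2 ^ k` ends at a node of height at least `2 ^ k`.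
The fewer than `2 ^ k` steps that remain are made along the path of highest children through that
node and the ladder above it (`DepthSeq.jump_climb`). Such paths are intervals of positions, so
climbing along them is subtraction.

On the machine, preorder positions are recovered from entry times and depths (`OTree.tinOf_add`),
once for the given order of the children and once after the highest child has been moved to the
front. Each table is one loop whose cell is an expression of fixed size in earlier cells
(`computes_fill`). The searches are paid for by the timer (`dfs_exec`). Case distinctions in
expressions are arithmetic (`Term.ite`), so the cost of a query is a syntactic constant. One
preprocessing procedure serves both problems. -/

theorem BinOp.eval_lt {w : ℕ} (hw : 1 < 2 ^ w) (o : BinOp) {a b : ℕ} (ha : a < 2 ^ w)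
    (hb : b < 2 ^ w) : o.eval w a b < 2 ^ w := by
  have h0 : 0 < 2 ^ w := by omega
  cases o <;> simp only [BinOp.eval]
  case add => exact Nat.mod_lt _ h0
  case sub => exact Nat.mod_lt _ h0
  case mul => exact Nat.mod_lt _ h0
  case div => exact (Nat.div_le_self _ _).trans_lt ha
  case mod => exact (Nat.mod_le _ _).trans_lt ha
  case and => exact Nat.and_lt_two_pow _ hb
  case or => exact Nat.or_lt_two_pow ha hb
  case xor => exact Nat.xor_lt_two_pow ha hb
  case shl => exact Nat.mod_lt _ h0
  case shr => exact (Nat.shiftRight_le _ _).trans_lt ha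
  case lt => split_ifs <;> omega
  case eq => split_ifs <;> omega

/-- Every local variable holds a `w`-bit word. -/
def IsWordLocals (w : ℕ) (L : Locals) : Prop := ∀ x, L x < 2 ^ w

theorem Term.eval_lt {w : ℕ} (hw : 1 < 2 ^ w) {L : Locals} {M : Memory}
    (hL : IsWordLocals w L) (hM : IsWords w M) (e : Term) : e.eval w L M < 2 ^ w := by
  induction e with
  | const k => exact Nat.mod_lt _ (by omega)
  | var x => exact hL x
  | load A i _ => exact hM _ _
  | op o a b iha ihb => exact BinOp.eval_lt hw o iha ihb

theorem IsWordLocals.update {w : ℕ} {L : Locals} (hL : IsWordLocals w L) {x v : ℕ}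
    (hv : v < 2 ^ w) : IsWordLocals w (Function.update L x v) := by
  intro y
  by_cases h : y = x
  · subst h; simpa using hv
  · simpa [h] using hL y

theorem isWordLocals_frame {w : ℕ} {args : List ℕ} (h : ∀ a ∈ args, a < 2 ^ w) :
    IsWordLocals w (frame args) := by
  intro i
  rw [frame, List.getD_eq_getElem?_getD]
  by_cases hi : i < args.length
  · simpa [hi] using h _ (List.getElem_mem hi)
  · simp [hi]

theorem Memory.write_same (M : Memory) (A i x : ℕ) : M.write A i x A i = x := by
  simp [Memory.write]

theorem Memory.write_row_ne (M : Memory) {A B : ℕ} (i x : ℕ) (h : B ≠ A) :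
    M.write A i x B = M B := by
  simp [Memory.write, h]

theorem Memory.write_index_ne (M : Memory) (A : ℕ) {i j : ℕ} (x : ℕ) (h : j ≠ i) :
    M.write A i x A j = M A j := by
  simp [Memory.write, h]

theorem IsWords.write {w : ℕ} {M : Memory} (hM : IsWords w M) {A i x : ℕ} (hx : x < 2 ^ w) :
    IsWords w (M.write A i x) := by
  intro B j
  by_cases hB : B = A
  · subst hB
    by_cases hj : j = i
    · subst hj; rw [Memory.write_same]; exact hx
    · rw [Memory.write_index_ne _ _ _ hj]; exact hM _ _
  · rw [Memory.write_row_ne _ _ _ hB]; exact hM _ _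

/-- Every value that is written comes from an expression, and those stay below `2 ^ w`. Thus "all
cells are words" passes from one command to the next and need not be part of the invariants. -/
theorem Exec.isWords {P : Program} {w : ℕ} (hw : 1 < 2 ^ w) {c : Cmd} {L L' : Locals}
    {M M' : Memory} {t : ℕ} (h : Exec P w c L M t L' M') :
    IsWordLocals w L → IsWords w M → IsWordLocals w L' ∧ IsWords w M' := by
  induction h with
  | skip L M => exact fun h h' => ⟨h, h'⟩
  | assign x e L M => exact fun h h' => ⟨h.update (Term.eval_lt hw h h' e), h'⟩
  | store A i e L M => exact fun h h' => ⟨h, h'.write (Term.eval_lt hw h h' e)⟩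
  | seq _ _ ih ih' =>
    intro h h'
    obtain ⟨a, b⟩ := ih h h'
    exact ih' a b
  | condTrue _ _ ih => exact ih
  | condFalse _ _ ih => exact ih
  | loopTrue _ _ _ ih ih' =>
    intro h h'
    obtain ⟨a, b⟩ := ih h h'
    exact ih' a b
  | loopFalse _ => exact fun h h' => ⟨h, h'⟩
  | call hp _ ih =>
    intro h h'
    obtain ⟨a, b⟩ := ih (isWordLocals_frame fun y hy => by
      obtain ⟨e, -, rfl⟩ := List.mem_map.1 hy
      exact Term.eval_lt hw h h' e) h'
    exact ⟨h.update (a 0), b⟩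

/-! ### A logic for running times -/

/-- Started on a memory of words with the property `Pre`, the command `c` halts within `k` steps
and leaves a memory with the property `Post`. -/
def Computes (P : Program) (w : ℕ) (c : Cmd) (k : ℕ) (Pre Post : Memory → Prop) : Prop :=
  ∀ L M, IsWordLocals w L → IsWords w M → Pre M →
    ∃ t L' M', Exec P w c L M t L' M' ∧ t ≤ k ∧ Post M'

section Computes

variable {P : Program} {w : ℕ}

theorem Computes.seq (hw : 1 < 2 ^ w) {c d : Cmd} {k k' : ℕ} {I J K : Memory → Prop}
    (h : Computes P w c k I J) (h' : Computes P w d k' J K) :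
    Computes P w (c ;; d) (k + k') I K := by
  intro L M hL hM hI
  obtain ⟨t, L₁, M₁, e₁, ht, hJ⟩ := h L M hL hM hI
  obtain ⟨hL₁, hM₁⟩ := e₁.isWords hw hL hM
  obtain ⟨t', L₂, M₂, e₂, ht', hK⟩ := h' L₁ M₁ hL₁ hM₁ hJ
  exact ⟨_, _, _, .seq e₁ e₂, by omega, hK⟩

/-- Keeping each bound in the form "constant times `n`" makes the constants of a long sequence add
up on their own. -/
theorem Computes.seq_mul (hw : 1 < 2 ^ w) {c d : Cmd} {k k' n : ℕ} {I J K : Memory → Prop}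
    (h : Computes P w c (k * n) I J) (h' : Computes P w d (k' * n) J K) :
    Computes P w (c ;; d) ((k + k') * n) I K := by
  rw [add_mul]
  exact h.seq hw h'

theorem Computes.mono {c : Cmd} {k k' : ℕ} {I I' J J' : Memory → Prop}
    (h : Computes P w c k I J) (hk : k ≤ k') (hI : ∀ M, I' M → I M) (hJ : ∀ M, J M → J' M) :
    Computes P w c k' I' J' := by
  intro L M hL hM h'
  obtain ⟨t, L₁, M₁, e₁, ht, h₁⟩ := h L M hL hM (hI M h')
  exact ⟨t, L₁, M₁, e₁, ht.trans hk, hJ _ h₁⟩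

theorem Computes.store {A : ℕ} {i e : Term} {I J : Memory → Prop}
    (h : ∀ L M, I M → J (M.write A (i.eval w L M) (e.eval w L M))) :
    Computes P w (.store A i e) (i.cost + e.cost + 1) I J :=
  fun L M _ _ hI => ⟨_, _, _, .store A i e L M, le_rfl, h L M hI⟩

theorem Computes.call (hw : 1 < 2 ^ w) {x p k : ℕ} {args : List Term} {body : Cmd}
    {I J : Memory → Prop} (hp : P[p]? = some body) (h : Computes P w body k I J) :
    Computes P w (.call x p args) ((args.map Term.cost).sum + 1 + k) I J := by
  intro L M hL hM hI
  obtain ⟨t, L₁, M₁, e₁, ht, h₁⟩ := h (frame (args.map fun e => e.eval w L M)) M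
    (isWordLocals_frame fun y hy => by
      obtain ⟨e, -, rfl⟩ := List.mem_map.1 hy
      exact Term.eval_lt hw hL hM e) hM hI
  exact ⟨_, _, _, .call hp e₁, by omega, h₁⟩

theorem Computes.runs {p k : ℕ} {body : Cmd} {I J : Memory → Prop} (hp : P[p]? = some body)
    (hw : 1 < 2 ^ w) (h : Computes P w body k I J) {M : Memory} (hM : IsWords w M) (hI : I M) :
    ∃ t r M', Runs P w p [] M t r M' ∧ t ≤ k ∧ J M' ∧ IsWords w M' := by
  have hL : IsWordLocals w (frame []) := fun i => by simp [frame]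
  obtain ⟨t, L₁, M₁, e₁, ht, h₁⟩ := h (frame []) M hL hM hI
  exact ⟨t, L₁ 0, M₁, ⟨body, L₁, hp, e₁, rfl⟩, ht, h₁, (e₁.isWords hw hL hM).2⟩

end Computes

/-! ### Loops that fill one table -/

/-- The loop that assigns, for `i = 0, …, N - 1` in this order, the value of `e` to the cell of the
array `A` whose index is the value of `g`. The local variable `0` is the counter `i`. -/
def fill (A : ℕ) (N g e : Term) : Cmd :=
  .assign 1 N ;; .assign 0 (.const 0) ;;
  .loop (.op .lt (.var 0) (.var 1))
    (.store A g e ;; .assign 0 (.op .add (.var 0) (.const 1)))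

/-- A bound for the steps of one round of the loop `fill`. -/
def fillCost (N g e : Term) : ℕ := N.cost + g.cost + e.cost + 20

/-- The rule for dynamic programming: when cell `gf i` is computed, the cells `gf j` with `j < i`
already satisfy their specification `R j`. Injectivity of `gf` keeps later rounds from overwriting
them, and `hframe` says that `I` does not depend on the array `A`. -/
theorem computes_fill {P : Program} {w : ℕ} (hw : 1 < 2 ^ w) {A : ℕ} {N g e : Term} {N₀ : ℕ}
    {gf : ℕ → ℕ} {R : ℕ → ℕ → Prop} {I : Memory → Prop}
    (hframe : ∀ M M', (∀ B, B ≠ A → M' B = M B) → I M → I M')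
    (hN₀ : N₀ < 2 ^ w)
    (hN : ∀ L M, IsWordLocals w L → IsWords w M → I M → N.eval w L M = N₀)
    (hinj : ∀ i < N₀, ∀ j < i, gf j ≠ gf i)
    (step : ∀ L M i, IsWordLocals w L → IsWords w M → I M → i < N₀ → L 0 = i →
      (∀ j < i, R j (M A (gf j))) → g.eval w L M = gf i ∧ R i (e.eval w L M)) :
    Computes P w (fill A N g e) (fillCost N g e * (N₀ + 1)) I
      (fun M => I M ∧ ∀ i < N₀, R i (M A (gf i))) := by
  -- Induction on the number `k` of rounds that remain; the `4` is the cost of the final failing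
  -- test.
  have key : ∀ k, ∀ i, i + k = N₀ → ∀ L M, IsWordLocals w L → IsWords w M → I M → L 0 = i →
      L 1 = N₀ → (∀ j < i, R j (M A (gf j))) →
      ∃ t L' M', Exec P w (.loop (.op .lt (.var 0) (.var 1))
        (.store A g e ;; .assign 0 (.op .add (.var 0) (.const 1)))) L M t L' M' ∧
        t ≤ (g.cost + e.cost + 10) * k + 4 ∧ (I M' ∧ ∀ i < N₀, R i (M' A (gf i))) := by
    intro k
    induction k with
    | zero =>
      intro i hi L M _ _ hI h0 h1 hR
      refine ⟨_, _, _, .loopFalse ?_, ?_, hI, ?_⟩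
      · simp [Term.eval, BinOp.eval, h0, h1]; omega
      · simp [Term.cost]
      · intro j hj; exact hR j (by omega)
    | succ k ih =>
      intro i hi L M hL hM hI h0 h1 hR
      obtain ⟨hg, hRi⟩ := step L M i hL hM hI (by omega) h0 hR
      have e₁ := Exec.store (P := P) (w := w) A g e L M
      have e₂ := Exec.assign (P := P) (w := w) 0 (.op .add (.var 0) (.const 1)) L
        (M.write A (g.eval w L M) (e.eval w L M))
      have hadd : Term.eval w L (M.write A (g.eval w L M) (e.eval w L M))
          (.op .add (.var 0) (.const 1)) = i + 1 := by
        simp only [Term.eval, BinOp.eval, h0]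
        rw [Nat.mod_eq_of_lt hw, Nat.mod_eq_of_lt (by omega)]
      rw [hadd] at e₂
      obtain ⟨hL₁, hM₁⟩ := (Exec.seq e₁ e₂).isWords hw hL hM
      obtain ⟨t, L', M', e₃, ht, hpost⟩ := ih (i + 1) (by omega) _ _ hL₁ hM₁
        (hframe M _ (fun B hB => Memory.write_row_ne _ _ _ hB) hI) (by simp)
        (by simpa using h1) (by
          intro j hj
          rw [hg]
          by_cases hji : j = i
          · subst hji; rw [Memory.write_same]; exact hRi
          · rw [Memory.write_index_ne _ _ _ (hinj i (by omega) j (by omega))]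
            exact hR j (by omega))
      refine ⟨_, _, _, .loopTrue ?_ (.seq e₁ e₂) e₃, ?_, hpost⟩
      · simp [Term.eval, BinOp.eval, h0, h1]; omega
      · simp only [Term.cost]
        rw [Nat.mul_succ]
        omega
  intro L M hL hM hI
  have e₁ := Exec.assign (P := P) (w := w) 1 N L M
  rw [hN L M hL hM hI] at e₁
  have e₂ := Exec.assign (P := P) (w := w) 0 (.const 0) (Function.update L 1 N₀) M
  obtain ⟨hL₁, hM₁⟩ := (Exec.seq e₁ e₂).isWords hw hL hM
  obtain ⟨t, L', M', e₃, ht, hpost⟩ := key N₀ 0 (by omega) _ M hL₁ hM₁ hI (by simp [Term.eval])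
    (by simp) (by simp)
  refine ⟨_, _, _, .seq e₁ (.seq e₂ e₃), ?_, hpost⟩
  have : (g.cost + e.cost + 10) * N₀ + 4 + (N.cost + 5) ≤ fillCost N g e * (N₀ + 1) := by
    simp only [fillCost]; nlinarith
  simp only [Term.cost]
  omega

/-! ### Evaluation of expressions -/

section Eval

variable {w : ℕ} {L : Locals} {M : Memory} {a b c : Term} {x y : ℕ}

theorem eval_const {k : ℕ} (h : k < 2 ^ w) : (Term.const k).eval w L M = k :=
  Nat.mod_eq_of_lt h

theorem eval_load {A : ℕ} (ha : a.eval w L M = x) : (Term.load A a).eval w L M = M A x := by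
  simp [Term.eval, ha]

theorem eval_add (ha : a.eval w L M = x) (hb : b.eval w L M = y) (h : x + y < 2 ^ w) :
    (Term.op .add a b).eval w L M = x + y := by
  simp only [Term.eval, BinOp.eval, ha, hb]
  exact Nat.mod_eq_of_lt h

theorem eval_sub (ha : a.eval w L M = x) (hb : b.eval w L M = y) (hx : x < 2 ^ w) (h : y ≤ x) :
    (Term.op .sub a b).eval w L M = x - y := by
  simp only [Term.eval, BinOp.eval, ha, hb]
  rw [show x + 2 ^ w - y = x - y + 2 ^ w by omega, Nat.add_mod_right]
  exact Nat.mod_eq_of_lt (by omega)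

theorem eval_mul (ha : a.eval w L M = x) (hb : b.eval w L M = y) (h : x * y < 2 ^ w) :
    (Term.op .mul a b).eval w L M = x * y := by
  simp only [Term.eval, BinOp.eval, ha, hb]
  exact Nat.mod_eq_of_lt h

theorem eval_div (ha : a.eval w L M = x) (hb : b.eval w L M = y) :
    (Term.op .div a b).eval w L M = x / y := by
  simp only [Term.eval, BinOp.eval, ha, hb]

theorem eval_mod (ha : a.eval w L M = x) (hb : b.eval w L M = y) :
    (Term.op .mod a b).eval w L M = x % y := by
  simp only [Term.eval, BinOp.eval, ha, hb]

theorem eval_shl_one (ha : a.eval w L M = x) (h : 2 ^ x < 2 ^ w) :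
    (Term.op .shl (.const 1) a).eval w L M = 2 ^ x := by
  have : 1 < 2 ^ w := lt_of_le_of_lt (Nat.one_le_two_pow) h
  simp only [Term.eval, BinOp.eval, ha, Nat.mod_eq_of_lt this, Nat.shiftLeft_eq, one_mul]
  exact Nat.mod_eq_of_lt h

theorem eval_shr (ha : a.eval w L M = x) (hb : b.eval w L M = y) :
    (Term.op .shr a b).eval w L M = x / 2 ^ y := by
  simp only [Term.eval, BinOp.eval, ha, hb, Nat.shiftRight_eq_div_pow]

theorem eval_lt (ha : a.eval w L M = x) (hb : b.eval w L M = y) :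
    (Term.op .lt a b).eval w L M = if x < y then 1 else 0 := by
  simp only [Term.eval, BinOp.eval, ha, hb]

theorem eval_eq (ha : a.eval w L M = x) (hb : b.eval w L M = y) :
    (Term.op .eq a b).eval w L M = if x = y then 1 else 0 := by
  simp only [Term.eval, BinOp.eval, ha, hb]

/-- The expression with the value of `a` if the condition `c` has the value `1`, and with the value
of `b` if `c` has the value `0`. -/
def Term.ite (c a b : Term) : Term :=
  .op .add (.op .mul c a) (.op .mul (.op .sub (.const 1) c) b)

/-- Both branches are evaluated and the unwanted one is multiplied by `0`, so nothing is required of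
its value, even if it reads meaningless cells. The wanted value is a word, so the reductions modulo
`2 ^ w` leave it unchanged. -/
theorem eval_ite (hw : 1 < 2 ^ w) (hL : IsWordLocals w L) (hM : IsWords w M) {p : Prop}
    [Decidable p] (hc : c.eval w L M = if p then 1 else 0) (ha : p → a.eval w L M = x)
    (hb : ¬ p → b.eval w L M = x) : (Term.ite c a b).eval w L M = x := by
  have h1 := Term.eval_lt hw hL hM a
  have h2 := Term.eval_lt hw hL hM b
  simp only [Term.ite, Term.eval, BinOp.eval, hc, Nat.mod_eq_of_lt hw]
  split_ifs with hp
  · rw [ha hp] at h1 ⊢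
    simp [Nat.mod_eq_of_lt h1]
  · rw [hb hp] at h2 ⊢
    simp [Nat.mod_eq_of_lt h2, Nat.mod_eq_of_lt hw]

/-- The minimum of two expressions. -/
def Term.min (a b : Term) : Term := .ite (.op .lt a b) a b

theorem eval_min (hw : 1 < 2 ^ w) (hL : IsWordLocals w L) (hM : IsWords w M)
    (ha : a.eval w L M = x) (hb : b.eval w L M = y) :
    (Term.min a b).eval w L M = Min.min x y :=
  eval_ite hw hL hM (eval_lt ha hb) (fun h => by rw [ha, min_eq_left h.le])
    (fun h => by rw [hb, min_eq_right (not_lt.1 h)])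

end Eval

end WordRAM

/-! ### Ordered trees and their preorder -/

namespace RootedTree

variable {n : ℕ} [NeZero n]

/-- The parent function `pa`, with `pa 0 = 0`, the depths `dp` and the ordered lists `ch` of children
describe an ordered tree with root `0`. -/
structure OTree (ch : Fin n → List (Fin n)) (pa : Fin n → Fin n) (dp : Fin n → ℕ) : Prop where
  nodup : ∀ v, (ch v).Nodup
  mem : ∀ v u, u ∈ ch v ↔ u ≠ 0 ∧ pa u = v
  pa_zero : pa 0 = 0
  dp_zero : dp 0 = 0
  dp_succ : ∀ u, u ≠ 0 → dp u = dp (pa u) + 1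

/-- The nodes of the subtree of a node in preorder, down to a given number of levels. -/
def preListAux (ch : Fin n → List (Fin n)) : ℕ → Fin n → List (Fin n)
  | 0, _ => []
  | k + 1, v => v :: (ch v).flatMap (preListAux ch k)

/-- The nodes of the subtree of `v` in preorder. -/
def preList (ch : Fin n → List (Fin n)) (dp : Fin n → ℕ) (v : Fin n) : List (Fin n) :=
  preListAux ch (Finset.univ.sup dp + 1 - dp v) v

/-- The position of a node in the preorder. -/
def preIdx (ch : Fin n → List (Fin n)) (dp : Fin n → ℕ) (v : Fin n) : ℕ :=
  (preList ch dp 0).idxOf v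

/-- The node at a position of the preorder. -/
def nodeAt (ch : Fin n → List (Fin n)) (dp : Fin n → ℕ) (i : ℕ) : Fin n :=
  (preList ch dp 0).getD i 0

/-- The entry time of a node in the depth-first traversal. -/
def tinOf (ch : Fin n → List (Fin n)) (dp : Fin n → ℕ) (v : Fin n) : ℕ :=
  2 * preIdx ch dp v - dp v

/-- The exit time of a node in the depth-first traversal. -/
def toutOf (ch : Fin n → List (Fin n)) (dp : Fin n → ℕ) (v : Fin n) : ℕ :=
  tinOf ch dp v + 2 * (preList ch dp v).length - 1

/-- `a` is an ancestor of `v` with respect to the parent function `pa`. -/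
def Anc {V : Type*} (pa : V → V) (a v : V) : Prop := ∃ k, pa^[k] v = a

theorem Anc.refl {V : Type*} (pa : V → V) (v : V) : Anc pa v v := ⟨0, rfl⟩

theorem Anc.parent {V : Type*} (pa : V → V) (v : V) : Anc pa (pa v) v := ⟨1, rfl⟩

theorem Anc.trans {V : Type*} {pa : V → V} {a b c : V} (h : Anc pa a b) (h' : Anc pa b c) :
    Anc pa a c := by
  obtain ⟨k, rfl⟩ := h
  obtain ⟨l, rfl⟩ := h'
  exact ⟨k + l, Function.iterate_add_apply _ _ _ _⟩

/-- A proper ancestor of `v` is an ancestor of the parent of `v`. -/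
theorem Anc.of_ne {V : Type*} {pa : V → V} {a v : V} (h : Anc pa a v) (hne : a ≠ v) :
    Anc pa a (pa v) := by
  obtain ⟨k, rfl⟩ := h
  cases k with
  | zero => exact absurd rfl hne
  | succ k => exact ⟨k, rfl⟩

namespace OTree

variable {ch : Fin n → List (Fin n)} {pa : Fin n → Fin n} {dp : Fin n → ℕ}

theorem dp_child (h : OTree ch pa dp) {v u : Fin n} (hu : u ∈ ch v) : dp u = dp v + 1 := by
  obtain ⟨h0, rfl⟩ := (h.mem v u).1 hu
  exact h.dp_succ u h0

theorem eq_zero_of_dp (h : OTree ch pa dp) {v : Fin n} (hv : dp v = 0) : v = 0 := by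
  by_contra h0
  have := h.dp_succ v h0
  omega

theorem dp_pa (h : OTree ch pa dp) (v : Fin n) : dp (pa v) = dp v - 1 := by
  by_cases h0 : v = 0
  · subst h0; rw [h.pa_zero, h.dp_zero]
  · have := h.dp_succ v h0; omega

theorem dp_iterate (h : OTree ch pa dp) (v : Fin n) (k : ℕ) : dp (pa^[k] v) = dp v - k := by
  induction k with
  | zero => rfl
  | succ k ih => rw [Function.iterate_succ_apply', h.dp_pa, ih]; omega

theorem eq_iterate_of_anc (h : OTree ch pa dp) {a v : Fin n} (ha : Anc pa a v) :
    a = pa^[dp v - dp a] v := by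
  obtain ⟨k, hk⟩ := ha
  have hd := h.dp_iterate v k
  rw [hk] at hd
  by_cases hkd : k ≤ dp v
  · rw [show dp v - dp a = k by omega, hk]
  · have h0 : a = 0 := h.eq_zero_of_dp (by omega)
    refine h0.trans (h.eq_zero_of_dp ?_).symm
    rw [h.dp_iterate]; omega

theorem dp_le_of_anc (h : OTree ch pa dp) {a v : Fin n} (ha : Anc pa a v) : dp a ≤ dp v := by
  obtain ⟨k, rfl⟩ := ha
  rw [h.dp_iterate]; omega

theorem anc_unique (h : OTree ch pa dp) {a b v : Fin n} (ha : Anc pa a v) (hb : Anc pa b v)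
    (hd : dp a = dp b) : a = b := by
  rw [h.eq_iterate_of_anc ha, h.eq_iterate_of_anc hb, hd]

theorem anc_zero (h : OTree ch pa dp) (v : Fin n) : Anc pa 0 v :=
  ⟨dp v, h.eq_zero_of_dp (by rw [h.dp_iterate]; omega)⟩

/-- Passing to a child lowers the difference between the maximal depth and the depth of the node. -/
theorem induction_down (h : OTree ch pa dp) {p : Fin n → Prop}
    (step : ∀ v, (∀ u ∈ ch v, p u) → p v) (v : Fin n) : p v := by
  induction hk : Finset.univ.sup dp - dp v using Nat.strong_induction_on generalizing v with
  | _ k ih =>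
    refine step v fun u hu => ih _ ?_ u rfl
    have := h.dp_child hu
    have := Finset.le_sup (f := dp) (Finset.mem_univ u)
    omega

theorem induction_up (h : OTree ch pa dp) {p : Fin n → Prop} (h0 : p 0)
    (step : ∀ u, u ≠ 0 → p (pa u) → p u) (v : Fin n) : p v := by
  induction hk : dp v using Nat.strong_induction_on generalizing v with
  | _ k ih =>
    by_cases hv : v = 0
    · rwa [hv]
    · refine step v hv (ih _ ?_ _ rfl)
      have := h.dp_succ v hv
      omega

/-- The number of levels allotted in `preList` drops by exactly one from a node to its child, so the
truncated recursion is the true one. -/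
theorem preList_eq (h : OTree ch pa dp) (v : Fin n) :
    preList ch dp v = v :: (ch v).flatMap (preList ch dp) := by
  have hv := Finset.le_sup (f := dp) (Finset.mem_univ v)
  rw [preList, show Finset.univ.sup dp + 1 - dp v = (Finset.univ.sup dp - dp v) + 1 by omega,
    preListAux]
  congr 1
  refine List.flatMap_congr fun u hu => ?_
  rw [preList, h.dp_child hu, show Finset.univ.sup dp + 1 - (dp v + 1) =
    Finset.univ.sup dp - dp v by omega]

theorem self_mem_preList (h : OTree ch pa dp) (v : Fin n) : v ∈ preList ch dp v := by
  rw [h.preList_eq]; exact List.mem_cons_self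

theorem child_mem_preList (h : OTree ch pa dp) (v : Fin n) :
    ∀ y ∈ preList ch dp v, ∀ x ∈ ch y, x ∈ preList ch dp v := by
  refine h.induction_down (p := fun v => ∀ y ∈ preList ch dp v, ∀ x ∈ ch y, x ∈ preList ch dp v)
    (fun v ih y hy x hx => ?_) v
  rw [h.preList_eq v] at hy ⊢
  refine List.mem_cons_of_mem _ (List.mem_flatMap.2 ?_)
  rcases List.mem_cons.1 hy with rfl | hy
  · exact ⟨x, hx, h.self_mem_preList x⟩
  · obtain ⟨u, hu, hyu⟩ := List.mem_flatMap.1 hy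
    exact ⟨u, hu, ih u hu y hyu x hx⟩

theorem mem_preList (h : OTree ch pa dp) {v x : Fin n} :
    x ∈ preList ch dp v ↔ Anc pa v x := by
  constructor
  · revert x
    refine h.induction_down (p := fun v => ∀ {x}, x ∈ preList ch dp v → Anc pa v x)
      (fun v ih x hx => ?_) v
    rw [h.preList_eq v] at hx
    rcases List.mem_cons.1 hx with rfl | hx
    · exact Anc.refl _ _
    · obtain ⟨u, hu, hxu⟩ := List.mem_flatMap.1 hx
      have := (h.mem v u).1 hu
      exact Anc.trans (this.2 ▸ Anc.parent pa u) (ih u hu hxu)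
  · refine h.induction_up (p := fun x => Anc pa v x → x ∈ preList ch dp v) ?_ ?_ x
    · intro hv
      have := h.dp_le_of_anc hv
      rw [h.dp_zero] at this
      rw [h.eq_zero_of_dp (v := v) (by omega)]
      exact h.self_mem_preList 0
    · intro u hu ih hv
      by_cases huv : v = u
      · subst huv; exact h.self_mem_preList _
      · exact h.child_mem_preList v _ (ih (hv.of_ne huv)) u ((h.mem _ _).2 ⟨hu, rfl⟩)

theorem nodup_preList (h : OTree ch pa dp) (v : Fin n) : (preList ch dp v).Nodup := by
  refine h.induction_down (p := fun v => (preList ch dp v).Nodup) (fun v ih => ?_) v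
  rw [h.preList_eq v, List.nodup_cons, List.nodup_flatMap]
  refine ⟨fun hv => ?_, ih, ?_⟩
  · obtain ⟨u, hu, hvu⟩ := List.mem_flatMap.1 hv
    have := h.dp_le_of_anc (h.mem_preList.1 hvu)
    have := h.dp_child hu
    omega
  · refine List.Pairwise.imp_of_mem ?_ (h.nodup v)
    intro u u' hu hu' hne
    rw [Function.onFun, List.disjoint_left]
    intro x hx hx'
    exact hne (h.anc_unique (h.mem_preList.1 hx) (h.mem_preList.1 hx')
      (by rw [h.dp_child hu, h.dp_child hu']))

theorem mem_preList_zero (h : OTree ch pa dp) (v : Fin n) : v ∈ preList ch dp 0 :=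
  h.mem_preList.2 (h.anc_zero v)

theorem length_preList_zero (h : OTree ch pa dp) : (preList ch dp 0).length = n := by
  rw [← List.toFinset_card_of_nodup (h.nodup_preList 0)]
  have : (preList ch dp 0).toFinset = Finset.univ := by
    ext v; simp [h.mem_preList_zero v]
  rw [this, Finset.card_univ, Fintype.card_fin]

theorem preList_segment_child (h : OTree ch pa dp) {v u : Fin n} {a b : List (Fin n)}
    (hv : ch v = a ++ u :: b) : preList ch dp v = (v :: a.flatMap (preList ch dp)) ++
      preList ch dp u ++ b.flatMap (preList ch dp) := by
  rw [h.preList_eq v, hv]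
  simp [List.flatMap_append, List.flatMap_cons]

/-- Descending from the root, the segment of a child lies inside that of its parent. All index
computations below rest on subtrees being intervals of the preorder. -/
theorem exists_segment (h : OTree ch pa dp) (v : Fin n) :
    ∃ l₁ l₂, preList ch dp 0 = l₁ ++ preList ch dp v ++ l₂ := by
  refine h.induction_up (p := fun v => ∃ l₁ l₂, preList ch dp 0 = l₁ ++ preList ch dp v ++ l₂)
    ⟨[], [], by simp⟩ (fun u hu ⟨l₁, l₂, hl⟩ => ?_) v
  obtain ⟨a, b, hab⟩ := List.append_of_mem ((h.mem (pa u) u).2 ⟨hu, rfl⟩)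
  rw [h.preList_segment_child hab] at hl
  exact ⟨l₁ ++ (pa u :: a.flatMap (preList ch dp)), b.flatMap (preList ch dp) ++ l₂,
    by simpa using hl⟩

theorem preIdx_of_segment (h : OTree ch pa dp) {v : Fin n} {l₁ l₂ : List (Fin n)}
    (hl : preList ch dp 0 = l₁ ++ preList ch dp v ++ l₂) : preIdx ch dp v = l₁.length := by
  have hnd := h.nodup_preList 0
  rw [preIdx]
  rw [hl] at hnd ⊢
  rw [h.preList_eq v] at hnd ⊢
  have hv : v ∉ l₁ := by
    rw [List.append_assoc, List.nodup_append] at hnd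
    intro hv
    exact hnd.2.2 v hv v (by simp) rfl
  rw [List.append_assoc, List.idxOf_append_of_notMem hv]
  simp

theorem preIdx_lt (h : OTree ch pa dp) (v : Fin n) : preIdx ch dp v < n := by
  have := List.idxOf_lt_length_iff.2 (h.mem_preList_zero v)
  rwa [h.length_preList_zero] at this

theorem nodeAt_preIdx (h : OTree ch pa dp) (v : Fin n) :
    nodeAt ch dp (preIdx ch dp v) = v := by
  have := List.idxOf_lt_length_iff.2 (h.mem_preList_zero v)
  rw [nodeAt, preIdx, List.getD_eq_getElem _ _ this, List.getElem_idxOf]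

theorem preIdx_nodeAt (h : OTree ch pa dp) {i : ℕ} (hi : i < n) :
    preIdx ch dp (nodeAt ch dp i) = i := by
  have hi' : i < (preList ch dp 0).length := by rwa [h.length_preList_zero]
  rw [nodeAt, List.getD_eq_getElem _ _ hi', preIdx]
  exact (h.nodup_preList 0).idxOf_getElem i hi'

theorem preIdx_inj (h : OTree ch pa dp) {u v : Fin n} (huv : preIdx ch dp u = preIdx ch dp v) :
    u = v := by
  rw [← h.nodeAt_preIdx u, huv, h.nodeAt_preIdx]

theorem preIdx_child (h : OTree ch pa dp) {v u : Fin n} {a b : List (Fin n)}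
    (hv : ch v = a ++ u :: b) :
    preIdx ch dp u = preIdx ch dp v + 1 + (a.flatMap (preList ch dp)).length := by
  obtain ⟨l₁, l₂, hl⟩ := h.exists_segment v
  rw [h.preIdx_of_segment hl]
  rw [h.preList_segment_child hv] at hl
  rw [h.preIdx_of_segment (l₁ := l₁ ++ (v :: a.flatMap (preList ch dp)))
    (l₂ := b.flatMap (preList ch dp) ++ l₂) (by simpa using hl)]
  simp only [List.length_append, List.length_cons]
  omega

theorem preIdx_zero (h : OTree ch pa dp) : preIdx ch dp 0 = 0 :=
  h.preIdx_of_segment (l₁ := []) (l₂ := []) (by simp)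

theorem preIdx_first (h : OTree ch pa dp) {v u : Fin n} {l : List (Fin n)}
    (hv : ch v = u :: l) : preIdx ch dp u = preIdx ch dp v + 1 := by
  simpa using h.preIdx_child (a := []) hv

theorem preIdx_next (h : OTree ch pa dp) {v u u' : Fin n} {l l' : List (Fin n)}
    (hv : ch v = l ++ u :: u' :: l') :
    preIdx ch dp u' = preIdx ch dp u + (preList ch dp u).length := by
  rw [h.preIdx_child hv, h.preIdx_child (a := l ++ [u]) (u := u') (b := l') (by simpa using hv)]
  simp [List.flatMap_append]
  omega

theorem length_preList_last (h : OTree ch pa dp) {v u : Fin n} {l : List (Fin n)}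
    (hv : ch v = l ++ [u]) : preIdx ch dp v + (preList ch dp v).length =
      preIdx ch dp u + (preList ch dp u).length := by
  rw [h.preIdx_child hv, h.preList_eq v, hv]
  simp [List.flatMap_append]
  omega

theorem length_preList_pos (h : OTree ch pa dp) (v : Fin n) : 0 < (preList ch dp v).length :=
  List.length_pos_of_mem (h.self_mem_preList v)

theorem preIdx_pa_lt (h : OTree ch pa dp) {u : Fin n} (hu : u ≠ 0) :
    preIdx ch dp (pa u) < preIdx ch dp u := by
  obtain ⟨a, b, hab⟩ := List.append_of_mem ((h.mem (pa u) u).2 ⟨hu, rfl⟩)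
  rw [h.preIdx_child hab]
  omega

theorem dp_le_preIdx (h : OTree ch pa dp) (v : Fin n) : dp v ≤ preIdx ch dp v := by
  refine h.induction_up (p := fun v => dp v ≤ preIdx ch dp v) ?_ (fun u hu ih => ?_) v
  · rw [h.dp_zero]; omega
  · have := h.preIdx_pa_lt hu
    have := h.dp_succ u hu
    omega

theorem dp_lt (h : OTree ch pa dp) (v : Fin n) : dp v < n :=
  (h.dp_le_preIdx v).trans_lt (h.preIdx_lt v)

/-- The nodes between `v` and its parent in the preorder lie in the subtree of the parent. -/
theorem dp_le_of_between (h : OTree ch pa dp) {u x : Fin n} (hu : u ≠ 0)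
    (h₁ : preIdx ch dp (pa u) < preIdx ch dp x) (h₂ : preIdx ch dp x ≤ preIdx ch dp u) :
    dp u ≤ dp x := by
  obtain ⟨a, b, hab⟩ := List.append_of_mem ((h.mem (pa u) u).2 ⟨hu, rfl⟩)
  obtain ⟨l₁, l₂, hl⟩ := h.exists_segment (pa u)
  have hp := h.preIdx_of_segment hl
  have hxl := List.idxOf_lt_length_iff.2 (h.mem_preList_zero x)
  have hx : (preList ch dp 0)[preIdx ch dp x]'hxl = x := List.getElem_idxOf hxl
  have hlen : preIdx ch dp x < l₁.length + (preList ch dp (pa u)).length := by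
    have := h.preIdx_child hab
    have h3 := congrArg List.length (h.preList_segment_child hab)
    have h4 := h.length_preList_pos u
    simp only [List.length_append, List.length_cons] at h3
    omega
  have hmem : x ∈ preList ch dp (pa u) := by
    rw [← hx]
    simp only [hl]
    rw [List.getElem_append_left (by simpa using hlen), List.getElem_append_right (by omega)]
    exact List.getElem_mem _
  have hanc := h.mem_preList.1 hmem
  have hne : pa u ≠ x := by rintro rfl; omega
  have hx0 : x ≠ 0 := by rintro rfl; rw [h.preIdx_zero] at h₁; omega
  have := h.dp_le_of_anc (hanc.of_ne hne)
  rw [h.dp_succ u hu, h.dp_succ x hx0]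
  omega

/-- Before `v` is entered, `preIdx v` nodes have been entered, and all of these except the `dp v`
proper ancestors of `v` have been left. This also lets the program read the preorder position from
the entry time and the depth. -/
theorem tinOf_add (h : OTree ch pa dp) (v : Fin n) :
    tinOf ch dp v + dp v = 2 * preIdx ch dp v := by
  have := h.dp_le_preIdx v
  rw [tinOf]; omega

/-- Each node of the subtree contributes two events, and leaving `v` is the last of them. -/
theorem toutOf_add (h : OTree ch pa dp) (v : Fin n) :
    toutOf ch dp v + 1 = tinOf ch dp v + 2 * (preList ch dp v).length := by
  have := h.length_preList_pos v
  rw [toutOf]; omega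

theorem isDFSTimes (h : OTree ch pa dp) : IsDFSTimes 0 ch (tinOf ch dp) (toutOf ch dp) where
  root := by rw [tinOf, h.preIdx_zero, Nat.mul_zero, Nat.zero_sub]
  leaf v hv := by
    have := h.toutOf_add v
    rw [h.preList_eq, hv] at this
    simp at this
    omega
  first v u l hv := by
    have := h.preIdx_first hv
    have := h.dp_child (v := v) (u := u) (by simp [hv])
    have := h.tinOf_add v
    have := h.tinOf_add u
    omega
  next v l u u' l' hv := by
    have := h.preIdx_next hv
    have := h.dp_child (v := v) (u := u) (by simp [hv])
    have := h.dp_child (v := v) (u := u') (by simp [hv])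
    have := h.tinOf_add u'
    have := h.tinOf_add u
    have := h.toutOf_add u
    omega
  last v l u hv := by
    have := h.length_preList_last hv
    have := h.dp_child (v := v) (u := u) (by simp [hv])
    have := h.tinOf_add v
    have := h.tinOf_add u
    have := h.toutOf_add u
    have := h.toutOf_add v
    omega

theorem toutOf_zero (h : OTree ch pa dp) : toutOf ch dp 0 + 1 = 2 * n := by
  rw [h.toutOf_add, h.isDFSTimes.root, h.length_preList_zero, zero_add]

theorem tinOf_lt_toutOf (h : OTree ch pa dp) (v : Fin n) : tinOf ch dp v < toutOf ch dp v := by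
  have := h.toutOf_add v
  have := h.length_preList_pos v
  omega

theorem toutOf_lt (h : OTree ch pa dp) (v : Fin n) : toutOf ch dp v < 2 * n := by
  refine h.induction_up (p := fun v => toutOf ch dp v < 2 * n) ?_ (fun u hu ih => ?_) v
  · have := h.toutOf_zero; omega
  · obtain ⟨a, b, hab⟩ := List.append_of_mem ((h.mem (pa u) u).2 ⟨hu, rfl⟩)
    have h1 := h.preIdx_child hab
    have h3 := congrArg List.length (h.preList_segment_child hab)
    have := h.toutOf_add u
    have := h.toutOf_add (pa u)
    have := h.tinOf_add u
    have := h.tinOf_add (pa u)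
    have := h.dp_succ u hu
    simp only [List.length_append, List.length_cons] at h3
    omega

end OTree

end RootedTree

/-! ### The depth-first search -/

namespace RootedTree

/-- The recursive depth-first search with number `p` on the arrays `fc` of first children and `ns` of
next siblings. It fills the arrays `d`, `ti` and `tx` of distances, entry times and exit times. -/
def dfsCmd (p fc ns d ti tx tm : ℕ) : Cmd :=
  .store ti (.var 0) (.load tm (.const 0)) ;;
  .store tm (.const 0) (.op .add (.load tm (.const 0)) (.const 1)) ;;
  .assign 1 (.load fc (.var 0)) ;;
  .loop (.var 1)
    (.store d (.var 1) (.op .add (.load d (.var 0)) (.const 1)) ;;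
     .call 2 p [.var 1] ;;
     .assign 1 (.load ns (.var 1))) ;;
  .store tx (.var 0) (.load tm (.const 0)) ;;
  .store tm (.const 0) (.op .add (.load tm (.const 0)) (.const 1))

variable {n : ℕ} [NeZero n]

omit [NeZero n] in
theorem node_inj {u v : Fin n} : node u = node v ↔ u = v := by
  simp [node, Fin.ext_iff]

/-- The arrays `fc` and `ns` hold the first children and next siblings for the lists `ch`. -/
structure Links (ch : Fin n → List (Fin n)) (fc ns : ℕ) (M : Memory) : Prop where
  first : ∀ v, M fc (node v) = headNode (ch v)
  next : ∀ v l u l', ch v = l ++ u :: l' → M ns (node u) = headNode l'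

/-- The arrays `d`, `ti` and `tx` hold the values of `dp`, `tin` and `tout` at the node `x`. -/
structure DFSDone (dp tin tout : Fin n → ℕ) (d ti tx : ℕ) (M : Memory) (x : Fin n) : Prop where
  dist : M d (node x) = dp x
  tin : M ti (node x) = tin x
  tout : M tx (node x) = tout x

/-- `M'` arises from `M` by writing correct values into the arrays of the depth-first search. -/
structure DFSLe (dp tin tout : Fin n → ℕ) (d ti tx tm : ℕ) (M M' : Memory) : Prop where
  other : ∀ B, B ≠ d → B ≠ ti → B ≠ tx → B ≠ tm → M' B = M B
  dist : ∀ x, M d (node x) = dp x → M' d (node x) = dp x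
  tin : ∀ x, M ti (node x) = tin x → M' ti (node x) = tin x
  tout : ∀ x, M tx (node x) = tout x → M' tx (node x) = tout x

section

variable {dp tin tout : Fin n → ℕ} {d ti tx tm fc ns : ℕ} {ch : Fin n → List (Fin n)}
  {M M' M'' : Memory}

omit [NeZero n] in
theorem DFSLe.trans (h : DFSLe dp tin tout d ti tx tm M M')
    (h' : DFSLe dp tin tout d ti tx tm M' M'') : DFSLe dp tin tout d ti tx tm M M'' where
  other B h1 h2 h3 h4 := (h'.other B h1 h2 h3 h4).trans (h.other B h1 h2 h3 h4)
  dist x hx := h'.dist x (h.dist x hx)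
  tin x hx := h'.tin x (h.tin x hx)
  tout x hx := h'.tout x (h.tout x hx)

omit [NeZero n] in
theorem DFSLe.done (h : DFSLe dp tin tout d ti tx tm M M') {x : Fin n}
    (hx : DFSDone dp tin tout d ti tx M x) : DFSDone dp tin tout d ti tx M' x :=
  ⟨h.dist x hx.dist, h.tin x hx.tin, h.tout x hx.tout⟩

omit [NeZero n] in
theorem write_correct {A : ℕ} {f : Fin n → ℕ} (M : Memory) (v x : Fin n)
    (hx : M A (node x) = f x) : M.write A (node v) (f v) A (node x) = f x := by
  by_cases h : x = v
  · subst h; rw [Memory.write_same]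
  · rw [Memory.write_index_ne _ _ _ (fun h' => h (node_inj.1 h')), hx]

omit [NeZero n] in
theorem DFSLe.write_dist (M : Memory) (v : Fin n) (h₁ : d ≠ ti) (h₂ : d ≠ tx) :
    DFSLe dp tin tout d ti tx tm M (M.write d (node v) (dp v)) where
  other B h1 _ _ _ := Memory.write_row_ne _ _ _ h1
  dist x hx := write_correct M v x hx
  tin x hx := by rw [Memory.write_row_ne _ _ _ h₁.symm, hx]
  tout x hx := by rw [Memory.write_row_ne _ _ _ h₂.symm, hx]

omit [NeZero n] in
theorem DFSLe.write_tin (M : Memory) (v : Fin n) (h₁ : ti ≠ d) (h₂ : ti ≠ tx) :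
    DFSLe dp tin tout d ti tx tm M (M.write ti (node v) (tin v)) where
  other B _ h1 _ _ := Memory.write_row_ne _ _ _ h1
  dist x hx := by rw [Memory.write_row_ne _ _ _ h₁.symm, hx]
  tin x hx := write_correct M v x hx
  tout x hx := by rw [Memory.write_row_ne _ _ _ h₂.symm, hx]

omit [NeZero n] in
theorem DFSLe.write_tout (M : Memory) (v : Fin n) (h₁ : tx ≠ d) (h₂ : tx ≠ ti) :
    DFSLe dp tin tout d ti tx tm M (M.write tx (node v) (tout v)) where
  other B _ _ h1 _ := Memory.write_row_ne _ _ _ h1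
  dist x hx := by rw [Memory.write_row_ne _ _ _ h₁.symm, hx]
  tin x hx := by rw [Memory.write_row_ne _ _ _ h₂.symm, hx]
  tout x hx := write_correct M v x hx

omit [NeZero n] in
theorem DFSLe.write_timer (M : Memory) (i x : ℕ) (h₁ : tm ≠ d) (h₂ : tm ≠ ti) (h₃ : tm ≠ tx) :
    DFSLe dp tin tout d ti tx tm M (M.write tm i x) where
  other B _ _ _ h1 := Memory.write_row_ne _ _ _ h1
  dist x hx := by rw [Memory.write_row_ne _ _ _ h₁.symm, hx]
  tin x hx := by rw [Memory.write_row_ne _ _ _ h₂.symm, hx]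
  tout x hx := by rw [Memory.write_row_ne _ _ _ h₃.symm, hx]

omit [NeZero n] in
theorem DFSLe.links (h : DFSLe dp tin tout d ti tx tm M M')
    (hnd : [fc, ns, d, ti, tx, tm].Nodup) (hl : Links ch fc ns M) : Links ch fc ns M' := by
  simp only [List.nodup_cons, List.mem_cons, not_or, List.not_mem_nil, not_false_eq_true,
    and_true] at hnd
  obtain ⟨⟨-, a1, a2, a3, a4⟩, ⟨b1, b2, b3, b4⟩, -⟩ := hnd
  have h1 := h.other fc a1 a2 a3 a4
  have h2 := h.other ns b1 b2 b3 b4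
  exact ⟨fun v => by rw [h1, hl.first], fun v l u l' hv => by rw [h2, hl.next v l u l' hv]⟩

end

/-- Induction over subtrees, with an inner induction over the children still to be visited. Time is
charged to the timer at 40 steps per tick. The `13` set aside is what a loop round of the caller
spends besides the body of the call: 2 for the test, 6 for the distance, 2 for the call, 3 for the
next sibling. With it, the bounds telescope along the siblings. `DFSLe` guarantees that a finished
subtree stays correct while later ones are searched. -/
theorem dfs_exec {P : Program} {w p fc ns d ti tx tm : ℕ} {ch : Fin n → List (Fin n)}
    {pa : Fin n → Fin n} {dp tin tout : Fin n → ℕ}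
    (hP : P[p]? = some (dfsCmd p fc ns d ti tx tm)) (hnd : [fc, ns, d, ti, tx, tm].Nodup)
    (hw : 4 * n < 2 ^ w) (h : OTree ch pa dp) (ht : IsDFSTimes 0 ch tin tout)
    (htio : ∀ v, tin v < tout v) (hto : ∀ v, tout v < 2 * n) (v : Fin n) :
    ∀ M, Links ch fc ns M → M tm 0 = tin v → M d (node v) = dp v →
      ∃ t L' M', Exec P w (dfsCmd p fc ns d ti tx tm) (frame [node v]) M t L' M' ∧
        t + 13 + 40 * tin v ≤ 40 * (tout v + 1) ∧ M' tm 0 = tout v + 1 ∧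
        DFSLe dp tin tout d ti tx tm M M' ∧
        ∀ x, Anc pa v x → DFSDone dp tin tout d ti tx M' x := by
  have hn : 0 < n := Nat.pos_of_ne_zero (NeZero.ne n)
  have hnd' := hnd
  simp only [List.nodup_cons, List.mem_cons, not_or, List.not_mem_nil, not_false_eq_true,
    and_true] at hnd'
  obtain ⟨⟨f0, f1, f2, f3, f4⟩, ⟨n1, n2, n3, n4⟩, ⟨d1, d2, d3⟩, ⟨t1, t2⟩, o1, -⟩ := hnd'
  have inc : ∀ (L : Locals) (M : Memory), M tm 0 < 2 * n →
      Exec P w (.store tm (.const 0) (.op .add (.load tm (.const 0)) (.const 1))) L M 6 L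
        (M.write tm 0 (M tm 0 + 1)) := by
    intro L M hM
    have e := Exec.store (P := P) (w := w) tm (.const 0)
      (.op .add (.load tm (.const 0)) (.const 1)) L M
    rwa [eval_add (eval_load (eval_const (by omega))) (eval_const (by omega)) (by omega),
      eval_const (by omega)] at e
  refine h.induction_down (p := fun v => ∀ M, Links ch fc ns M → M tm 0 = tin v →
      M d (node v) = dp v →
      ∃ t L' M', Exec P w (dfsCmd p fc ns d ti tx tm) (frame [node v]) M t L' M' ∧
        t + 13 + 40 * tin v ≤ 40 * (tout v + 1) ∧ M' tm 0 = tout v + 1 ∧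
        DFSLe dp tin tout d ti tx tm M M' ∧
        ∀ x, Anc pa v x → DFSDone dp tin tout d ti tx M' x) (fun v ih => ?_) v
  have loop : ∀ (l' l : List (Fin n)), ch v = l ++ l' → ∀ (L : Locals) (M : Memory),
      Links ch fc ns M → L 0 = node v → L 1 = headNode l' → M d (node v) = dp v →
      (l' = [] → M tm 0 = tout v) → (∀ u l'', l' = u :: l'' → M tm 0 = tin u) →
      ∃ t L' M', Exec P w (.loop (.var 1)
          (.store d (.var 1) (.op .add (.load d (.var 0)) (.const 1)) ;;
          .call 2 p [.var 1] ;; .assign 1 (.load ns (.var 1)))) L M t L' M' ∧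
        t + 40 * M tm 0 ≤ 40 * tout v + 2 ∧ L' 0 = node v ∧ M' tm 0 = tout v ∧
        DFSLe dp tin tout d ti tx tm M M' ∧
        ∀ u ∈ l', ∀ x, Anc pa u x → DFSDone dp tin tout d ti tx M' x := by
    intro l'
    induction l' with
    | nil =>
      intro l hl L M hM h0 h1 hd htm _
      refine ⟨_, _, _, .loopFalse ?_, ?_, h0, htm rfl, ?_, by simp⟩
      · simpa [Term.eval, headNode] using h1
      · rw [htm rfl]; simp [Term.cost]; omega
      · exact ⟨fun _ _ _ _ _ => rfl, fun _ h => h, fun _ h => h, fun _ h => h⟩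
    | cons u l'' ihl =>
      intro l hl L M hM h0 h1 hd _ htm
      have htu := htm u l'' rfl
      have hu : u ∈ ch v := by simp [hl]
      have hdu := h.dp_child hu
      have hdn := h.dp_lt u
      have e₁ := Exec.store (P := P) (w := w) d (.var 1)
        (.op .add (.load d (.var 0)) (.const 1)) L M
      have hL1 : (Term.var 1).eval w L M = node u := h1
      have hL0 : (Term.var 0).eval w L M = node v := h0
      rw [eval_add (x := dp v) (y := 1) ((eval_load hL0).trans hd) (eval_const (by omega))
        (by omega), hL1, ← hdu] at e₁
      have le₁ := DFSLe.write_dist (dp := dp) (tin := tin) (tout := tout) (tm := tm) M u d1 d2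
      obtain ⟨t, L₂, M₂, e₂, ht₂, htm₂, le₂, hdone⟩ := ih u hu (M.write d (node u) (dp u))
        (le₁.links hnd hM) (by rw [Memory.write_row_ne _ _ _ (Ne.symm d3), htu])
        (Memory.write_same _ _ _ _)
      have e₃ := Exec.call (x := 2) (args := [.var 1]) (L := L) hP
        (by simpa [Term.eval, h1, headNode] using e₂)
      have e₄ := Exec.assign (P := P) (w := w) 1 (.load ns (.var 1))
        (Function.update L 2 (L₂ 0)) M₂
      have le₁₂ := le₁.trans le₂
      have hM₂ := le₁₂.links hnd hM
      have hns : (Term.load ns (.var 1)).eval w (Function.update L 2 (L₂ 0)) M₂ = headNode l'' := by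
        rw [eval_load (x := node u) (by simpa [Term.eval, headNode] using h1),
          hM₂.next v l u l'' hl]
      rw [hns] at e₄
      obtain ⟨t', L₅, M₅, e₅, ht₅, hL₅, htm₅, le₅, hdone₅⟩ := ihl (l ++ [u]) (by simpa using hl)
        (Function.update (Function.update L 2 (L₂ 0)) 1 (headNode l'')) M₂ hM₂
        (by simpa using h0) (by simp) (le₁₂.dist v hd)
        (fun hnil => by rw [htm₂, ht.last v l u (by simpa [hnil] using hl)])
        (fun u' l₃ h3 => by rw [htm₂, ht.next v l u u' l₃ (by simpa [h3] using hl)])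
      refine ⟨_, _, _, .loopTrue ?_ (.seq e₁ (.seq e₃ e₄)) e₅, ?_, hL₅, htm₅,
        le₁₂.trans le₅, ?_⟩
      · rw [hL1]; simp [node]
      · simp only [Term.cost, List.map_cons, List.map_nil, List.sum_cons, List.sum_nil]
        rw [htm₂] at ht₅
        rw [htu]
        omega
      · intro y hy x hx
        rcases List.mem_cons.1 hy with rfl | hy
        · exact le₅.done (hdone x hx)
        · exact hdone₅ y hy x hx
  intro M hM htm hd
  have hlt := htio v
  have hlt' := hto v
  have e₁ := Exec.store (P := P) (w := w) ti (.var 0) (.load tm (.const 0)) (frame [node v]) M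
  rw [eval_load (eval_const (by omega)), htm, show (Term.var 0).eval w (frame [node v]) M = node v
    from rfl] at e₁
  have le₁ := DFSLe.write_tin (dp := dp) (tin := tin) (tout := tout) (tm := tm) M v
    (Ne.symm d1) t1
  set M₁ := M.write ti (node v) (tin v) with hM₁
  have htm₁ : M₁ tm 0 = tin v := by rw [hM₁, Memory.write_row_ne _ _ _ (Ne.symm t2), htm]
  have e₂ := inc (frame [node v]) M₁ (by omega)
  have le₂ := DFSLe.write_timer (dp := dp) (tin := tin) (tout := tout) M₁ 0 (M₁ tm 0 + 1)
    (Ne.symm d3) (Ne.symm t2) (Ne.symm o1)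
  rw [htm₁] at e₂ le₂
  have hti₁ : M₁ ti (node v) = tin v := Memory.write_same _ _ _ _
  have hti₂ := le₂.tin v hti₁
  have hd₂ := le₂.dist v (le₁.dist v hd)
  have htm₂ : M₁.write tm 0 (tin v + 1) tm 0 = tin v + 1 := Memory.write_same _ _ _ _
  set M₂ := M₁.write tm 0 (tin v + 1) with hM₂
  have hl₂ := (le₁.trans le₂).links hnd hM
  have e₃ := Exec.assign (P := P) (w := w) 1 (.load fc (.var 0)) (frame [node v]) M₂
  rw [eval_load (x := node v) (show (Term.var 0).eval w (frame [node v]) M₂ = node v from rfl),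
    hl₂.first] at e₃
  obtain ⟨t, L₄, M₄, e₄, ht₄, hL₄, htm₄, le₄, hdone₄⟩ := loop (ch v) [] rfl
    (Function.update (frame [node v]) 1 (headNode (ch v))) M₂ hl₂ (by simp [frame]) (by simp)
    hd₂ (fun hnil => by rw [htm₂, ht.leaf v hnil])
    (fun u l hu => by rw [htm₂, ht.first v u l hu])
  have e₅ := Exec.store (P := P) (w := w) tx (.var 0) (.load tm (.const 0)) L₄ M₄
  rw [eval_load (eval_const (by omega)), htm₄, show (Term.var 0).eval w L₄ M₄ = node v
    from hL₄] at e₅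
  have le₅ := DFSLe.write_tout (dp := dp) (tin := tin) (tout := tout) (tm := tm) M₄ v
    (Ne.symm d2) (Ne.symm t1)
  have hto₅ : M₄.write tx (node v) (tout v) tx (node v) = tout v := Memory.write_same _ _ _ _
  have htm₅ : M₄.write tx (node v) (tout v) tm 0 = tout v := by
    rw [Memory.write_row_ne _ _ _ (Ne.symm o1), htm₄]
  set M₅ := M₄.write tx (node v) (tout v)
  have e₆ := inc L₄ M₅ (by omega)
  have le₆ := DFSLe.write_timer (dp := dp) (tin := tin) (tout := tout) M₅ 0 (M₅ tm 0 + 1)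
    (Ne.symm d3) (Ne.symm t2) (Ne.symm o1)
  rw [htm₅] at e₆ le₆
  have le₄₆ := le₄.trans (le₅.trans le₆)
  refine ⟨_, _, _, .seq e₁ (.seq e₂ (.seq e₃ (.seq e₄ (.seq e₅ e₆)))), ?_,
    Memory.write_same _ _ _ _, le₁.trans (le₂.trans le₄₆), ?_⟩
  · simp only [Term.cost]
    rw [htm₂] at ht₄
    omega
  · intro x hx
    by_cases hxv : v = x
    · subst hxv
      exact ⟨le₄₆.dist v hd₂, le₄₆.tin v hti₂, le₆.tout v hto₅⟩
    · have hx0 : x ≠ 0 := by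
        rintro rfl
        have := h.dp_le_of_anc hx
        rw [h.dp_zero] at this
        exact hxv (h.eq_zero_of_dp (by omega))
      obtain ⟨k, hk⟩ := hx.of_ne hxv
      have : ∃ u ∈ ch v, Anc pa u x := by
        have hne := h.eq_iterate_of_anc hx
        have hle := h.dp_le_of_anc hx
        have hdne : dp v ≠ dp x := fun h' => hxv (h.anc_unique hx (Anc.refl pa x) h')
        -- The child of `v` towards `x` is the ancestor of `x` one level below `v`.
        refine ⟨pa^[dp x - dp v - 1] x, ?_, _, rfl⟩
        rw [h.mem]
        constructor
        · intro h0
          have := h.dp_iterate x (dp x - dp v - 1)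
          rw [h0, h.dp_zero] at this
          omega
        · rw [← Function.iterate_succ_apply' (f := pa)]
          rw [show (dp x - dp v - 1).succ = dp x - dp v by omega, ← hne]
      obtain ⟨u, hu, hux⟩ := this
      exact (le₅.trans le₆).done (hdone₄ u hu x hux)

/-- The depth-first search from the root. -/
theorem computes_dfs {P : Program} {w p fc ns d ti tx tm x : ℕ} {ch : Fin n → List (Fin n)}
    {pa : Fin n → Fin n} {dp : Fin n → ℕ}
    (hP : P[p]? = some (dfsCmd p fc ns d ti tx tm)) (hnd : [fc, ns, d, ti, tx, tm].Nodup)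
    (hw : 4 * n < 2 ^ w) (h : OTree ch pa dp) {I : Memory → Prop}
    (hI : ∀ M, I M → Links ch fc ns M)
    (hframe : ∀ M M', (∀ B, B ≠ d → B ≠ ti → B ≠ tx → B ≠ tm → M' B = M B) → I M → I M') :
    Computes P w (.store tm (.const 0) (.const 0) ;; .store d (.const 1) (.const 0) ;;
      .call x p [.const 1]) (100 * n) I
      (fun M => I M ∧ ∀ v, DFSDone dp (tinOf ch dp) (toutOf ch dp) d ti tx M v) := by
  have hn : 0 < n := Nat.pos_of_ne_zero (NeZero.ne n)
  intro L M hL hM hIM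
  have hnd' := hnd
  simp only [List.nodup_cons, List.mem_cons, not_or, List.not_mem_nil, not_false_eq_true,
    and_true] at hnd'
  obtain ⟨⟨f0, f1, f2, f3, f4⟩, ⟨n1, n2, n3, n4⟩, ⟨d1, d2, d3⟩, ⟨t1, t2⟩, o1, -⟩ := hnd'
  have e₁ := Exec.store (P := P) (w := w) tm (.const 0) (.const 0) L M
  rw [eval_const (by omega)] at e₁
  have e₂ := Exec.store (P := P) (w := w) d (.const 1) (.const 0) L (M.write tm 0 0)
  rw [eval_const (by omega), eval_const (by omega)] at e₂
  have hfr : ∀ B, B ≠ d → B ≠ ti → B ≠ tx → B ≠ tm →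
      ((M.write tm 0 0).write d 1 0) B = M B := fun B h1 _ _ h4 => by
    rw [Memory.write_row_ne _ _ _ h1, Memory.write_row_ne _ _ _ h4]
  have hnode : node (0 : Fin n) = 1 := by simp [node]
  obtain ⟨t, L', M', e₃, ht, htm, hle, hdone⟩ := dfs_exec hP hnd hw h h.isDFSTimes
    h.tinOf_lt_toutOf h.toutOf_lt 0 ((M.write tm 0 0).write d 1 0)
    (hI _ (hframe _ _ hfr hIM))
    (by rw [Memory.write_row_ne _ _ _ (Ne.symm d3), Memory.write_same, h.isDFSTimes.root])
    (by rw [hnode, Memory.write_same, h.dp_zero])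
  have e₄ := Exec.call (w := w) (x := x) (args := [.const 1]) (L := L)
    (M := (M.write tm 0 0).write d 1 0) hP (by simpa [eval_const (show 1 < 2 ^ w by omega), hnode] using e₃)
  refine ⟨_, _, _, .seq e₁ (.seq e₂ e₄), ?_, hframe M M' (fun B h1 h2 h3 h4 => ?_) hIM,
    fun v => hdone v (h.anc_zero v)⟩
  · have := h.toutOf_zero
    simp only [Term.cost, List.map_cons, List.map_nil, List.sum_cons, List.sum_nil]
    omega
  · rw [hle.other B h1 h2 h3 h4, hfr B h1 h2 h3 h4]

end RootedTree

/-! ### Moving the highest child to the front -/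

namespace RootedTree

variable {n : ℕ} [NeZero n]

open Classical in
/-- The largest depth of a node in the subtree of `v`. -/
noncomputable def maxDepth (pa : Fin n → Fin n) (dp : Fin n → ℕ) (v : Fin n) : ℕ :=
  (Finset.univ.filter (Anc pa v)).sup dp

/-- The first node of the list `v :: l` with the largest value of `f`. -/
def bestOf (f : Fin n → ℕ) : Fin n → List (Fin n) → Fin n
  | v, [] => v
  | v, u :: l => if f v < f (bestOf f u l) then bestOf f u l else v

omit [NeZero n] in
theorem bestOf_mem (f : Fin n → ℕ) (v : Fin n) (l : List (Fin n)) : bestOf f v l ∈ v :: l := by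
  induction l generalizing v with
  | nil => simp [bestOf]
  | cons u l ih =>
    rw [bestOf]
    split_ifs
    · exact List.mem_cons_of_mem _ (ih u)
    · exact List.mem_cons_self

omit [NeZero n] in
theorem le_bestOf (f : Fin n → ℕ) (v : Fin n) (l : List (Fin n)) :
    ∀ x ∈ v :: l, f x ≤ f (bestOf f v l) := by
  induction l generalizing v with
  | nil => simp [bestOf]
  | cons u l ih =>
    intro x hx
    rw [bestOf]
    rcases List.mem_cons.1 hx with rfl | hx
    · split_ifs <;> omega
    · have := ih u x hx
      split_ifs <;> omega

/-- The list `l` with its best element moved to the front. -/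
def bestFirst (f : Fin n → ℕ) : List (Fin n) → List (Fin n)
  | [] => []
  | u :: l => bestOf f u l :: (u :: l).erase (bestOf f u l)

omit [NeZero n] in
theorem bestFirst_perm (f : Fin n → ℕ) (l : List (Fin n)) : (bestFirst f l).Perm l := by
  cases l with
  | nil => exact List.Perm.refl _
  | cons u l => exact (List.perm_cons_erase (bestOf_mem f u l)).symm

/-- The siblings after `v`. -/
def laterSibs (ch : Fin n → List (Fin n)) (pa : Fin n → Fin n) (v : Fin n) : List (Fin n) :=
  if v = 0 then [] else ((ch (pa v)).dropWhile (· ≠ v)).tail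

theorem laterSibs_zero (ch : Fin n → List (Fin n)) (pa : Fin n → Fin n) :
    laterSibs ch pa 0 = [] := by simp [laterSibs]

namespace OTree

variable {ch : Fin n → List (Fin n)} {pa : Fin n → Fin n} {dp : Fin n → ℕ}

theorem laterSibs_eq (h : OTree ch pa dp) {p v : Fin n} {l l' : List (Fin n)}
    (hp : ch p = l ++ v :: l') : laterSibs ch pa v = l' := by
  have hv := (h.mem p v).1 (by simp [hp])
  have hnd := h.nodup p
  rw [hp, List.nodup_append] at hnd
  rw [laterSibs, if_neg hv.1, hv.2, hp, List.dropWhile_append_of_pos]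
  · simp
  · intro a ha
    simpa using hnd.2.2 a ha v (by simp)

theorem exists_laterSibs (h : OTree ch pa dp) {v : Fin n} (hv : v ≠ 0) :
    ∃ l, ch (pa v) = l ++ v :: laterSibs ch pa v := by
  obtain ⟨a, b, hab⟩ := List.append_of_mem ((h.mem (pa v) v).2 ⟨hv, rfl⟩)
  exact ⟨a, by rw [h.laterSibs_eq hab, hab]⟩

theorem laterSibs_cons (h : OTree ch pa dp) {v u : Fin n} {l : List (Fin n)}
    (hv : laterSibs ch pa v = u :: l) :
    laterSibs ch pa u = l ∧ preIdx ch dp v < preIdx ch dp u := by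
  have h0 : v ≠ 0 := by rintro rfl; simp [laterSibs] at hv
  obtain ⟨a, ha⟩ := h.exists_laterSibs h0
  rw [hv] at ha
  have := h.preIdx_next ha
  have := h.length_preList_pos v
  exact ⟨h.laterSibs_eq (l := a ++ [v]) (by simpa using ha), by omega⟩

omit [NeZero n] in
theorem dp_le_maxDepth_of_anc {v x : Fin n} (hx : Anc pa v x) : dp x ≤ maxDepth pa dp v :=
  Finset.le_sup (f := dp) (by simpa using hx)

omit [NeZero n] in
theorem maxDepth_le_of_anc {v x : Fin n} (hx : Anc pa v x) :
    maxDepth pa dp x ≤ maxDepth pa dp v :=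
  Finset.sup_mono fun y hy => by
    simp only [Finset.mem_filter, Finset.mem_univ, true_and] at hy ⊢
    exact hx.trans hy

theorem exists_child_of_anc (h : OTree ch pa dp) {v x : Fin n} (hx : Anc pa v x) (hne : v ≠ x) :
    ∃ u ∈ ch v, Anc pa u x := by
  have := h.mem_preList.2 hx
  rw [h.preList_eq] at this
  rcases List.mem_cons.1 this with rfl | h'
  · exact absurd rfl hne
  · obtain ⟨u, hu, hxu⟩ := List.mem_flatMap.1 h'
    exact ⟨u, hu, h.mem_preList.1 hxu⟩

theorem maxDepth_nil (h : OTree ch pa dp) {v : Fin n} (hv : ch v = []) :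
    maxDepth pa dp v = dp v := by
  refine le_antisymm (Finset.sup_le fun x hx => ?_) (dp_le_maxDepth_of_anc (Anc.refl _ _))
  simp only [Finset.mem_filter, Finset.mem_univ, true_and] at hx
  by_cases hne : v = x
  · rw [hne]
  · obtain ⟨u, hu, -⟩ := h.exists_child_of_anc hx hne
    simp [hv] at hu

/-- A deepest node below `v` lies below some child, because `v` itself is less deep than any of its
children; the best child attains the maximum. -/
theorem maxDepth_cons (h : OTree ch pa dp) {v u : Fin n} {l : List (Fin n)} (hv : ch v = u :: l) :
    maxDepth pa dp v = maxDepth pa dp (bestOf (maxDepth pa dp) u l) := by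
  have hanc : ∀ x ∈ ch v, Anc pa v x := fun x hx => ((h.mem v x).1 hx).2 ▸ Anc.parent pa x
  refine le_antisymm (Finset.sup_le fun x hx => ?_) (maxDepth_le_of_anc (hanc _ ?_))
  · simp only [Finset.mem_filter, Finset.mem_univ, true_and] at hx
    by_cases hne : v = x
    · subst hne
      have h1 := h.dp_child (v := v) (u := u) (by simp [hv])
      have h2 : dp u ≤ maxDepth pa dp u := dp_le_maxDepth_of_anc (Anc.refl pa u)
      have h3 := le_bestOf (maxDepth pa dp) u l u (by simp)
      omega
    · obtain ⟨y, hy, hyx⟩ := h.exists_child_of_anc hx hne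
      have h2 : dp x ≤ maxDepth pa dp y := dp_le_maxDepth_of_anc hyx
      exact h2.trans (le_bestOf (maxDepth pa dp) u l y (by rwa [← hv]))
  · rw [hv]; exact bestOf_mem _ _ _

theorem bestFirst (h : OTree ch pa dp) (f : Fin n → ℕ) :
    OTree (fun v => bestFirst f (ch v)) pa dp where
  nodup v := (bestFirst_perm f (ch v)).nodup_iff.2 (h.nodup v)
  mem v u := by rw [← h.mem v u]; exact (bestFirst_perm f (ch v)).mem_iff
  pa_zero := h.pa_zero
  dp_zero := h.dp_zero
  dp_succ := h.dp_succ

/-- The next sibling of a node after the best child has been moved to the front. -/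
theorem headNode_bestFirst (h : OTree ch pa dp) {f : Fin n → ℕ} {v c u : Fin n}
    {cs l l' : List (Fin n)} (hc : ch v = c :: cs)
    (hu : RootedTree.bestFirst f (ch v) = l ++ u :: l') :
    headNode l' = if u = bestOf f c cs then
        if c = u then headNode (laterSibs ch pa u) else node c
      else if headNode (laterSibs ch pa u) = node (bestOf f c cs) then
        headNode (laterSibs ch pa (bestOf f c cs)) else headNode (laterSibs ch pa u) := by
  have hnd := h.nodup v
  have hb := bestOf_mem f c cs
  rw [hc, RootedTree.bestFirst] at hu
  rw [hc] at hnd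
  set b := bestOf f c cs with hbdef
  cases l with
  | nil =>
    simp only [List.nil_append, List.cons.injEq] at hu
    obtain ⟨rfl, rfl⟩ := hu
    rw [if_pos rfl]
    split_ifs with hcb
    · rw [← hcb, h.laterSibs_eq (l := []) hc]
      simp
    · rw [List.erase_cons_tail (by simpa using hcb)]
      rfl
  | cons x l₁ =>
    simp only [List.cons_append, List.cons.injEq] at hu
    obtain ⟨-, hu⟩ := hu
    obtain ⟨p, q, hp, hpq, her⟩ := List.exists_erase_eq hb
    rw [her] at hu
    have hcv : ch v = p ++ b :: q := by rw [hc, hpq]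
    rw [hpq] at hnd
    have hbq : b ∉ q := by
      rw [List.nodup_append] at hnd
      exact (List.nodup_cons.1 hnd.2.1).1
    have hub : u ≠ b := by
      rintro rfl
      have : b ∈ p ++ q := by rw [hu]; simp
      rcases List.mem_append.1 this with h' | h'
      · exact hp h'
      · exact hbq h'
    have hhead : ∀ {r : List (Fin n)}, b ∉ r → headNode r ≠ node b := by
      intro r hr
      cases r with
      | nil => simp [headNode, node]
      | cons y r =>
        rw [headNode, Ne, node_inj]
        rintro rfl
        exact hr (by simp)
    rw [if_neg hub]
    -- The old list is `p ++ b :: q` with `b` removed from the middle. If `u` lies in `q`, nothing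
    -- after it changes. If `u` lies in `p`, its successor changes only when `u` is the last element
    -- of `p`, and then `b` is skipped.
    rcases List.append_eq_append_iff.1 hu with ⟨a', ha, hq⟩ | ⟨a', ha, hq⟩
    · have hv : ch v = (p ++ b :: a') ++ u :: l' := by rw [hcv, hq]; simp
      have hbl : b ∉ l' := fun hb' => hbq (by rw [hq]; simp [hb'])
      rw [h.laterSibs_eq hv, if_neg (hhead hbl)]
    · cases a' with
      | nil =>
        simp only [List.nil_append] at hq
        have hv : ch v = (p ++ [b]) ++ u :: l' := by rw [hcv, hq]; simp
        have hbl : b ∉ l' := fun hb' => hbq (by rw [← hq]; simp [hb'])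
        rw [h.laterSibs_eq hv, if_neg (hhead hbl)]
      | cons y a' =>
        simp only [List.cons_append, List.cons.injEq] at hq
        obtain ⟨rfl, rfl⟩ := hq
        have hv : ch v = l₁ ++ u :: (a' ++ b :: q) := by rw [hcv, ha]; simp
        rw [h.laterSibs_eq hv]
        cases a' with
        | nil =>
          rw [List.nil_append, List.nil_append, if_pos (by rfl), h.laterSibs_eq hcv]
        | cons y a' =>
          have hyb : y ≠ b := by
            rintro rfl
            exact hp (by rw [ha]; simp)
          rw [if_neg (by simpa [headNode, node_inj] using hyb)]
          rfl

end OTree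

end RootedTree

/-! ### Depth sequences -/

namespace RootedTree

/-- The depths `D`, the parents `par` and the heights `ht` of the nodes `0, …, n - 1` of a tree,
numbered in a preorder in which the first child of each node has the largest height. -/
structure DepthSeq (n : ℕ) (D par ht : ℕ → ℕ) : Prop where
  par_zero : par 0 = 0
  D_zero : D 0 = 0
  par_lt : ∀ i, 0 < i → i < n → par i < i
  D_succ : ∀ i, 0 < i → i < n → D i = D (par i) + 1
  gap : ∀ i j, 0 < i → i < n → par i < j → j ≤ i → D i ≤ D j
  ht_par : ∀ i, 0 < i → i < n → ht i + 1 ≤ ht (par i)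
  ht_first : ∀ i, i < n → 0 < ht i → i + 1 < n ∧ par (i + 1) = i ∧ ht (i + 1) + 1 = ht i

/-- `m` is the minimum of `D` on the interval from `l` to `j`. -/
def IsMin (D : ℕ → ℕ) (l j m : ℕ) : Prop :=
  (∃ k, l ≤ k ∧ k ≤ j ∧ D k = m) ∧ ∀ k, l ≤ k → k ≤ j → m ≤ D k

theorem IsMin.unique {D : ℕ → ℕ} {l j m m' : ℕ} (h : IsMin D l j m) (h' : IsMin D l j m') :
    m = m' := by
  obtain ⟨⟨k, h1, h2, rfl⟩, h3⟩ := h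
  obtain ⟨⟨k', h4, h5, rfl⟩, h6⟩ := h'
  exact le_antisymm (h3 _ h4 h5) (h6 _ h1 h2)

theorem IsMin.union {D : ℕ → ℕ} {l e l' j m m' : ℕ} (h : IsMin D l e m) (h' : IsMin D l' j m')
    (h₁ : l ≤ l') (h₂ : l' ≤ e + 1) (h₃ : e ≤ j) : IsMin D l j (min m m') := by
  obtain ⟨⟨k, a1, a2, a3⟩, a4⟩ := h
  obtain ⟨⟨k', b1, b2, b3⟩, b4⟩ := h'
  constructor
  · rcases le_total m m' with hm | hm
    · exact ⟨k, a1, by omega, by omega⟩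
    · exact ⟨k', by omega, b2, by omega⟩
  · intro i hi hi'
    by_cases h : i ≤ e
    · exact (min_le_left _ _).trans (a4 i hi h)
    · exact (min_le_right _ _).trans (b4 i (by omega) hi')

/-! ### Selecting set bits -/

/-- The position of the set bit number `k` of `m`, where the bits are counted from the lowest. -/
def selBit (m k : ℕ) : ℕ :=
  if m = 0 then 0
  else if m % 2 = 1 then if k = 0 then 0 else selBit (m / 2) (k - 1) + 1
  else selBit (m / 2) k + 1
termination_by m
decreasing_by all_goals omega

/-- The number of set bits. -/
def bitCount (m : ℕ) : ℕ := if m = 0 then 0 else m % 2 + bitCount (m / 2)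
termination_by m
decreasing_by omega

theorem selBit_le (m : ℕ) : ∀ k, selBit m k ≤ m := by
  induction m using Nat.strong_induction_on with
  | _ m ih =>
    intro k
    rw [selBit]
    split_ifs with h1 h2 h3
    · omega
    · omega
    · have := ih (m / 2) (by omega) (k - 1); omega
    · have := ih (m / 2) (by omega) k; omega

theorem bitCount_zero : bitCount 0 = 0 := by rw [bitCount]; simp

theorem bitCount_pos {m : ℕ} (h : m ≠ 0) : 0 < bitCount m := by
  induction m using Nat.strong_induction_on with
  | _ m ih =>
    rw [bitCount, if_neg h]
    by_cases h2 : m / 2 = 0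
    · omega
    · have := ih (m / 2) (by omega) h2; omega

/-- A bit above all bits of `m` keeps the old bits in place and becomes the last one. This is how a
mask arises from the mask of the parent. -/
theorem selBit_add_two_pow (p : ℕ) : ∀ m, m < 2 ^ p →
    (∀ k < bitCount m, selBit (m + 2 ^ p) k = selBit m k) ∧
    selBit (m + 2 ^ p) (bitCount m) = p ∧ bitCount (m + 2 ^ p) = bitCount m + 1 := by
  induction p with
  | zero =>
    intro m hm
    obtain rfl : m = 0 := by simpa using hm
    refine ⟨fun k hk => ?_, ?_, ?_⟩
    · rw [bitCount_zero] at hk; omega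
    · rw [bitCount_zero, selBit]; simp
    · rw [bitCount]; simp [bitCount_zero]
  | succ p ih =>
    intro m hm
    obtain ⟨ih1, ih2, ih3⟩ := ih (m / 2) (by omega)
    have hpos : 0 < 2 ^ (p + 1) := by positivity
    have hdiv : (m + 2 ^ (p + 1)) / 2 = m / 2 + 2 ^ p := by omega
    have hmod : (m + 2 ^ (p + 1)) % 2 = m % 2 := by omega
    have hcm : bitCount m = m % 2 + bitCount (m / 2) := by
      by_cases h0 : m = 0
      · subst h0; simp [bitCount_zero]
      · rw [bitCount, if_neg h0]
    have hsel : ∀ k, selBit (m + 2 ^ (p + 1)) k = if m % 2 = 1 then if k = 0 then 0 else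
        selBit (m / 2 + 2 ^ p) (k - 1) + 1 else selBit (m / 2 + 2 ^ p) k + 1 := by
      intro k
      rw [selBit, if_neg (by omega), hmod, hdiv]
    refine ⟨fun k hk => ?_, ?_, ?_⟩
    · have h0 : m ≠ 0 := by rintro rfl; rw [bitCount_zero] at hk; omega
      rw [hsel]
      conv_rhs => rw [selBit, if_neg h0]
      split_ifs with h2 h3
      · rfl
      · rw [ih1 _ (by omega)]
      · rw [ih1 _ (by omega)]
    · rw [hsel, hcm]
      split_ifs with h2 h3
      · omega
      · rw [show m % 2 + bitCount (m / 2) - 1 = bitCount (m / 2) by omega, ih2]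
      · rw [show m % 2 + bitCount (m / 2) = bitCount (m / 2) by omega, ih2]
    · rw [bitCount, if_neg (by omega), hmod, hdiv, ih3, hcm]
      omega

/-- The set of the ancestors of `i` in its block of length `b`, where the node number `p` of the
block is represented by the bit number `p`. -/
def ancMask (b : ℕ) (par : ℕ → ℕ) (i : ℕ) : ℕ :=
  if i / b * b ≤ par i ∧ par i < i then ancMask b par (par i) + 2 ^ (i % b) else 2 ^ (i % b)
termination_by i
decreasing_by omega

/-- The start of the maximal run of first children that ends in `i`. -/
def runStart (par : ℕ → ℕ) (i : ℕ) : ℕ :=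
  if 0 < i ∧ par i + 1 = i then runStart par (i - 1) else i
termination_by i
decreasing_by omega

/-- The ancestor of the start of the run of `i` at the distance given by the position of `i` in
the run. -/
def ladder (par : ℕ → ℕ) (i : ℕ) : ℕ := par^[i - runStart par i + 1] (runStart par i)

/-- Climbing `δ` steps from `x` along the run of `x` and its ladder. -/
def climb (par : ℕ → ℕ) (x δ : ℕ) : ℕ :=
  if δ ≤ x - runStart par x then x - δ
  else ladder par (runStart par x + (δ - (x - runStart par x)) - 1)

theorem runStart_le (par : ℕ → ℕ) (i : ℕ) : runStart par i ≤ i := by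
  induction i using Nat.strong_induction_on with
  | _ i ih =>
    rw [runStart]
    split_ifs with h
    · have := ih (i - 1) (by omega); omega
    · exact le_rfl

/-- Inside a run the parent of a position is its predecessor, so climbing is subtraction. -/
theorem runStart_between (par : ℕ → ℕ) (i : ℕ) : ∀ j, runStart par i ≤ j → j ≤ i →
    runStart par j = runStart par i ∧ par^[i - j] i = j := by
  induction i using Nat.strong_induction_on with
  | _ i ih =>
    intro j hj hji
    rcases hji.eq_or_lt with rfl | hlt
    · simp
    · have hne : runStart par i ≠ i := by omega
      have hc : 0 < i ∧ par i + 1 = i := by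
        by_contra hc
        rw [runStart, if_neg hc] at hne
        exact hne rfl
      have hr : runStart par i = runStart par (i - 1) := by rw [runStart, if_pos hc]
      obtain ⟨h1, h2⟩ := ih (i - 1) (by omega) j (by omega) (by omega)
      refine ⟨by rw [h1, hr], ?_⟩
      rw [show i - j = (i - 1 - j) + 1 by omega, Function.iterate_succ_apply,
        show par i = i - 1 by omega, h2]

/-- One position further in a run means one step further up from the same start, so a ladder is
filled from left to right with one parent lookup per cell. -/
theorem ladder_rec (par : ℕ → ℕ) (i : ℕ) :
    ladder par i = if 0 < i ∧ par i + 1 = i then par (ladder par (i - 1)) else par i := by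
  rw [ladder]
  split_ifs with h
  · have hr : runStart par i = runStart par (i - 1) := by rw [runStart, if_pos h]
    have := runStart_le par (i - 1)
    rw [ladder, hr, ← Function.iterate_succ_apply' (f := par)]
    congr 1
    omega
  · have hr : runStart par i = i := by rw [runStart, if_neg h]
    rw [hr]
    simp

/-! ### Ancestors and minima in depth sequences -/

namespace DepthSeq

variable {n : ℕ} {D par ht : ℕ → ℕ}

theorem par_le (h : DepthSeq n D par ht) {i : ℕ} (hi : i < n) : par i ≤ i := by
  rcases Nat.eq_zero_or_pos i with rfl | h0
  · exact h.par_zero.le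
  · exact (h.par_lt i h0 hi).le

theorem D_par (h : DepthSeq n D par ht) {i : ℕ} (hi : i < n) : D (par i) = D i - 1 := by
  rcases Nat.eq_zero_or_pos i with rfl | h0
  · rw [h.par_zero, h.D_zero]
  · have := h.D_succ i h0 hi; omega

theorem iterate_le (h : DepthSeq n D par ht) {i : ℕ} (hi : i < n) (k : ℕ) :
    par^[k] i ≤ i ∧ D (par^[k] i) = D i - k := by
  induction k with
  | zero => exact ⟨le_rfl, rfl⟩
  | succ k ih =>
    rw [Function.iterate_succ_apply']
    have := h.par_le (ih.1.trans_lt hi)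
    have := h.D_par (ih.1.trans_lt hi)
    omega

theorem le_of_anc (h : DepthSeq n D par ht) {a i : ℕ} (hi : i < n) (ha : Anc par a i) :
    a ≤ i := by
  obtain ⟨k, rfl⟩ := ha
  exact (h.iterate_le hi k).1

theorem eq_zero_of_D (h : DepthSeq n D par ht) {i : ℕ} (hi : i < n) (h0 : D i = 0) : i = 0 := by
  by_contra hne
  have := h.D_succ i (by omega) hi
  omega

theorem eq_iterate_of_anc (h : DepthSeq n D par ht) {a i : ℕ} (hi : i < n) (ha : Anc par a i) :
    a = par^[D i - D a] i := by
  obtain ⟨k, hk⟩ := ha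
  obtain ⟨h1, h2⟩ := h.iterate_le hi k
  obtain ⟨h3, h4⟩ := h.iterate_le hi (D i)
  rw [hk] at h1 h2
  by_cases hkd : k ≤ D i
  · rw [show D i - D a = k by omega, hk]
  · have h0 : D a = 0 := by omega
    rw [h0, Nat.sub_zero, h.eq_zero_of_D (by omega) h0, h.eq_zero_of_D (i := par^[D i] i)
      (by omega) (by omega)]

/-- The ancestor of `i` at depth `d` is the ancestor at depth `d` of each lower ancestor. -/
theorem iterate_of_anc (h : DepthSeq n D par ht) {a i d : ℕ} (hi : i < n) (ha : Anc par a i)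
    (hd : d ≤ D a) : par^[D i - d] i = par^[D a - d] a := by
  have h1 := h.eq_iterate_of_anc hi ha
  have h2 := (h.iterate_le hi (D i - D a)).2
  rw [← h1] at h2
  conv_rhs => rw [h1]
  rw [← Function.iterate_add_apply, ← h1]
  congr 1
  omega

/-- Follow the parents of `i` down to `a`: positions after the parent of `i` are handled by `gap`,
the others by induction. -/
theorem D_le_of_anc (h : DepthSeq n D par ht) {a i : ℕ} (hi : i < n) (ha : Anc par a i) :
    ∀ k, a ≤ k → k ≤ i → D a ≤ D k := by
  induction i using Nat.strong_induction_on with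
  | _ i ih =>
    intro k hak hki
    have hai := h.iterate_le hi (D i - D a)
    rw [← h.eq_iterate_of_anc hi ha] at hai
    rcases Nat.eq_zero_or_pos i with rfl | h0
    · have : a = 0 := by omega
      have : k = 0 := by omega
      simp [*]
    · by_cases hne : a = i
      · subst hne
        obtain rfl : k = a := by omega
        exact le_rfl
      · have h1 := h.par_lt i h0 hi
        by_cases hk : k ≤ par i
        · exact ih _ h1 (h1.trans hi) (ha.of_ne hne) k hak hk
        · have := h.gap i k h0 hi (by omega) hki
          omega

/-- The chain of parents of `i` cannot jump over `a`: if `par i < a ≤ i`, then `gap` would give `D i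
≤ D a`. -/
theorem anc_of_lt (h : DepthSeq n D par ht) {a i : ℕ} (hi : i < n) (hai : a ≤ i)
    (hD : ∀ k, a < k → k ≤ i → D a < D k) : Anc par a i := by
  induction i using Nat.strong_induction_on with
  | _ i ih =>
    by_cases hne : a = i
    · subst hne; exact Anc.refl _ _
    · have h1 := h.par_lt i (by omega) hi
      have hap : a ≤ par i := by
        by_contra hlt
        have := h.gap i a (by omega) hi (by omega) (by omega)
        have := hD i (by omega) le_rfl
        omega
      exact (ih _ h1 (h1.trans hi) hap fun k hk hk' => hD k hk (by omega)).trans (Anc.parent _ _)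

/-- The smallest ancestor of `i` from `l` on. -/
theorem exists_firstAnc (h : DepthSeq n D par ht) {l i : ℕ} (hi : i < n) (hli : l ≤ i) :
    ∃ c, Anc par c i ∧ l ≤ c ∧ (c = 0 ∨ par c < l) := by
  induction i using Nat.strong_induction_on with
  | _ i ih =>
    by_cases hc : i = 0 ∨ par i < l
    · exact ⟨i, Anc.refl _ _, hli, hc⟩
    · have h1 := h.par_lt i (by omega) hi
      obtain ⟨c, hc1, hc2⟩ := ih _ h1 (h1.trans hi) (by omega)
      exact ⟨c, hc1.trans (Anc.parent _ _), hc2⟩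

/-- Positions from `c` to `i` are no higher in the tree than `c`, since `c` is an ancestor of `i`.
Positions from `l` to `c` come after the parent of `c`, so `gap` applies to them. -/
theorem isMin_firstAnc (h : DepthSeq n D par ht) {l i c : ℕ} (hi : i < n) (hc : Anc par c i)
    (hlc : l ≤ c) (hc' : c = 0 ∨ par c < l) : IsMin D l i (D c) := by
  have hci := h.le_of_anc hi hc
  refine ⟨⟨c, hlc, hci, rfl⟩, fun k hk hki => ?_⟩
  by_cases hck : c ≤ k
  · exact h.D_le_of_anc hi hc k hck hki
  · exact h.gap c k (by omega) (by omega) (by omega) (by omega)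

/-- The lowest common ancestor of `i < j` lies one level above the minimal depth between them. -/
theorem lca_of_isMin (h : DepthSeq n D par ht) {i j m : ℕ} (hj : j < n) (hij : i < j)
    (hm : IsMin D (i + 1) j m) : 0 < m ∧ m ≤ D j ∧ Anc par (par^[D j - (m - 1)] j) i ∧
      ∀ z, Anc par z i → Anc par z j → Anc par z (par^[D j - (m - 1)] j) := by
  -- The minimum is attained at the first ancestor `c` of `j` after `i`, and the parent of `c`,
  -- which is at most `i`, is the lowest common ancestor.
  obtain ⟨c, hc, hlc, hpc⟩ := h.exists_firstAnc hj (show i + 1 ≤ j from hij)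
  have hmin := h.isMin_firstAnc hj hc hlc hpc
  obtain rfl := hm.unique hmin
  have hcj := h.le_of_anc hj hc
  have hDc := h.D_succ c (by omega) (by omega)
  have hpcj : Anc par (par c) j := (Anc.parent _ _).trans hc
  have hpi : par c ≤ i := by omega
  have heq : par^[D j - (D c - 1)] j = par c := by
    rw [h.eq_iterate_of_anc hj hpcj, h.D_par (by omega)]
  rw [heq]
  refine ⟨by omega, hm.2 j (by omega) le_rfl, h.anc_of_lt (by omega) hpi fun k hk hk' => ?_,
    fun z hzi hzj => ?_⟩
  · have := h.gap c k (by omega) (by omega) hk (by omega)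
    omega
  · have hz := h.le_of_anc (by omega) hzi
    have hzc : Anc par z c := by
      have h1 := h.eq_iterate_of_anc hj hzj
      have h2 := h.eq_iterate_of_anc hj hc
      have h3 := h.D_le_of_anc hj hzj c (by omega) hcj
      refine ⟨D c - D z, ?_⟩
      rw [← h.iterate_of_anc hj hc h3, ← h1]
    exact hzc.of_ne (by omega)

/-! #### Blocks -/

variable {b : ℕ}

theorem block_of_mask (hb : 0 < b) {i : ℕ} (hc : i / b * b ≤ par i ∧ par i < i) :
    par i / b = i / b ∧ par i % b < i % b := by
  have hdiv : par i / b = i / b :=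
    le_antisymm (Nat.div_le_div_right hc.2.le) ((Nat.le_div_iff_mul_le hb).2 hc.1)
  have h1 := Nat.div_add_mod (par i) b
  have h2 := Nat.div_add_mod i b
  rw [hdiv] at h1
  exact ⟨hdiv, by omega⟩

/-- The bit of `i` itself is the highest one, because a parent in the same block has a smaller
position in it. -/
theorem ancMask_bounds (par : ℕ → ℕ) (hb : 0 < b) (i : ℕ) :
    2 ^ (i % b) ≤ ancMask b par i ∧ ancMask b par i < 2 ^ (i % b + 1) := by
  induction i using Nat.strong_induction_on with
  | _ i ih =>
    rw [ancMask]
    split_ifs with hc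
    · have h1 := ih _ hc.2
      have h2 : par i % b + 1 ≤ i % b := (block_of_mask hb hc).2
      have h3 := Nat.pow_le_pow_right (show 0 < 2 by omega) h2
      rw [pow_succ]
      omega
    · rw [pow_succ]
      have : 0 < 2 ^ (i % b) := by positivity
      omega

/-- The set bits of the mask of `i` are the ancestors of `i` in its block. -/
theorem selBit_ancMask (h : DepthSeq n D par ht) (hb : 0 < b) {i : ℕ} (hi : i < n) :
    ∃ c t, bitCount (ancMask b par i) = c + 1 ∧ c ≤ i % b ∧ Anc par t i ∧ D t + c = D i ∧
      i / b * b + selBit (ancMask b par i) 0 = t ∧ (t = 0 ∨ par t < i / b * b) ∧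
      ∀ k ≤ c, i / b * b + selBit (ancMask b par i) (c - k) = par^[k] i := by
  induction i using Nat.strong_induction_on with
  | _ i ih =>
    by_cases hc : i / b * b ≤ par i ∧ par i < i
    · obtain ⟨hdiv, hmod⟩ := block_of_mask hb hc
      obtain ⟨c, t, h1, h0, h2, h3, h4, h5, h6⟩ := ih _ hc.2 (by omega)
      have hlt : ancMask b par (par i) < 2 ^ (i % b) :=
        (ancMask_bounds par hb (par i)).2.trans_le (Nat.pow_le_pow_right (by omega) hmod)
      obtain ⟨s1, s2, s3⟩ := selBit_add_two_pow _ _ hlt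
      rw [← hdiv]
      rw [ancMask, if_pos hc]
      have hD := h.D_succ i (by omega) hi
      refine ⟨c + 1, t, by omega, by omega, h2.trans (Anc.parent _ _), by omega, ?_, h5, ?_⟩
      · rw [s1 0 (by omega), h4]
      · intro k hk
        rcases Nat.eq_zero_or_pos k with rfl | hk0
        · rw [Nat.sub_zero, ← h1, s2, hdiv]
          exact Nat.div_add_mod' i b
        · rw [s1 _ (by omega), show c + 1 - k = c - (k - 1) by omega, h6 _ (by omega),
            ← Function.iterate_succ_apply (f := par)]
          congr 1
          omega
    · obtain ⟨s1, s2, s3⟩ := selBit_add_two_pow (i % b) 0 (by positivity)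
      rw [bitCount_zero] at s2 s3
      rw [zero_add] at s2 s3
      rw [ancMask, if_neg hc]
      refine ⟨0, i, s3, Nat.zero_le _, Anc.refl _ _, rfl, by rw [s2]; exact Nat.div_add_mod' i b, ?_, ?_⟩
      · by_contra hcon
        have := h.par_lt i (by omega) hi
        omega
      · intro k hk
        obtain rfl : k = 0 := by omega
        rw [Nat.sub_zero, s2]
        exact Nat.div_add_mod' i b

/-- The lowest set bit of a shifted mask gives a minimum of the depths inside of a block. -/
theorem isMin_block (h : DepthSeq n D par ht) (hb : 0 < b) {l i : ℕ} (hi : i < n) (hli : l ≤ i)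
    (hbl : l / b = i / b) :
    l + selBit (ancMask b par i / 2 ^ (l % b)) 0 ≤ i ∧
      IsMin D l i (D (l + selBit (ancMask b par i / 2 ^ (l % b)) 0)) := by
  -- It is enough that the selected position is the first ancestor of `i` from `l` on.
  suffices hs : Anc par (l + selBit (ancMask b par i / 2 ^ (l % b)) 0) i ∧
      (l + selBit (ancMask b par i / 2 ^ (l % b)) 0 = 0 ∨
        par (l + selBit (ancMask b par i / 2 ^ (l % b)) 0) < l) from
    ⟨h.le_of_anc hi hs.1, h.isMin_firstAnc hi hs.1 (Nat.le_add_right _ _) hs.2⟩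
  have hlb := Nat.div_add_mod l b
  induction i using Nat.strong_induction_on with
  | _ i ih =>
    have hib := Nat.div_add_mod i b
    rw [hbl] at hlb
    have hx : i % b = l % b + (i - l) := by omega
    have hpow : 2 ^ (i % b) = 2 ^ (i - l) * 2 ^ (l % b) := by rw [hx, pow_add, mul_comm]
    have hpos : 0 < 2 ^ (l % b) := by positivity
    have single : l + selBit (0 + 2 ^ (i - l)) 0 = i := by
      have := (selBit_add_two_pow (i - l) 0 (by positivity)).2.1
      rw [bitCount_zero] at this
      omega
    by_cases hc : i / b * b ≤ par i ∧ par i < i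
    · obtain ⟨hdiv, hmod⟩ := block_of_mask hb hc
      have hjb := Nat.div_add_mod (par i) b
      rw [hdiv] at hjb
      have hbd := ancMask_bounds par hb (par i)
      rw [ancMask, if_pos hc, hpow, Nat.add_mul_div_right _ _ hpos]
      by_cases hlj : l ≤ par i
      · have hIH := ih _ hc.2 (by omega) hlj (by omega)
        have hlt : ancMask b par (par i) / 2 ^ (l % b) < 2 ^ (i - l) := by
          rw [Nat.div_lt_iff_lt_mul hpos, ← hpow]
          exact hbd.2.trans_le (Nat.pow_le_pow_right (by omega) hmod)
        have hne : ancMask b par (par i) / 2 ^ (l % b) ≠ 0 := by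
          have : 2 ^ (l % b) ≤ 2 ^ (par i % b) := Nat.pow_le_pow_right (by omega) (by omega)
          exact (Nat.div_pos (this.trans hbd.1) hpos).ne'
        rw [(selBit_add_two_pow _ _ hlt).1 0 (bitCount_pos hne)]
        exact ⟨hIH.1.trans (Anc.parent _ _), hIH.2⟩
      -- The parent lies before `l`, so the shift removes all its bits and only the bit of `i`
      -- survives.
      · have h0 : ancMask b par (par i) / 2 ^ (l % b) = 0 := by
          refine Nat.div_eq_of_lt (hbd.2.trans_le (Nat.pow_le_pow_right (by omega) ?_))
          omega
        rw [h0, single]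
        exact ⟨Anc.refl _ _, Or.inr (by omega)⟩
    · rw [ancMask, if_neg hc, hpow, Nat.mul_div_cancel _ hpos]
      rw [zero_add] at single
      rw [single]
      refine ⟨Anc.refl _ _, ?_⟩
      by_contra hcon
      have := h.par_lt i (by omega) hi
      have : i / b * b ≤ l := by rw [← hbl]; exact Nat.div_mul_le_self _ _
      omega

/-! #### Ladders -/

/-- Each step up raises the height by at least one. Thus a long jump ends at a node with a long path
of highest children below it. -/
theorem ht_iterate (h : DepthSeq n D par ht) {i : ℕ} (hi : i < n) (k : ℕ) (hk : k ≤ D i) :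
    k ≤ ht (par^[k] i) := by
  induction k with
  | zero => exact Nat.zero_le _
  | succ k ih =>
    rw [Function.iterate_succ_apply']
    obtain ⟨h1, h2⟩ := h.iterate_le hi k
    have h0 : par^[k] i ≠ 0 := by
      intro h0
      rw [h0, h.D_zero] at h2
      omega
    have := h.ht_par _ (by omega) (h1.trans_lt hi)
    have := ih (by omega)
    omega

/-- As long as the height is positive, the next position is the highest child and continues the run.
-/
theorem runStart_add (h : DepthSeq n D par ht) {x : ℕ} (hx : x < n) (j : ℕ) (hj : j ≤ ht x) :
    x + j < n ∧ runStart par (x + j) = runStart par x ∧ ht (x + j) + j = ht x := by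
  induction j with
  | zero => exact ⟨hx, rfl, rfl⟩
  | succ j ih =>
    obtain ⟨h1, h2, h3⟩ := ih (by omega)
    obtain ⟨h4, h5, h6⟩ := h.ht_first _ h1 (by omega)
    refine ⟨h4, ?_, show ht (x + j + 1) + (j + 1) = ht x by omega⟩
    rw [← h2, ← add_assoc, runStart, if_pos ⟨by omega, by rw [h5]⟩, Nat.add_sub_cancel]

theorem runStart_of_le (h : DepthSeq n D par ht) {x y : ℕ} (hx : x < n)
    (h₁ : runStart par x ≤ y) (h₂ : y ≤ x + ht x) : y < n ∧ runStart par y = runStart par x := by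
  by_cases hyx : y ≤ x
  · exact ⟨by omega, (runStart_between par x y h₁ hyx).1⟩
  · obtain ⟨h3, h4, -⟩ := h.runStart_add hx (y - x) (by omega)
    rw [show x + (y - x) = y by omega] at h3 h4
    exact ⟨h3, h4⟩

theorem climb_index_lt (h : DepthSeq n D par ht) {x δ : ℕ} (hx : x < n) (hδ : δ ≤ ht x + 1)
    (hc : ¬ δ ≤ x - runStart par x) :
    runStart par x + (δ - (x - runStart par x)) - 1 < n := by
  have := runStart_le par x
  exact (h.runStart_of_le hx (by omega) (by omega)).1

/-- From its start on, the run of `x` has at least `(x - runStart par x) + ht x + 1` nodes, and its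
ladder has as many cells. Beyond the start at most `ht x + 1` steps remain, which the ladder covers;
the ladder cell with offset `r - 1` stores `r` steps above the start, hence the `- 1` in `climb`. -/
theorem climb_eq (h : DepthSeq n D par ht) {x δ : ℕ} (hx : x < n) (hδ : δ ≤ ht x + 1) :
    climb par x δ = par^[δ] x := by
  have hr := runStart_le par x
  rw [climb]
  split_ifs with hc
  · have := (runStart_between par x (x - δ) (by omega) (by omega)).2
    rw [show x - (x - δ) = δ by omega] at this
    exact this.symm
  · have h1 := (h.runStart_of_le hx (y := runStart par x + (δ - (x - runStart par x)) - 1)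
      (by omega) (by omega)).2
    have h2 := (runStart_between par x (runStart par x) le_rfl hr).2
    rw [ladder, h1]
    calc _ = par^[δ - (x - runStart par x)] (par^[x - runStart par x] x) := by
          rw [h2]
          congr 1
          omega
      _ = par^[δ] x := by
          rw [← Function.iterate_add_apply]
          congr 1
          omega

end DepthSeq

end RootedTree

namespace RootedTree

/-! ### Level ancestors in depth sequences -/

namespace DepthSeq

variable {n b : ℕ} {D par ht : ℕ → ℕ}

/-- The mask lists the ancestors in the block by increasing depth, one per level, so the difference
to the depth of the topmost one is the bit number. -/
theorem iterate_near (h : DepthSeq n D par ht) (hb : 0 < b) {i d : ℕ} (hi : i < n) (hd : d ≤ D i)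
    (hnear : D (i / b * b + selBit (ancMask b par i) 0) ≤ d) :
    i / b * b + selBit (ancMask b par i) (d - D (i / b * b + selBit (ancMask b par i) 0)) =
      par^[D i - d] i := by
  obtain ⟨c, t, h1, -, h2, h3, h4, h5, h6⟩ := h.selBit_ancMask hb hi
  rw [h4] at hnear ⊢
  rw [← h6 (D i - d) (by omega)]
  congr 2
  omega

/-- Let `t` be the topmost ancestor of `i` in its block. Its parent lies before the block, and by
`gap` everything between that parent and `t` is deeper than the parent. So the parent of `t` is also
an ancestor of the first position of the block, and above it the two chains of ancestors agree. -/
theorem iterate_far (h : DepthSeq n D par ht) (hb : 0 < b) {i d : ℕ} (hi : i < n)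
    (hfar : d < D (i / b * b + selBit (ancMask b par i) 0)) :
    d < D (i / b * b) ∧ par^[D i - d] i = par^[D (i / b * b) - d] (i / b * b) := by
  obtain ⟨c, t, h1, -, h2, h3, h4, h5, h6⟩ := h.selBit_ancMask hb hi
  have hst : i / b * b ≤ t := by omega
  rw [h4] at hfar
  have ht0 : t ≠ 0 := by rintro rfl; rw [h.D_zero] at hfar; omega
  have hti := h.le_of_anc hi h2
  have hD := h.D_succ t (by omega) (by omega)
  have hp : par t < i / b * b := h5.resolve_left ht0
  have hgap := fun k => h.gap t k (by omega) (by omega)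
  have hanc : Anc par (par t) (i / b * b) := h.anc_of_lt (by omega) hp.le fun k hk hk' => by
    have := hgap k hk (by omega)
    omega
  have := hgap (i / b * b) hp hst
  refine ⟨by omega, ?_⟩
  rw [h.iterate_of_anc hi ((Anc.parent par t).trans h2) (by omega),
    h.iterate_of_anc (by omega) hanc (by omega)]

/-- The largest power of two below `δ` leaves less than itself to climb, while the node reached has
at least that height. -/
theorem jump_climb (h : DepthSeq n D par ht) {s δ : ℕ} (hs : s < n) (hδ : δ ≤ D s) (hδ₀ : 0 < δ) :
    2 ^ Nat.log 2 δ ≤ δ ∧ par^[2 ^ Nat.log 2 δ] s < n ∧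
      δ - 2 ^ Nat.log 2 δ ≤ ht (par^[2 ^ Nat.log 2 δ] s) + 1 ∧
      climb par (par^[2 ^ Nat.log 2 δ] s) (δ - 2 ^ Nat.log 2 δ) = par^[δ] s := by
  have h1 : 2 ^ Nat.log 2 δ ≤ δ := Nat.pow_log_le_self 2 hδ₀.ne'
  have h2 : δ < 2 ^ (Nat.log 2 δ + 1) := Nat.lt_pow_succ_log_self (by omega) δ
  rw [pow_succ] at h2
  have h3 := h.ht_iterate hs (2 ^ Nat.log 2 δ) (by omega)
  have h4 := (h.iterate_le hs (2 ^ Nat.log 2 δ)).1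
  refine ⟨h1, by omega, by omega, ?_⟩
  rw [h.climb_eq (by omega) (by omega), ← Function.iterate_add_apply]
  congr 1
  omega

/-- Doubling of a jump. -/
theorem jump_succ (h : DepthSeq n D par ht) {s k : ℕ} (hs : s < n)
    (h0 : par^[2 ^ k] s ≠ 0) : 2 ^ k ≤ ht (par^[2 ^ k] s) + 1 ∧
      climb par (par^[2 ^ k] s) (2 ^ k) = par^[2 ^ (k + 1)] s := by
  have h1 := h.iterate_le hs (2 ^ k)
  have hD : 2 ^ k ≤ D s := by
    by_contra hlt
    exact h0 (h.eq_zero_of_D (by omega) (by omega))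
  have h2 := h.ht_iterate hs (2 ^ k) hD
  refine ⟨by omega, ?_⟩
  rw [h.climb_eq (by omega) (by omega), ← Function.iterate_add_apply]
  congr 1
  rw [pow_succ]
  omega

theorem iterate_zero_eq (h : DepthSeq n D par ht) (k : ℕ) : par^[k] 0 = 0 := by
  induction k with
  | zero => rfl
  | succ k ih => rw [Function.iterate_succ_apply, h.par_zero, ih]

end DepthSeq

/-! ### The block length -/

/-- The length of the blocks. -/
def blockLen (n : ℕ) : ℕ := Nat.log 2 n / 2 + 1

theorem blockLen_pos (n : ℕ) : 0 < blockLen n := Nat.succ_pos _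

/-- Half of the logarithm is small enough for a table over all pairs of a mask and a bit number to
have linear size, and large enough that `n / b` rows of length `2 * b`, one cell per exponent, also
have linear size. -/
theorem two_pow_blockLen_le {n : ℕ} (hn : 0 < n) : 2 ^ (2 * blockLen n) ≤ 4 * n := by
  have h1 : 2 ^ Nat.log 2 n ≤ n := Nat.pow_log_le_self 2 hn.ne'
  have h2 : 2 ^ (2 * blockLen n) ≤ 2 ^ (Nat.log 2 n + 2) :=
    Nat.pow_le_pow_right (by omega) (by rw [blockLen]; omega)
  rw [pow_add] at h2
  omega

theorem blockLen_mul_le {n : ℕ} (hn : 0 < n) : 2 ^ blockLen n * blockLen n ≤ 4 * n := by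
  refine le_trans ?_ (two_pow_blockLen_le hn)
  rw [two_mul, pow_add]
  exact Nat.mul_le_mul_left _ Nat.lt_two_pow_self.le

theorem two_mul_blockLen_le {n : ℕ} (hn : 0 < n) : 2 * blockLen n ≤ 4 * n :=
  Nat.lt_two_pow_self.le.trans (two_pow_blockLen_le hn)

/-! ### The depth sequence of a tree -/

/-- An ordered tree with the nodes `0, …, n - 1`. -/
structure TreeData (n : ℕ) [NeZero n] where
  /-- The lists of children. -/
  ch : Fin n → List (Fin n)
  /-- The parents. -/
  pa : Fin n → Fin n
  /-- The depths. -/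
  dp : Fin n → ℕ
  isTree : OTree ch pa dp

namespace TreeData

variable {n : ℕ} [NeZero n] (X : TreeData n)

/-- The height of the subtree, measured from the root of the whole tree. -/
noncomputable def md : Fin n → ℕ := maxDepth X.pa X.dp

/-- The lists of children with the highest child moved to the front. -/
noncomputable def newCh (v : Fin n) : List (Fin n) := bestFirst X.md (X.ch v)

/-- The siblings after a node. -/
def sibs : Fin n → List (Fin n) := laterSibs X.ch X.pa

/-- The highest node among `v` and the siblings after it. -/
noncomputable def best (v : Fin n) : Fin n := bestOf X.md v (X.sibs v)

/-- The position of a node in the preorder that visits the highest children first. -/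
noncomputable def idx : Fin n → ℕ := preIdx X.newCh X.dp

/-- The node at a position of the preorder that visits the highest children first. -/
noncomputable def at' : ℕ → Fin n := nodeAt X.newCh X.dp

/-- The depth of the node at a position. -/
noncomputable def D (i : ℕ) : ℕ := X.dp (X.at' i)

/-- The position of the parent of the node at a position. -/
noncomputable def par (i : ℕ) : ℕ := X.idx (X.pa (X.at' i))

/-- The height of the node at a position. -/
noncomputable def ht (i : ℕ) : ℕ := X.md (X.at' i) - X.dp (X.at' i)

theorem isTree' : OTree X.newCh X.pa X.dp := X.isTree.bestFirst X.md

theorem idx_lt (v : Fin n) : X.idx v < n := X.isTree'.preIdx_lt v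

theorem at_idx (v : Fin n) : X.at' (X.idx v) = v := X.isTree'.nodeAt_preIdx v

theorem idx_at {i : ℕ} (hi : i < n) : X.idx (X.at' i) = i := X.isTree'.preIdx_nodeAt hi

theorem idx_zero : X.idx 0 = 0 := X.isTree'.preIdx_zero

theorem at_zero : X.at' 0 = 0 := by rw [← X.idx_zero, at_idx]

theorem at_ne_zero {i : ℕ} (h0 : 0 < i) (hi : i < n) : X.at' i ≠ 0 := by
  intro h
  have := X.idx_at hi
  rw [h, idx_zero] at this
  omega

theorem at_par (i : ℕ) : X.at' (X.par i) = X.pa (X.at' i) := X.at_idx _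

theorem D_idx (v : Fin n) : X.D (X.idx v) = X.dp v := by rw [D, at_idx]

theorem at_iterate (i k : ℕ) : X.at' (X.par^[k] i) = X.pa^[k] (X.at' i) := by
  induction k with
  | zero => rfl
  | succ k ih => rw [Function.iterate_succ_apply', Function.iterate_succ_apply', at_par, ih]

theorem anc_at {i j : ℕ} (h : Anc X.par i j) : Anc X.pa (X.at' i) (X.at' j) := by
  obtain ⟨k, rfl⟩ := h
  exact ⟨k, (X.at_iterate j k).symm⟩

theorem dp_le_md (v : Fin n) : X.dp v ≤ X.md v := OTree.dp_le_maxDepth_of_anc (Anc.refl _ _)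

/-- `gap` comes from subtrees being intervals of the preorder. `ht_first` is the purpose of the
reordering: the first child reaches as deep as its parent does and lies one level lower, so the
height drops by exactly one. -/
theorem depthSeq : DepthSeq n X.D X.par X.ht where
  par_zero := by rw [par, at_zero, X.isTree.pa_zero, idx_zero]
  D_zero := by rw [D, at_zero, X.isTree.dp_zero]
  par_lt i h0 hi := by
    have := X.isTree'.preIdx_pa_lt (X.at_ne_zero h0 hi)
    have h2 := X.idx_at hi
    exact this.trans_eq h2
  D_succ i h0 hi := by
    rw [D, D, at_par]
    exact X.isTree.dp_succ _ (X.at_ne_zero h0 hi)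
  gap i j h0 hi hij hji := by
    refine X.isTree'.dp_le_of_between (X.at_ne_zero h0 hi) ?_ ?_
    · exact hij.trans_eq (X.idx_at (i := j) (by omega)).symm
    · exact (X.idx_at (i := j) (by omega)).trans_le (hji.trans_eq (X.idx_at hi).symm)
  ht_par i h0 hi := by
    rw [ht, ht, at_par]
    have h1 := X.isTree.dp_succ _ (X.at_ne_zero h0 hi)
    have h2 : X.md (X.at' i) ≤ X.md (X.pa (X.at' i)) :=
      OTree.maxDepth_le_of_anc (Anc.parent _ _)
    have h3 := X.dp_le_md (X.at' i)
    omega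
  ht_first i hi h := by
    have hch : X.ch (X.at' i) ≠ [] := by
      intro hnil
      have := X.isTree.maxDepth_nil hnil
      rw [ht, md] at h
      omega
    obtain ⟨u, l, hu⟩ := List.exists_cons_of_ne_nil hch
    have hnew : X.newCh (X.at' i) = bestOf X.md u l :: (u :: l).erase (bestOf X.md u l) := by
      rw [newCh, hu, bestFirst]
    have h1 : X.idx (bestOf X.md u l) = i + 1 := by
      have := X.isTree'.preIdx_first hnew
      exact this.trans (by rw [show preIdx X.newCh X.dp (X.at' i) = i from X.idx_at hi])
    have h2 := X.isTree.maxDepth_cons hu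
    have h3 := (X.isTree'.mem (X.at' i) (bestOf X.md u l)).1 (by rw [hnew]; simp)
    have h4 := X.isTree.dp_succ _ h3.1
    have h5 : X.at' (i + 1) = bestOf X.md u l := by rw [← h1, at_idx]
    refine ⟨h1 ▸ X.idx_lt _, by rw [par, h5, h3.2, X.idx_at hi], ?_⟩
    rw [ht] at h
    rw [ht, ht, h5]
    rw [h3.2] at h4
    change X.md (X.at' i) = X.md (bestOf X.md u l) at h2
    omega

theorem par_lt {i : ℕ} (hi : i < n) : X.par i < n := (X.depthSeq.par_le hi).trans_lt hi

theorem D_lt (i : ℕ) : X.D i < n := X.isTree.dp_lt _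

theorem ladder_lt {i : ℕ} (hi : i < n) : ladder X.par i < n :=
  (X.depthSeq.iterate_le ((runStart_le X.par i).trans_lt hi) _).1.trans_lt
    ((runStart_le X.par i).trans_lt hi)

end TreeData

end RootedTree

/-! ### The tables in memory -/

namespace RootedTree

/-- Array of the nodes in preorder. -/
abbrev orderArr : ℕ := 8
/-- Array of the largest depths below a node and the siblings after it. -/
abbrev heightArr : ℕ := 9
/-- Array of the highest nodes among a node and the siblings after it. -/
abbrev bestArr : ℕ := 10
/-- Array of the highest children, which become the first ones. -/
abbrev newFirstArr : ℕ := 11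
/-- Array of the next siblings after the highest children have been moved to the front. -/
abbrev newNextArr : ℕ := 12
/-- Array of the distances for the second depth-first search. -/
abbrev newDistArr : ℕ := 13
/-- Array of the entry times for the second depth-first search. -/
abbrev newTinArr : ℕ := 14
/-- Array of the exit times for the second depth-first search. -/
abbrev newToutArr : ℕ := 15
/-- Array of the timer for the second depth-first search. -/
abbrev newTimerArr : ℕ := 16
/-- Array of the positions of the nodes in the second preorder. -/
abbrev idxArr : ℕ := 17
/-- Array of the nodes in the second preorder. -/
abbrev atArr : ℕ := 18
/-- Array of the depths, by positions. -/
abbrev depthArr : ℕ := 19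
/-- Array of the parents, by positions. -/
abbrev parArr : ℕ := 20
/-- Array of the binary logarithms. -/
abbrev logArr : ℕ := 21
/-- Array of the set bits of small numbers. -/
abbrev selArr : ℕ := 22
/-- Array of the masks of the ancestors in the same block. -/
abbrev maskArr : ℕ := 23
/-- Array of the minimal depths of sequences of blocks. -/
abbrev minArr : ℕ := 24
/-- Array of the starts of the runs of first children. -/
abbrev runArr : ℕ := 25
/-- Array of the ladders. -/
abbrev ladderArr : ℕ := 26
/-- Array of the jumps from the starts of the blocks. -/
abbrev jumpArr : ℕ := 27

namespace TreeData

variable {n : ℕ} [NeZero n] (X : TreeData n)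

/-- The intended contents of the arrays. -/
def Spec : ℕ → (ℕ → ℕ) → Prop
  | 0, r => r 0 = n
  | 1, r => r (node (0 : Fin n)) = 0 ∧ ∀ v ≠ 0, r (node v) = node (X.pa v)
  | 2, r => ∀ v, r (node v) = headNode (X.ch v)
  | 3, r => ∀ v, r (node v) = headNode (X.sibs v)
  | 4, r => ∀ v, r (node v) = X.dp v
  | 5, r => ∀ v, r (node v) = tinOf X.ch X.dp v
  | 6, r => ∀ v, r (node v) = toutOf X.ch X.dp v
  | 8, r => ∀ i < n, r i = node (nodeAt X.ch X.dp i)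
  | 9, r => ∀ v, r (node v) = X.md (X.best v)
  | 10, r => ∀ v, r (node v) = node (X.best v)
  | 11, r => ∀ v, r (node v) = headNode (X.newCh v)
  | 12, r => ∀ p l v l', X.newCh p = l ++ v :: l' → r (node v) = headNode l'
  | 13, r => ∀ v, r (node v) = X.dp v
  | 14, r => ∀ v, r (node v) = tinOf X.newCh X.dp v
  | 17, r => ∀ v, r (node v) = X.idx v
  | 18, r => ∀ i < n, r i = node (X.at' i)
  | 19, r => ∀ i < n, r i = X.D i
  | 20, r => ∀ i < n, r i = X.par i
  | 21, r => ∀ i ≤ n, r i = Nat.log 2 i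
  | 22, r => ∀ m k, m < 2 ^ blockLen n → k < blockLen n → r (m * blockLen n + k) = selBit m k
  | 23, r => ∀ i < n, r i = ancMask (blockLen n) X.par i
  | 24, r => ∀ q k, q < n / blockLen n → k < 2 * blockLen n →
      IsMin X.D ((q + 1 - 2 ^ k) * blockLen n) (q * blockLen n + blockLen n - 1)
        (r (q * (2 * blockLen n) + k))
  | 25, r => ∀ i < n, r i = runStart X.par i
  | 26, r => ∀ i < n, r i = ladder X.par i
  | 27, r => ∀ q k, q * blockLen n < n → k < 2 * blockLen n →
      r (q * (2 * blockLen n) + k) = X.par^[2 ^ k] (q * blockLen n)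
  | _, _ => True

/-- The arrays in the list `l` have the intended contents. -/
def Holds (l : List ℕ) (M : Memory) : Prop := ∀ A ∈ l, X.Spec A (M A)

variable {X}

theorem Holds.mono {l l' : List ℕ} {M : Memory} (h : X.Holds l M) (hl : l' ⊆ l) :
    X.Holds l' M := fun A hA => h A (hl hA)

theorem Holds.congr {l : List ℕ} {M M' : Memory} (h : X.Holds l M)
    (hM : ∀ A ∈ l, M' A = M A) : X.Holds l M' := fun A hA => by rw [hM A hA]; exact h A hA

theorem Holds.cons {l : List ℕ} {M : Memory} {A : ℕ} (h : X.Holds l M) (hA : X.Spec A (M A)) :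
    X.Holds (A :: l) M := fun B hB => by
  rcases List.mem_cons.1 hB with rfl | hB
  · exact hA
  · exact h B hB

end TreeData

/-! ### Expressions for queries -/

/-- The number of nodes. -/
def sizeTerm : Term := .load sizeArr (.const 0)

/-- The block length. -/
def blockTerm : Term := .op .add (.op .div (.load logArr sizeTerm) (.const 2)) (.const 1)

/-- The start of the block of `i`. -/
def blockStartTerm (i : Term) : Term := .op .mul (.op .div i blockTerm) blockTerm

/-- The minimal depth from `l` to `j` inside of a block. -/
def blockMinTerm (l j : Term) : Term :=
  .load depthArr (.op .add l (.load selArr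
    (.op .mul (.op .shr (.load maskArr j) (.op .mod l blockTerm)) blockTerm)))

/-- Climbing `δ` steps from `x` with the ladder of `x`. -/
def climbTerm (x δ : Term) : Term :=
  .ite (.op .lt (.op .sub x (.load runArr x)) δ)
    (.load ladderArr (.op .sub (.op .add (.load runArr x)
      (.op .sub δ (.op .sub x (.load runArr x)))) (.const 1)))
    (.op .sub x δ)

/-- The cell number `k` of the row `q` in a table whose rows have twice the block length. -/
def cellTerm (A : ℕ) (q k : Term) : Term :=
  .load A (.op .add (.op .mul q (.op .mul (.const 2) blockTerm)) k)

/-- The minimal depth from the block `p` to the block `q`. -/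
def blocksMinTerm (p q : Term) : Term :=
  .min (cellTerm minArr q (.load logArr (.op .sub (.op .add q (.const 1)) p)))
    (cellTerm minArr (.op .sub (.op .add p (.op .shl (.const 1)
      (.load logArr (.op .sub (.op .add q (.const 1)) p)))) (.const 1))
      (.load logArr (.op .sub (.op .add q (.const 1)) p)))

/-- The minimal depth from `l` to `j`. -/
def minTerm (l j : Term) : Term :=
  .ite (.op .eq (.op .div l blockTerm) (.op .div j blockTerm)) (blockMinTerm l j)
    (.ite (.op .lt (.op .add (.op .div l blockTerm) (.const 1)) (.op .div j blockTerm))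
      (.min (.min (blockMinTerm l (.op .sub (.op .add (blockStartTerm l) blockTerm) (.const 1)))
          (blocksMinTerm (.op .add (.op .div l blockTerm) (.const 1))
            (.op .sub (.op .div j blockTerm) (.const 1))))
        (blockMinTerm (blockStartTerm j) j))
      (.min (blockMinTerm l (.op .sub (.op .add (blockStartTerm l) blockTerm) (.const 1)))
        (blockMinTerm (blockStartTerm j) j)))

/-- The position of the set bit number `k` in the mask of `i`. -/
def selTerm (i k : Term) : Term :=
  .op .add (blockStartTerm i)
    (.load selArr (.op .add (.op .mul (.load maskArr i) blockTerm) k))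

/-- The ancestor of `s` at depth `d`, for the first position `s` of the block `q`. -/
def farTerm (q s d : Term) : Term :=
  climbTerm (cellTerm jumpArr q (.load logArr (.op .sub (.load depthArr s) d)))
    (.op .sub (.op .sub (.load depthArr s) d)
      (.op .shl (.const 1) (.load logArr (.op .sub (.load depthArr s) d))))

/-- The position of the ancestor at depth `d` of the node at the position `i`. -/
def levelTerm (i d : Term) : Term :=
  .ite (.op .lt d (.load depthArr (selTerm i (.const 0))))
    (farTerm (.op .div i blockTerm) (blockStartTerm i) d)
    (selTerm i (.op .sub d (.load depthArr (selTerm i (.const 0)))))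

/-- The position of the lowest common ancestor of the nodes at the positions `i < j`. -/
def lcaTermLt (i j : Term) : Term :=
  levelTerm j (.op .sub (minTerm (.op .add i (.const 1)) j) (.const 1))

/-- The position of the lowest common ancestor of the nodes at the positions `i` and `j`. -/
def lcaTerm (i j : Term) : Term :=
  .ite (.op .eq i j) i (.ite (.op .lt i j) (lcaTermLt i j) (lcaTermLt j i))

/-! ### Values of the query expressions -/

section Eval

variable {n : ℕ} [NeZero n] {X : TreeData n} {w : ℕ} {L : Locals} {M : Memory}

theorem eval_sizeTerm (h0 : X.Spec 0 (M 0)) : sizeTerm.eval w L M = n := by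
  rw [sizeTerm, eval_load (eval_const (by positivity))]
  exact h0

theorem eval_blockTerm (hw : 64 * n ≤ 2 ^ w) (h0 : X.Spec 0 (M 0)) (h21 : X.Spec 21 (M 21)) :
    blockTerm.eval w L M = blockLen n := by
  have hn : 0 < n := Nat.pos_of_ne_zero (NeZero.ne n)
  have hb := two_mul_blockLen_le hn
  refine eval_add (x := Nat.log 2 n / 2) (y := 1) ?_ (eval_const (by omega)) ?_
  · exact eval_div ((eval_load (eval_sizeTerm h0)).trans (h21 n le_rfl)) (eval_const (by omega))
  · rw [← blockLen]; omega

theorem eval_blockStartTerm (hw : 64 * n ≤ 2 ^ w) (h0 : X.Spec 0 (M 0)) (h21 : X.Spec 21 (M 21))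
    {i : Term} {i₀ : ℕ} (hi : i.eval w L M = i₀) (hi₀ : i₀ < 2 ^ w) :
    (blockStartTerm i).eval w L M = i₀ / blockLen n * blockLen n :=
  eval_mul (eval_div hi (eval_blockTerm hw h0 h21)) (eval_blockTerm hw h0 h21)
    ((Nat.div_mul_le_self _ _).trans_lt hi₀)

theorem mul_add_div_mod {b y : ℕ} (x : ℕ) (hy : y < b) :
    (x * b + y) / b = x ∧ (x * b + y) % b = y := by
  rw [mul_comm, Nat.mul_add_div (by omega), Nat.mul_add_mod, Nat.div_eq_of_lt hy,
    Nat.mod_eq_of_lt hy]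
  exact ⟨rfl, rfl⟩

omit [NeZero n] in
theorem ancMask_lt (par : ℕ → ℕ) (i : ℕ) :
    ancMask (blockLen n) par i < 2 ^ blockLen n :=
  (DepthSeq.ancMask_bounds par (blockLen_pos n) i).2.trans_le
    (Nat.pow_le_pow_right (by omega) (Nat.mod_lt _ (blockLen_pos n)))

omit [NeZero n] in
theorem mul_blockLen_add_lt {m k : ℕ} (hm : m < 2 ^ blockLen n) (hk : k < blockLen n) :
    m * blockLen n + k < 2 ^ blockLen n * blockLen n := by
  have : (m + 1) * blockLen n ≤ 2 ^ blockLen n * blockLen n := Nat.mul_le_mul_right _ hm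
  rw [add_mul] at this
  omega

theorem two_pow_blockLen_bounds (n : ℕ) [NeZero n] :
    2 ^ blockLen n * blockLen n ≤ 4 * n ∧ 2 ^ blockLen n ≤ 4 * n := by
  have hn : 0 < n := Nat.pos_of_ne_zero (NeZero.ne n)
  exact ⟨blockLen_mul_le hn, (Nat.pow_le_pow_right (by omega) (by omega)).trans
    (two_pow_blockLen_le hn)⟩

theorem eval_blockMinTerm (hw : 64 * n ≤ 2 ^ w) (h0 : X.Spec 0 (M 0)) (h19 : X.Spec 19 (M 19))
    (h21 : X.Spec 21 (M 21)) (h22 : X.Spec 22 (M 22)) (h23 : X.Spec 23 (M 23))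
    {l j : Term} {l₀ j₀ : ℕ} (hl : l.eval w L M = l₀) (hj : j.eval w L M = j₀) (hj₀ : j₀ < n)
    (hlj : l₀ ≤ j₀) (hb : l₀ / blockLen n = j₀ / blockLen n) :
    IsMin X.D l₀ j₀ ((blockMinTerm l j).eval w L M) := by
  obtain ⟨h1, h2⟩ := X.depthSeq.isMin_block (blockLen_pos n) hj₀ hlj hb
  obtain ⟨b1, b2⟩ := two_pow_blockLen_bounds n
  have hm : ancMask (blockLen n) X.par j₀ / 2 ^ (l₀ % blockLen n) < 2 ^ blockLen n :=
    (Nat.div_le_self _ _).trans_lt (ancMask_lt X.par j₀)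
  have hlt := mul_blockLen_add_lt hm (blockLen_pos n)
  have he : (Term.load selArr (.op .mul (.op .shr (.load maskArr j) (.op .mod l blockTerm))
      blockTerm)).eval w L M = selBit (ancMask (blockLen n) X.par j₀ / 2 ^ (l₀ % blockLen n)) 0 := by
    rw [eval_load (eval_mul (eval_shr ((eval_load hj).trans (h23 _ hj₀))
      (eval_mod hl (eval_blockTerm hw h0 h21))) (eval_blockTerm hw h0 h21) (by omega))]
    exact h22 _ 0 hm (blockLen_pos n)
  rw [blockMinTerm, eval_load (eval_add hl he (by omega)), h19 _ (by omega)]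
  exact h2

theorem eval_climbTerm (hw : 64 * n ≤ 2 ^ w) (hL : IsWordLocals w L) (hM : IsWords w M)
    (h25 : X.Spec 25 (M 25)) (h26 : X.Spec 26 (M 26)) {x δ : Term} {x₀ δ₀ : ℕ}
    (hx : x.eval w L M = x₀) (hδ : δ.eval w L M = δ₀) (hx₀ : x₀ < n) (hδ₀ : δ₀ ≤ X.ht x₀ + 1) :
    (climbTerm x δ).eval w L M = climb X.par x₀ δ₀ := by
  have hn : 0 < n := Nat.pos_of_ne_zero (NeZero.ne n)
  have hr := runStart_le X.par x₀
  have hrun : (Term.load runArr x).eval w L M = runStart X.par x₀ :=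
    (eval_load hx).trans (h25 _ hx₀)
  have hsub := eval_sub hx hrun (by omega) hr
  have hδw : δ₀ < 2 ^ w := hδ ▸ Term.eval_lt (by omega) hL hM δ
  refine eval_ite (by omega) hL hM (eval_lt hsub hδ) (fun h => ?_) (fun h => ?_)
  · have hlt := X.depthSeq.climb_index_lt hx₀ hδ₀ (by omega)
    rw [climb, if_neg (by omega), eval_load (eval_sub (eval_add hrun
      (eval_sub hδ hsub hδw (by omega)) (by omega)) (eval_const (by omega)) (by omega) (by omega))]
    exact h26 _ hlt
  · rw [climb, if_pos (by omega)]
    exact eval_sub hx hδ (by omega) (by omega)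

theorem eval_cellTerm (hw : 64 * n ≤ 2 ^ w) (h0 : X.Spec 0 (M 0)) (h21 : X.Spec 21 (M 21))
    {A : ℕ} {q k : Term} {q₀ k₀ : ℕ} (hq : q.eval w L M = q₀) (hk : k.eval w L M = k₀)
    (hq₀ : q₀ * blockLen n ≤ n) (hk₀ : k₀ < 2 * blockLen n) :
    (cellTerm A q k).eval w L M = M A (q₀ * (2 * blockLen n) + k₀) := by
  have hn : 0 < n := Nat.pos_of_ne_zero (NeZero.ne n)
  have hb := two_mul_blockLen_le hn
  have : q₀ * (2 * blockLen n) = 2 * (q₀ * blockLen n) := by ring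
  exact eval_load (eval_add (eval_mul hq (eval_mul (eval_const (by omega))
    (eval_blockTerm hw h0 h21) (by omega)) (by omega)) hk (by omega))

-- Rows of length `2 * blockLen n` have a column for every exponent that can occur, since `2 *
-- blockLen n` exceeds the logarithm of `n`.
omit [NeZero n] in
theorem log_lt {δ : ℕ} (hδ : δ ≤ n) : Nat.log 2 δ < 2 * blockLen n := by
  refine (Nat.log_mono_right hδ).trans_lt ?_
  rw [blockLen]
  omega

/-- Two windows of `2 ^ k` blocks, one ending in `q` and one starting in `p`, cover the range, where
`k` is the logarithm of the number of blocks. Their overlap does no harm to a minimum. -/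
theorem eval_blocksMinTerm (hw : 64 * n ≤ 2 ^ w) (hL : IsWordLocals w L) (hM : IsWords w M)
    (h0 : X.Spec 0 (M 0)) (h21 : X.Spec 21 (M 21)) (h24 : X.Spec 24 (M 24))
    {p q : Term} {p₀ q₀ : ℕ} (hp : p.eval w L M = p₀) (hq : q.eval w L M = q₀)
    (hpq : p₀ ≤ q₀) (hq₀ : q₀ < n / blockLen n) :
    IsMin X.D (p₀ * blockLen n) (q₀ * blockLen n + blockLen n - 1)
      ((blocksMinTerm p q).eval w L M) := by
  have hn : 0 < n := Nat.pos_of_ne_zero (NeZero.ne n)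
  have hb := blockLen_pos n
  have hqb : q₀ * blockLen n + blockLen n ≤ n := by
    rw [← Nat.succ_mul]
    exact (Nat.mul_le_mul_right _ hq₀).trans (Nat.div_mul_le_self _ _)
  have hqn : q₀ < n := hq₀.trans_le (Nat.div_le_self _ _)
  have hlen : (Term.op .sub (.op .add q (.const 1)) p).eval w L M = q₀ + 1 - p₀ :=
    eval_sub (eval_add hq (eval_const (by omega)) (by omega)) hp (by omega) (by omega)
  have hlog := (eval_load (A := logArr) hlen).trans (h21 (q₀ + 1 - p₀) (by omega))
  have h1 : 2 ^ Nat.log 2 (q₀ + 1 - p₀) ≤ q₀ + 1 - p₀ := Nat.pow_log_le_self 2 (by omega)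
  have h2 : q₀ + 1 - p₀ < 2 ^ (Nat.log 2 (q₀ + 1 - p₀) + 1) := Nat.lt_pow_succ_log_self (by omega) _
  have hk := log_lt (n := n) (δ := q₀ + 1 - p₀) (by omega)
  rw [pow_succ] at h2
  set k := Nat.log 2 (q₀ + 1 - p₀)
  have hpb : (p₀ + 2 ^ k - 1) * blockLen n ≤ q₀ * blockLen n := Nat.mul_le_mul_right _ (by omega)
  have hpow : 0 < 2 ^ k := by positivity
  rw [blocksMinTerm, eval_min (by omega) hL hM
    (eval_cellTerm hw h0 h21 hq hlog (by omega) hk)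
    (eval_cellTerm hw h0 h21 (eval_sub (eval_add hp (eval_shl_one hlog (by omega)) (by omega))
      (eval_const (by omega)) (by omega) (by omega)) hlog (by omega) hk), min_comm]
  have m1 := h24 q₀ k hq₀ hk
  have m2 := h24 (p₀ + 2 ^ k - 1) k (by omega) hk
  rw [show p₀ + 2 ^ k - 1 + 1 - 2 ^ k = p₀ by omega] at m2
  refine m2.union m1 (Nat.mul_le_mul_right _ (by omega)) ?_ (by omega)
  have : (q₀ + 1 - 2 ^ k) * blockLen n ≤ (p₀ + 2 ^ k - 1 + 1) * blockLen n :=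
    Nat.mul_le_mul_right _ (by omega)
  rw [add_mul _ 1, one_mul] at this
  omega

/-- An interval across several blocks splits into the rest of the first block, the complete blocks
between and the beginning of the last block. The middle part is missing when the two blocks are
adjacent. -/
theorem eval_minTerm (hw : 64 * n ≤ 2 ^ w) (hL : IsWordLocals w L) (hM : IsWords w M)
    (h0 : X.Spec 0 (M 0)) (h19 : X.Spec 19 (M 19)) (h21 : X.Spec 21 (M 21))
    (h22 : X.Spec 22 (M 22)) (h23 : X.Spec 23 (M 23)) (h24 : X.Spec 24 (M 24))
    {l j : Term} {l₀ j₀ : ℕ} (hl : l.eval w L M = l₀) (hj : j.eval w L M = j₀)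
    (hlj : l₀ ≤ j₀) (hj₀ : j₀ < n) :
    IsMin X.D l₀ j₀ ((minTerm l j).eval w L M) := by
  have hn : 0 < n := Nat.pos_of_ne_zero (NeZero.ne n)
  have hb := blockLen_pos n
  have hb4 := two_mul_blockLen_le hn
  have hbt := eval_blockTerm (L := L) hw h0 h21
  have hlb := eval_div hl hbt
  have hjb := eval_div hj hbt
  have hsl := eval_blockStartTerm hw h0 h21 hl (by omega)
  have hsj := eval_blockStartTerm hw h0 h21 hj (by omega)
  have hdl := Nat.div_add_mod' l₀ (blockLen n)
  have hdj := Nat.div_add_mod' j₀ (blockLen n)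
  have hml := Nat.mod_lt l₀ hb
  have hmj := Nat.mod_lt j₀ hb
  have hle := Nat.div_le_div_right (c := blockLen n) hlj
  by_cases heq : l₀ / blockLen n = j₀ / blockLen n
  · rw [minTerm, eval_ite (by omega) hL hM (eval_eq hlb hjb) (fun _ => rfl)
      (fun h => absurd heq h)]
    exact eval_blockMinTerm hw h0 h19 h21 h22 h23 hl hj hj₀ hlj heq
  have hlt : l₀ / blockLen n + 1 ≤ j₀ / blockLen n := by omega
  have hmul := Nat.mul_le_mul_right (blockLen n) hlt
  rw [add_mul, one_mul] at hmul
  have hdn : j₀ / blockLen n ≤ j₀ := Nat.div_le_self _ _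
  have hend : (Term.op .sub (.op .add (blockStartTerm l) blockTerm) (.const 1)).eval w L M =
      l₀ / blockLen n * blockLen n + blockLen n - 1 :=
    eval_sub (eval_add hsl hbt (by omega)) (eval_const (by omega)) (by omega) (by omega)
  have m1 := eval_blockMinTerm hw h0 h19 h21 h22 h23 hl hend (by omega) (by omega) (by
    rw [show l₀ / blockLen n * blockLen n + blockLen n - 1 =
      l₀ / blockLen n * blockLen n + (blockLen n - 1) by omega,
      (mul_add_div_mod _ (by omega)).1])
  have m3 := eval_blockMinTerm hw h0 h19 h21 h22 h23 hsj hj hj₀ (by omega)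
    (by rw [Nat.mul_div_cancel _ hb])
  rw [minTerm, eval_ite (by omega) hL hM (eval_eq hlb hjb) (fun h => absurd h heq)
    (fun _ => rfl)]
  by_cases hlt2 : l₀ / blockLen n + 1 < j₀ / blockLen n
  · rw [eval_ite (by omega) hL hM (eval_lt (eval_add hlb (eval_const (by omega)) (by omega)) hjb)
      (fun _ => rfl) (fun h => absurd hlt2 h), eval_min (by omega) hL hM
        (eval_min (by omega) hL hM rfl rfl) rfl]
    have m2 := eval_blocksMinTerm hw hL hM h0 h21 h24
      (eval_add hlb (eval_const (k := 1) (by omega)) (by omega))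
      (eval_sub hjb (eval_const (k := 1) (by omega)) (by omega) (by omega)) (by omega) (by
        have : j₀ / blockLen n ≤ n / blockLen n := Nat.div_le_div_right hj₀.le
        omega)
    have e1 : (l₀ / blockLen n + 1) * blockLen n = l₀ / blockLen n * blockLen n + blockLen n := by
      rw [add_mul, one_mul]
    have e2 : (j₀ / blockLen n - 1) * blockLen n + blockLen n = j₀ / blockLen n * blockLen n := by
      rw [← Nat.succ_mul]
      congr 1
      omega
    rw [e1, e2] at m2
    exact (m1.union m2 (by omega) (by omega) (by omega)).union m3 (by omega) (by omega) (by omega)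
  · rw [eval_ite (by omega) hL hM (eval_lt (eval_add hlb (eval_const (by omega)) (by omega)) hjb)
      (fun h => absurd h hlt2) (fun _ => rfl), eval_min (by omega) hL hM rfl rfl]
    have e1 : j₀ / blockLen n * blockLen n = l₀ / blockLen n * blockLen n + blockLen n := by
      rw [show j₀ / blockLen n = l₀ / blockLen n + 1 by omega, add_mul, one_mul]
    exact m1.union m3 (by omega) (by omega) (by omega)

theorem eval_selTerm (hw : 64 * n ≤ 2 ^ w) (h0 : X.Spec 0 (M 0)) (h21 : X.Spec 21 (M 21))
    (h22 : X.Spec 22 (M 22)) (h23 : X.Spec 23 (M 23)) {i k : Term} {i₀ k₀ : ℕ}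
    (hi : i.eval w L M = i₀) (hk : k.eval w L M = k₀) (hi₀ : i₀ < n) (hk₀ : k₀ < blockLen n) :
    (selTerm i k).eval w L M =
      i₀ / blockLen n * blockLen n + selBit (ancMask (blockLen n) X.par i₀) k₀ := by
  have hm := ancMask_lt (n := n) X.par i₀
  have hlt := mul_blockLen_add_lt hm hk₀
  obtain ⟨b1, b2⟩ := two_pow_blockLen_bounds n
  have h1 := Nat.div_mul_le_self i₀ (blockLen n)
  have h2 := selBit_le (ancMask (blockLen n) X.par i₀) k₀
  refine eval_add (eval_blockStartTerm hw h0 h21 hi (by omega)) ?_ (by omega)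
  rw [eval_load (eval_add (eval_mul ((eval_load hi).trans (h23 _ hi₀))
    (eval_blockTerm hw h0 h21) (by omega)) hk (by omega))]
  exact h22 _ _ hm hk₀

theorem eval_farTerm (hw : 64 * n ≤ 2 ^ w) (hL : IsWordLocals w L) (hM : IsWords w M)
    (h0 : X.Spec 0 (M 0)) (h19 : X.Spec 19 (M 19)) (h21 : X.Spec 21 (M 21))
    (h25 : X.Spec 25 (M 25)) (h26 : X.Spec 26 (M 26)) (h27 : X.Spec 27 (M 27))
    {q s d : Term} {q₀ s₀ d₀ : ℕ} (hq : q.eval w L M = q₀) (hs : s.eval w L M = s₀)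
    (hd : d.eval w L M = d₀) (hs₀ : s₀ = q₀ * blockLen n) (hsn : s₀ < n) (hds : d₀ < X.D s₀) :
    (farTerm q s d).eval w L M = X.par^[X.D s₀ - d₀] s₀ := by
  have hDn := X.D_lt s₀
  have hδ := eval_sub ((eval_load hs).trans (h19 _ hsn)) hd (by omega) hds.le
  have hlog := (eval_load (A := logArr) hδ).trans (h21 (X.D s₀ - d₀) (by omega))
  obtain ⟨j1, j2, j3, j4⟩ := X.depthSeq.jump_climb hsn (δ := X.D s₀ - d₀) (by omega) (by omega)
  have hk := log_lt (n := n) (δ := X.D s₀ - d₀) (by omega)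
  have hx := (eval_cellTerm (A := jumpArr) hw h0 h21 hq hlog (by omega) hk).trans
    (h27 _ _ (by omega) hk)
  rw [← hs₀] at hx
  rw [farTerm, eval_climbTerm hw hL hM h25 h26 hx
    (eval_sub hδ (eval_shl_one hlog (by omega)) (by omega) (by omega)) j2 j3, j4]

/-- Bit `0` of the mask is the topmost ancestor in the block, and comparing `d` with its depth
decides between the mask and the jumps. -/
theorem eval_levelTerm (hw : 64 * n ≤ 2 ^ w) (hL : IsWordLocals w L) (hM : IsWords w M)
    (h0 : X.Spec 0 (M 0)) (h19 : X.Spec 19 (M 19)) (h21 : X.Spec 21 (M 21))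
    (h22 : X.Spec 22 (M 22)) (h23 : X.Spec 23 (M 23))
    (h25 : X.Spec 25 (M 25)) (h26 : X.Spec 26 (M 26)) (h27 : X.Spec 27 (M 27))
    {i d : Term} {i₀ d₀ : ℕ} (hi : i.eval w L M = i₀) (hd : d.eval w L M = d₀) (hi₀ : i₀ < n)
    (hd₀ : d₀ ≤ X.D i₀) :
    (levelTerm i d).eval w L M = X.par^[X.D i₀ - d₀] i₀ := by
  have hn : 0 < n := Nat.pos_of_ne_zero (NeZero.ne n)
  have hb := blockLen_pos n
  have hst := Nat.div_mul_le_self i₀ (blockLen n)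
  obtain ⟨c, t, h1, hc, h2, h3, h4, h5, h6⟩ := X.depthSeq.selBit_ancMask hb hi₀
  have hti := X.depthSeq.le_of_anc hi₀ h2
  have hsel := eval_selTerm hw h0 h21 h22 h23 hi
    (eval_const (k := 0) (by omega)) hi₀ hb
  have hDt := (eval_load (A := depthArr) hsel).trans (h19 _ (by omega))
  have hDn := X.D_lt i₀
  refine eval_ite (by omega) hL hM (eval_lt hd hDt) (fun h => ?_) (fun h => ?_)
  · obtain ⟨f1, f2⟩ := X.depthSeq.iterate_far hb hi₀ h
    rw [f2]
    exact eval_farTerm hw hL hM h0 h19 h21 h25 h26 h27 (eval_div hi (eval_blockTerm hw h0 h21))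
      (eval_blockStartTerm hw h0 h21 hi (by omega)) hd rfl (by omega) f1
  · rw [← X.depthSeq.iterate_near hb hi₀ hd₀ (not_lt.1 h)]
    refine eval_selTerm hw h0 h21 h22 h23 hi (eval_sub hd hDt (by omega) (not_lt.1 h)) hi₀ ?_
    rw [h4]
    have := Nat.mod_lt i₀ hb
    omega

theorem eval_lcaTermLt (hw : 64 * n ≤ 2 ^ w) (hL : IsWordLocals w L) (hM : IsWords w M)
    (hX : X.Holds [0, 19, 21, 22, 23, 24, 25, 26, 27] M) {i j : Term} {i₀ j₀ : ℕ}
    (hi : i.eval w L M = i₀) (hj : j.eval w L M = j₀) (hij : i₀ < j₀) (hj₀ : j₀ < n) :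
    (lcaTermLt i j).eval w L M < n ∧ Anc X.par ((lcaTermLt i j).eval w L M) i₀ ∧
      Anc X.par ((lcaTermLt i j).eval w L M) j₀ ∧ ∀ z, Anc X.par z i₀ → Anc X.par z j₀ →
        Anc X.par z ((lcaTermLt i j).eval w L M) := by
  have hmin := eval_minTerm (X := X) hw hL hM (hX 0 (by decide)) (hX 19 (by decide))
    (hX 21 (by decide)) (hX 22 (by decide)) (hX 23 (by decide)) (hX 24 (by decide))
    (eval_add hi (eval_const (k := 1) (by omega)) (by omega)) hj hij hj₀
  obtain ⟨h1, h2, h3, h4⟩ := X.depthSeq.lca_of_isMin hj₀ hij hmin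
  have hDn := X.D_lt j₀
  have hl := eval_levelTerm (X := X) hw hL hM (hX 0 (by decide)) (hX 19 (by decide))
    (hX 21 (by decide)) (hX 22 (by decide)) (hX 23 (by decide)) (hX 25 (by decide))
    (hX 26 (by decide)) (hX 27 (by decide)) hj
    (eval_sub (rfl : (minTerm (.op .add i (.const 1)) j).eval w L M = _)
      (eval_const (k := 1) (by omega)) (by omega) h1) hj₀ (by omega)
  rw [lcaTermLt, hl]
  exact ⟨(X.depthSeq.iterate_le hj₀ _).1.trans_lt hj₀, h3, ⟨_, rfl⟩, h4⟩

theorem eval_lcaTerm (hw : 64 * n ≤ 2 ^ w) (hL : IsWordLocals w L) (hM : IsWords w M)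
    (hX : X.Holds [0, 19, 21, 22, 23, 24, 25, 26, 27] M) {i j : Term} {i₀ j₀ : ℕ}
    (hi : i.eval w L M = i₀) (hj : j.eval w L M = j₀) (hi₀ : i₀ < n) (hj₀ : j₀ < n) :
    (lcaTerm i j).eval w L M < n ∧ Anc X.par ((lcaTerm i j).eval w L M) i₀ ∧
      Anc X.par ((lcaTerm i j).eval w L M) j₀ ∧ ∀ z, Anc X.par z i₀ → Anc X.par z j₀ →
        Anc X.par z ((lcaTerm i j).eval w L M) := by
  have hw1 : 1 < 2 ^ w := by omega
  rcases lt_trichotomy i₀ j₀ with h | h | h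
  · rw [lcaTerm, eval_ite hw1 hL hM (eval_eq hi hj) (fun h' => absurd h' h.ne)
      (fun _ => eval_ite hw1 hL hM (eval_lt hi hj) (fun _ => rfl) (fun h' => absurd h h'))]
    exact eval_lcaTermLt hw hL hM hX hi hj h hj₀
  · rw [lcaTerm, eval_ite hw1 hL hM (eval_eq hi hj) (fun _ => hi) (fun h' => absurd h h')]
    subst h
    exact ⟨hi₀, Anc.refl _ _, Anc.refl _ _, fun z hz _ => hz⟩
  · rw [lcaTerm, eval_ite hw1 hL hM (eval_eq hi hj) (fun h' => absurd h' h.ne')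
      (fun _ => eval_ite hw1 hL hM (eval_lt hi hj) (fun h' => absurd h' h.not_gt)
        (fun _ => rfl))]
    obtain ⟨h1, h2, h3, h4⟩ := eval_lcaTermLt hw hL hM hX hj hi h hi₀
    exact ⟨h1, h3, h2, fun z hz hz' => h4 z hz' hz⟩

end Eval

end RootedTree

/-! ### The preprocessing loops -/

namespace RootedTree

/-- The number of the node that belongs to the counter of a loop over the nodes. -/
def nodeTerm : Term := .op .add (.var 0) (.const 1)

/-- The node that belongs to the counter of a loop over the nodes in the opposite of the preorder. -/
def revTerm : Term := .load orderArr (.op .sub (.op .sub sizeTerm (.const 1)) (.var 0))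

/-- The largest depth below the node `v`. -/
def belowTerm (v : Term) : Term :=
  .ite (.op .eq (.load firstChildArr v) (.const 0)) (.load distArr v)
    (.load heightArr (.load firstChildArr v))

/-- The largest depth below the siblings after the node `v`. -/
def laterTerm (v : Term) : Term :=
  .ite (.op .eq (.load nextSiblingArr v) (.const 0)) (.const 0)
    (.load heightArr (.load nextSiblingArr v))

/-- The position in the preorder, from the entry time and the depth. -/
def preIdxTerm (ti d : ℕ) (v : Term) : Term :=
  .op .div (.op .add (.load ti v) (.load d v)) (.const 2)

/-- The value for the array `newNextArr`. -/
def newNextTerm (v p c : Term) : Term :=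
  .ite (.op .eq v c)
    (.ite (.op .eq (.load firstChildArr p) v) (.load nextSiblingArr v) (.load firstChildArr p))
    (.ite (.op .eq (.load nextSiblingArr v) c) (.load nextSiblingArr c) (.load nextSiblingArr v))

/-- The value for the array `selArr`, from the number `m` and the number `k` of a bit. -/
def selValTerm (m k : Term) : Term :=
  .ite (.op .eq m (.const 0)) (.const 0)
    (.ite (.op .eq (.op .mod m (.const 2)) (.const 1))
      (.ite (.op .eq k (.const 0)) (.const 0)
        (.op .add (.load selArr (.op .add (.op .mul (.op .div m (.const 2)) blockTerm)
          (.op .sub k (.const 1)))) (.const 1)))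
      (.op .add (.load selArr (.op .add (.op .mul (.op .div m (.const 2)) blockTerm) k))
        (.const 1)))

/-- The value for the array `maskArr`. -/
def maskValTerm (i p : Term) : Term :=
  .ite (.op .lt p (blockStartTerm i)) (.op .shl (.const 1) (.op .mod i blockTerm))
    (.ite (.op .lt p i)
      (.op .add (.load maskArr p) (.op .shl (.const 1) (.op .mod i blockTerm)))
      (.op .shl (.const 1) (.op .mod i blockTerm)))

/-- Twice the block length. -/
def rowTerm : Term := .op .mul (.const 2) blockTerm

/-- The value for the array `minArr`, for the cell `i` in the row `q` and the column `k`. -/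
def minValTerm (i q k : Term) : Term :=
  .ite (.op .eq k (.const 0))
    (blockMinTerm (.op .mul q blockTerm)
      (.op .sub (.op .add (.op .mul q blockTerm) blockTerm) (.const 1)))
    (.ite (.op .lt q (.op .shl (.const 1) (.op .sub k (.const 1))))
      (.load minArr (.op .sub i (.const 1)))
      (.min (.load minArr (.op .sub i (.const 1)))
        (cellTerm minArr (.op .sub q (.op .shl (.const 1) (.op .sub k (.const 1))))
          (.op .sub k (.const 1)))))

/-- The value for the array `jumpArr`, for the cell `i` in the row `q` and the column `k`. -/
def jumpValTerm (i q k : Term) : Term :=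
  .ite (.op .eq k (.const 0)) (.load parArr (.op .mul q blockTerm))
    (.ite (.op .eq (.load jumpArr (.op .sub i (.const 1))) (.const 0)) (.const 0)
      (climbTerm (.load jumpArr (.op .sub i (.const 1)))
        (.op .shl (.const 1) (.op .sub k (.const 1)))))

/-- A loop over the nodes. -/
def fillNodes (A : ℕ) (e : Term) : Cmd := fill A sizeTerm nodeTerm e

/-- A loop over the nodes in the opposite of the preorder. -/
def fillRev (A : ℕ) (e : Term) : Cmd := fill A sizeTerm revTerm e

/-- A loop over the cells `0, …, N - 1`. -/
def fillCells (A : ℕ) (N e : Term) : Cmd := fill A N (.var 0) e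

section Phases

variable {n : ℕ} [NeZero n] {X : TreeData n} {P : Program} {w : ℕ}

/-- A loop writes only `A`, which is not among the arrays already in place, so the list of correct
arrays grows by one. All tables have fewer than `8 * n` cells, which gives every loop the same
linear form of bound. -/
theorem computes_phase (hw : 64 * n ≤ 2 ^ w) {l : List ℕ} {A : ℕ} {N g e : Term} {N₀ : ℕ}
    {gf : ℕ → ℕ} {R : ℕ → ℕ → Prop} (hA : A ∉ l) (hN₀ : N₀ + 1 ≤ 8 * n)
    (hN : ∀ L M, IsWordLocals w L → IsWords w M → X.Holds l M → N.eval w L M = N₀)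
    (hinj : ∀ i < N₀, ∀ j < i, gf j ≠ gf i)
    (step : ∀ L M i, IsWordLocals w L → IsWords w M → X.Holds l M → i < N₀ → L 0 = i →
      (∀ j < i, R j (M A (gf j))) → g.eval w L M = gf i ∧ R i (e.eval w L M))
    (post : ∀ r : ℕ → ℕ, (∀ i < N₀, R i (r (gf i))) → X.Spec A r) :
    Computes P w (fill A N g e) (fillCost N g e * 8 * n) (X.Holds l) (X.Holds (A :: l)) := by
  have hn : 0 < n := Nat.pos_of_ne_zero (NeZero.ne n)
  refine (computes_fill (by omega) (fun M M' h hM => hM.congr fun B hB => h B ?_) (by omega) hN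
    hinj step).mono ?_ (fun _ h => h) (fun M h => h.1.cons (post _ h.2))
  · rw [mul_assoc]; exact Nat.mul_le_mul_left _ hN₀
  · rintro rfl; exact hA hB

theorem computes_fillNodes (hw : 64 * n ≤ 2 ^ w) {l : List ℕ} {A : ℕ} {e : Term}
    {R : Fin n → ℕ → Prop} (hA : A ∉ l) (h0 : 0 ∈ l)
    (step : ∀ L M (v : Fin n), IsWordLocals w L → IsWords w M → X.Holds l M →
      nodeTerm.eval w L M = node v → R v (e.eval w L M))
    (post : ∀ r : ℕ → ℕ, (∀ v, R v (r (node v))) → X.Spec A r) :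
    Computes P w (fillNodes A e) (fillCost sizeTerm nodeTerm e * 8 * n) (X.Holds l)
      (X.Holds (A :: l)) := by
  have hn : 0 < n := Nat.pos_of_ne_zero (NeZero.ne n)
  refine computes_phase hw (N₀ := n) (gf := fun i => i + 1)
    (R := fun i x => ∀ h : i < n, R ⟨i, h⟩ x) hA (by omega)
    (fun L M _ _ hM => eval_sizeTerm (hM 0 h0)) (fun i _ j hj => by simp; omega)
    (fun L M i hL hM hX hi hi0 _ => ?_) (fun r hr => post r fun v => hr v v.2 v.2)
  have hv : nodeTerm.eval w L M = i + 1 := eval_add hi0 (eval_const (by omega)) (by omega)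
  exact ⟨hv, fun h => step L M ⟨i, h⟩ hL hM hX hv⟩

/-- This inverts a numbering: the loop runs over the nodes and writes each one at its own position.
-/
theorem computes_scatter (hw : 64 * n ≤ 2 ^ w) {l : List ℕ} {A : ℕ} {g : Term} {f : Fin n → ℕ}
    (hA : A ∉ l) (h0 : 0 ∈ l) (hf : Function.Injective f)
    (hg : ∀ L M (v : Fin n), IsWordLocals w L → IsWords w M → X.Holds l M →
      nodeTerm.eval w L M = node v → g.eval w L M = f v)
    (post : ∀ r : ℕ → ℕ, (∀ v, r (f v) = node v) → X.Spec A r) :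
    Computes P w (fill A sizeTerm g nodeTerm) (fillCost sizeTerm g nodeTerm * 8 * n) (X.Holds l)
      (X.Holds (A :: l)) := by
  have hn : 0 < n := Nat.pos_of_ne_zero (NeZero.ne n)
  refine computes_phase hw (N₀ := n) (gf := fun i => if h : i < n then f ⟨i, h⟩ else 0)
    (R := fun i x => x = i + 1) hA (by omega)
    (fun L M _ _ hM => eval_sizeTerm (hM 0 h0)) (fun i hi j hj => ?_)
    (fun L M i hL hM hX hi hi0 _ => ?_) (fun r hr => post r fun v => ?_)
  · rw [dif_pos hi, dif_pos (hj.trans hi)]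
    intro h
    have := hf h
    simp at this
    omega
  · have hv : nodeTerm.eval w L M = i + 1 := eval_add hi0 (eval_const (by omega)) (by omega)
    rw [dif_pos hi]
    exact ⟨hg L M ⟨i, hi⟩ hL hM hX hv, hv⟩
  · have := hr v v.2
    rwa [dif_pos v.2] at this

/-- In reverse preorder, the children of a node and its later siblings come before the node, so
their cells can be used for its own. -/
theorem computes_fillRev (hw : 64 * n ≤ 2 ^ w) {l : List ℕ} {A : ℕ} {e : Term}
    {R : Fin n → ℕ → Prop} (hA : A ∉ l) (h0 : 0 ∈ l) (h8 : 8 ∈ l)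
    (step : ∀ L M (v : Fin n), IsWordLocals w L → IsWords w M → X.Holds l M →
      revTerm.eval w L M = node v →
      (∀ u, preIdx X.ch X.dp v < preIdx X.ch X.dp u → R u (M A (node u))) → R v (e.eval w L M))
    (post : ∀ r : ℕ → ℕ, (∀ v, R v (r (node v))) → X.Spec A r) :
    Computes P w (fillRev A e) (fillCost sizeTerm revTerm e * 8 * n) (X.Holds l)
      (X.Holds (A :: l)) := by
  have hn : 0 < n := Nat.pos_of_ne_zero (NeZero.ne n)
  have hback : ∀ u, nodeAt X.ch X.dp (n - 1 - (n - 1 - preIdx X.ch X.dp u)) = u := fun u => by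
    have := X.isTree.preIdx_lt u
    rw [show n - 1 - (n - 1 - preIdx X.ch X.dp u) = preIdx X.ch X.dp u by omega,
      X.isTree.nodeAt_preIdx]
  refine computes_phase hw (N₀ := n) (gf := fun i => node (nodeAt X.ch X.dp (n - 1 - i)))
    (R := fun i x => R (nodeAt X.ch X.dp (n - 1 - i)) x) hA (by omega)
    (fun L M _ _ hM => eval_sizeTerm (hM 0 h0)) (fun i hi j hj h => ?_)
    (fun L M i hL hM hX hi hi0 hR => ?_) (fun r hr => post r fun v => ?_)
  · have := congrArg (preIdx X.ch X.dp) (node_inj.1 h)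
    rw [X.isTree.preIdx_nodeAt (by omega), X.isTree.preIdx_nodeAt (by omega)] at this
    omega
  · have hv : revTerm.eval w L M = node (nodeAt X.ch X.dp (n - 1 - i)) :=
      (eval_load (eval_sub (eval_sub (eval_sizeTerm (hX 0 h0)) (eval_const (by omega)) (by omega)
        (by omega)) (show (Term.var 0).eval w L M = i from hi0) (by omega) (by omega))).trans (hX 8 h8 _ (by omega))
    refine ⟨hv, step L M _ hL hM hX hv fun u hu => ?_⟩
    have := X.isTree.preIdx_lt u
    rw [X.isTree.preIdx_nodeAt (by omega)] at hu
    have := hR (n - 1 - preIdx X.ch X.dp u) (by omega)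
    rwa [hback] at this
  · have := hr (n - 1 - preIdx X.ch X.dp v) (by omega)
    rwa [hback] at this

theorem computes_fillCells (hw : 64 * n ≤ 2 ^ w) {l : List ℕ} {A : ℕ} {N e : Term} {N₀ : ℕ}
    {R : ℕ → ℕ → Prop} (hA : A ∉ l) (hN₀ : N₀ + 1 ≤ 8 * n)
    (hN : ∀ L M, IsWordLocals w L → IsWords w M → X.Holds l M → N.eval w L M = N₀)
    (step : ∀ L M i, IsWordLocals w L → IsWords w M → X.Holds l M → i < N₀ →
      (Term.var 0).eval w L M = i → (∀ j < i, R j (M A j)) → R i (e.eval w L M))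
    (post : ∀ r : ℕ → ℕ, (∀ i < N₀, R i (r i)) → X.Spec A r) :
    Computes P w (fillCells A N e) (fillCost N (.var 0) e * 8 * n) (X.Holds l)
      (X.Holds (A :: l)) :=
  computes_phase hw (gf := id) hA hN₀ hN (fun _ _ _ hj => by simpa using hj.ne)
    (fun L M i hL hM hX hi hi0 hR => ⟨hi0, step L M i hL hM hX hi hi0 hR⟩) post

/-! #### Reordering the children -/

theorem eval_preIdxTerm (hw : 64 * n ≤ 2 ^ w) {ch : Fin n → List (Fin n)} {pa : Fin n → Fin n}
    {dp : Fin n → ℕ} (h : OTree ch pa dp) {L : Locals} {M : Memory} {ti d : ℕ} {v : Term}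
    {v₀ : Fin n} (hv : v.eval w L M = node v₀) (hti : M ti (node v₀) = tinOf ch dp v₀)
    (hd : M d (node v₀) = dp v₀) : (preIdxTerm ti d v).eval w L M = preIdx ch dp v₀ := by
  have h1 := h.tinOf_add v₀
  have h2 := h.preIdx_lt v₀
  rw [preIdxTerm, eval_div (eval_add ((eval_load hv).trans hti) ((eval_load hv).trans hd)
    (by omega)) (eval_const (k := 2) (by omega)), h1]
  omega

theorem computes_order (hw : 64 * n ≤ 2 ^ w) :
    Computes P w (fill orderArr sizeTerm (preIdxTerm tinArr distArr nodeTerm) nodeTerm)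
      (fillCost sizeTerm (preIdxTerm tinArr distArr nodeTerm) nodeTerm * 8 * n)
      (X.Holds [6, 5, 4, 3, 2, 1, 0]) (X.Holds [8, 6, 5, 4, 3, 2, 1, 0]) := by
  refine computes_scatter hw (f := preIdx X.ch X.dp) (by decide) (by decide)
    (fun u v h => X.isTree.preIdx_inj h) (fun L M v hL hM hX hv => ?_) (fun r hr i hi => ?_)
  · exact eval_preIdxTerm hw X.isTree hv (hX 5 (by decide) v) (hX 4 (by decide) v)
  · have := hr (nodeAt X.ch X.dp i)
    rwa [X.isTree.preIdx_nodeAt hi] at this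

/-- The largest depth below the siblings after `v`. -/
noncomputable def TreeData.later (X : TreeData n) (v : Fin n) : ℕ :=
  match X.sibs v with
  | [] => 0
  | u :: _ => X.md (X.best u)

/-- The best node of a list of siblings is computed as a suffix maximum along the sibling pointers;
in a tie the earlier node wins. -/
theorem TreeData.best_eq (X : TreeData n) {v u : Fin n} {l : List (Fin n)}
    (hv : X.sibs v = u :: l) : X.best v = if X.md v < X.later v then X.best u else v := by
  have h1 : X.sibs u = l := (X.isTree.laterSibs_cons hv).1
  have h2 : X.best u = bestOf X.md u l := by rw [best, h1]
  rw [best, later, hv, bestOf, ← h2]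

theorem TreeData.best_nil (X : TreeData n) {v : Fin n} (hv : X.sibs v = []) :
    X.best v = v := by
  rw [best, hv, bestOf]

/-- The cell of the first child covers that child and all siblings after it, hence all children of
`v`. -/
theorem eval_belowTerm (hw : 64 * n ≤ 2 ^ w) {L : Locals} {M : Memory} (hL : IsWordLocals w L)
    (hM : IsWords w M) (h2 : X.Spec 2 (M 2)) (h4 : X.Spec 4 (M 4)) {v : Term} {v₀ : Fin n}
    (hv : v.eval w L M = node v₀) (h9 : ∀ u, preIdx X.ch X.dp v₀ < preIdx X.ch X.dp u →
      M 9 (node u) = X.md (X.best u)) : (belowTerm v).eval w L M = X.md v₀ := by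
  have hn : 0 < n := Nat.pos_of_ne_zero (NeZero.ne n)
  have hfc := (eval_load (A := firstChildArr) hv).trans (h2 v₀)
  refine eval_ite (by omega) hL hM (eval_eq hfc (eval_const (by omega))) (fun h => ?_)
    (fun h => ?_)
  · have hnil : X.ch v₀ = [] := by
      cases hc : X.ch v₀ with
      | nil => rfl
      | cons u l => rw [hc] at h; simp [headNode, node] at h
    rw [eval_load hv, h4]
    exact (X.isTree.maxDepth_nil hnil).symm
  · cases hc : X.ch v₀ with
    | nil => rw [hc] at h; simp [headNode] at h
    | cons u l =>
      rw [hc] at hfc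
      have hb : X.best u = bestOf X.md u l := by
        rw [TreeData.best, TreeData.sibs, X.isTree.laterSibs_eq (l := []) hc]
      have := X.isTree.preIdx_first hc
      rw [eval_load hfc]
      refine (h9 u (by omega)).trans ?_
      rw [hb]
      exact (X.isTree.maxDepth_cons hc).symm

theorem eval_laterTerm (hw : 64 * n ≤ 2 ^ w) {L : Locals} {M : Memory} (hL : IsWordLocals w L)
    (hM : IsWords w M) (h3 : X.Spec 3 (M 3)) {v : Term} {v₀ : Fin n}
    (hv : v.eval w L M = node v₀) (h9 : ∀ u, preIdx X.ch X.dp v₀ < preIdx X.ch X.dp u →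
      M 9 (node u) = X.md (X.best u)) : (laterTerm v).eval w L M = X.later v₀ := by
  have hn : 0 < n := Nat.pos_of_ne_zero (NeZero.ne n)
  have hns := (eval_load (A := nextSiblingArr) hv).trans (h3 v₀)
  have hz : (Term.const 0).eval w L M = 0 := eval_const (by omega)
  refine eval_ite (by omega) hL hM (eval_eq hns hz) (fun h => ?_) (fun h => ?_)
  · cases hc : X.sibs v₀ with
    | nil => rw [TreeData.later, hc, hz]
    | cons u l => rw [hc] at h; simp [headNode, node] at h
  · cases hc : X.sibs v₀ with
    | nil => rw [hc] at h; simp [headNode] at h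
    | cons u l =>
      rw [hc] at hns
      rw [eval_load hns, TreeData.later, hc]
      exact h9 u (X.isTree.laterSibs_cons hc).2

theorem computes_height (hw : 64 * n ≤ 2 ^ w) :
    Computes P w (fillRev heightArr (.ite (.op .lt (belowTerm revTerm) (laterTerm revTerm))
        (laterTerm revTerm) (belowTerm revTerm)))
      (fillCost sizeTerm revTerm (.ite (.op .lt (belowTerm revTerm) (laterTerm revTerm))
        (laterTerm revTerm) (belowTerm revTerm)) * 8 * n)
      (X.Holds [8, 6, 5, 4, 3, 2, 1, 0]) (X.Holds [9, 8, 6, 5, 4, 3, 2, 1, 0]) := by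
  refine computes_fillRev hw (R := fun v x => x = X.md (X.best v)) (by decide) (by decide)
    (by decide) (fun L M v hL hM hX hv hR => ?_) (fun r hr => hr)
  have hbel := eval_belowTerm hw hL hM (hX 2 (by decide)) (hX 4 (by decide)) hv hR
  have hlat := eval_laterTerm hw hL hM (hX 3 (by decide)) hv hR
  have hn : 0 < n := Nat.pos_of_ne_zero (NeZero.ne n)
  refine eval_ite (by omega) hL hM (eval_lt hbel hlat) (fun h => ?_) (fun h => ?_)
  · rw [hlat]
    cases hc : X.sibs v with
    | nil => rw [TreeData.later, hc] at h; simp at h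
    | cons u l => rw [X.best_eq hc, if_pos h, TreeData.later, hc]
  · rw [hbel]
    cases hc : X.sibs v with
    | nil => rw [X.best_nil hc]
    | cons u l => rw [X.best_eq hc, if_neg h]

theorem computes_best (hw : 64 * n ≤ 2 ^ w) :
    Computes P w (fillRev bestArr (.ite (.op .lt (belowTerm revTerm) (laterTerm revTerm))
        (.load bestArr (.load nextSiblingArr revTerm)) revTerm))
      (fillCost sizeTerm revTerm (.ite (.op .lt (belowTerm revTerm) (laterTerm revTerm))
        (.load bestArr (.load nextSiblingArr revTerm)) revTerm) * 8 * n)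
      (X.Holds [9, 8, 6, 5, 4, 3, 2, 1, 0]) (X.Holds [10, 9, 8, 6, 5, 4, 3, 2, 1, 0]) := by
  refine computes_fillRev hw (R := fun v x => x = node (X.best v)) (by decide) (by decide)
    (by decide) (fun L M v hL hM hX hv hR => ?_) (fun r hr => hr)
  have h9 : ∀ u, preIdx X.ch X.dp v < preIdx X.ch X.dp u → M 9 (node u) = X.md (X.best u) :=
    fun u _ => hX 9 (by decide) u
  have hbel := eval_belowTerm hw hL hM (hX 2 (by decide)) (hX 4 (by decide)) hv h9
  have hlat := eval_laterTerm hw hL hM (hX 3 (by decide)) hv h9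
  have hn : 0 < n := Nat.pos_of_ne_zero (NeZero.ne n)
  refine eval_ite (by omega) hL hM (eval_lt hbel hlat) (fun h => ?_) (fun h => ?_)
  · have hns := (eval_load (A := nextSiblingArr) hv).trans (hX 3 (by decide) v)
    cases hc : X.sibs v with
    | nil => rw [TreeData.later, hc] at h; simp at h
    | cons u l =>
      rw [hc] at hns
      rw [X.best_eq hc, if_pos h, eval_load hns]
      exact hR u (X.isTree.laterSibs_cons hc).2
  · rw [hv]
    cases hc : X.sibs v with
    | nil => rw [X.best_nil hc]
    | cons u l => rw [X.best_eq hc, if_neg h]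

theorem TreeData.newCh_cons (X : TreeData n) {v u : Fin n} {l : List (Fin n)}
    (hv : X.ch v = u :: l) : headNode (X.newCh v) = node (X.best u) := by
  rw [newCh, hv, bestFirst, headNode, best, sibs, X.isTree.laterSibs_eq (l := []) hv]

theorem computes_newFirst (hw : 64 * n ≤ 2 ^ w) :
    Computes P w (fillNodes newFirstArr (.ite (.op .eq (.load firstChildArr nodeTerm) (.const 0))
        (.const 0) (.load bestArr (.load firstChildArr nodeTerm))))
      (fillCost sizeTerm nodeTerm (.ite (.op .eq (.load firstChildArr nodeTerm) (.const 0))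
        (.const 0) (.load bestArr (.load firstChildArr nodeTerm))) * 8 * n)
      (X.Holds [10, 9, 8, 6, 5, 4, 3, 2, 1, 0])
      (X.Holds [11, 10, 9, 8, 6, 5, 4, 3, 2, 1, 0]) := by
  refine computes_fillNodes hw (R := fun v x => x = headNode (X.newCh v)) (by decide) (by decide)
    (fun L M v hL hM hX hv => ?_) (fun r hr => hr)
  have hn : 0 < n := Nat.pos_of_ne_zero (NeZero.ne n)
  have hz : (Term.const 0).eval w L M = 0 := eval_const (by omega)
  have hfc := (eval_load (A := firstChildArr) hv).trans (hX 2 (by decide) v)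
  refine eval_ite (by omega) hL hM (eval_eq hfc hz) (fun h => ?_) (fun h => ?_)
  · cases hc : X.ch v with
    | nil => rw [hz, TreeData.newCh, hc, bestFirst, headNode]
    | cons u l => rw [hc] at h; simp [headNode, node] at h
  · cases hc : X.ch v with
    | nil => rw [hc] at h; simp [headNode] at h
    | cons u l =>
      rw [hc] at hfc
      rw [X.newCh_cons hc, eval_load hfc]
      exact hX 10 (by decide) u

theorem computes_newNext (hw : 64 * n ≤ 2 ^ w) :
    Computes P w (fillNodes newNextArr (newNextTerm nodeTerm (.load parentArr nodeTerm)
        (.load newFirstArr (.load parentArr nodeTerm))))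
      (fillCost sizeTerm nodeTerm (newNextTerm nodeTerm (.load parentArr nodeTerm)
        (.load newFirstArr (.load parentArr nodeTerm))) * 8 * n)
      (X.Holds [11, 10, 9, 8, 6, 5, 4, 3, 2, 1, 0])
      (X.Holds [12, 11, 10, 9, 8, 6, 5, 4, 3, 2, 1, 0]) := by
  -- The condition is empty for the root, which is in no list of children; whatever the loop
  -- computes there is irrelevant.
  refine computes_fillNodes hw (R := fun v x => ∀ p l l', X.newCh p = l ++ v :: l' →
    x = headNode l') (by decide) (by decide) (fun L M v hL hM hX hv p l l' hp => ?_)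
    (fun r hr p l v l' h => hr v p l l' h)
  have hn : 0 < n := Nat.pos_of_ne_zero (NeZero.ne n)
  have hvp := (X.isTree'.mem p v).1 (by simp [hp])
  have hpar : (Term.load parentArr nodeTerm).eval w L M = node p := by
    rw [eval_load hv]
    exact ((hX 1 (by decide)).2 v hvp.1).trans (by rw [hvp.2])
  obtain ⟨c, cs, hc⟩ : ∃ c cs, X.ch p = c :: cs := by
    refine List.exists_cons_of_ne_nil fun h => ?_
    rw [TreeData.newCh, h, bestFirst] at hp
    simp at hp
  have hbest : X.best c = bestOf X.md c cs := by
    rw [TreeData.best, TreeData.sibs, X.isTree.laterSibs_eq (l := []) hc]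
  have hfirst : (Term.load newFirstArr (.load parentArr nodeTerm)).eval w L M =
      node (X.best c) := by
    rw [eval_load hpar, ← X.newCh_cons hc]
    exact hX 11 (by decide) p
  have hfc : (Term.load firstChildArr (.load parentArr nodeTerm)).eval w L M = node c := by
    rw [eval_load hpar]
    exact (hX 2 (by decide) p).trans (by rw [hc, headNode])
  have hns := (eval_load (A := nextSiblingArr) hv).trans (hX 3 (by decide) v)
  have hnsb := (eval_load (A := nextSiblingArr) hfirst).trans (hX 3 (by decide) (X.best c))
  have key := X.isTree.headNode_bestFirst hc hp
  rw [← hbest] at key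
  change _ = if v = X.best c then if c = v then headNode (X.sibs v) else node c
    else if headNode (X.sibs v) = node (X.best c) then headNode (X.sibs (X.best c))
    else headNode (X.sibs v) at key
  rw [key]
  refine eval_ite (by omega) hL hM (eval_eq hv hfirst) (fun h => ?_) (fun h => ?_)
  · rw [if_pos (node_inj.1 h)]
    refine eval_ite (by omega) hL hM (eval_eq hfc hv) (fun h' => ?_) (fun h' => ?_)
    · rw [if_pos (node_inj.1 h'), hns]
    · rw [if_neg (fun h'' => h' (by rw [h''])), hfc]
  · rw [if_neg (fun h'' => h (by rw [h'']))]
    refine eval_ite (by omega) hL hM (eval_eq hns hfirst) (fun h' => ?_) (fun h' => ?_)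
    · rw [if_pos h', hnsb]
    · rw [if_neg h', hns]

/-! #### The arrays indexed by positions -/

theorem computes_idx (hw : 64 * n ≤ 2 ^ w) :
    Computes P w (fillNodes idxArr (preIdxTerm newTinArr newDistArr nodeTerm))
      (fillCost sizeTerm nodeTerm (preIdxTerm newTinArr newDistArr nodeTerm) * 8 * n)
      (X.Holds [14, 13, 3, 2, 1, 0]) (X.Holds [17, 14, 13, 3, 2, 1, 0]) :=
  computes_fillNodes hw (R := fun v x => x = X.idx v) (by decide) (by decide)
    (fun _ _ v _ _ hX hv => eval_preIdxTerm hw X.isTree' hv (hX 14 (by decide) v)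
      (hX 13 (by decide) v)) (fun _ hr => hr)

theorem computes_at (hw : 64 * n ≤ 2 ^ w) :
    Computes P w (fill atArr sizeTerm (.load idxArr nodeTerm) nodeTerm)
      (fillCost sizeTerm (.load idxArr nodeTerm) nodeTerm * 8 * n)
      (X.Holds [17, 14, 13, 3, 2, 1, 0]) (X.Holds [18, 17, 14, 13, 3, 2, 1, 0]) := by
  refine computes_scatter hw (f := X.idx) (by decide) (by decide)
    (fun u v h => X.isTree'.preIdx_inj h) (fun L M v hL hM hX hv => ?_) (fun r hr i hi => ?_)
  · exact (eval_load hv).trans (hX 17 (by decide) v)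
  · have := hr (X.at' i)
    rwa [X.idx_at hi] at this

theorem computes_depth (hw : 64 * n ≤ 2 ^ w) :
    Computes P w (fillCells depthArr sizeTerm (.load newDistArr (.load atArr (.var 0))))
      (fillCost sizeTerm (.var 0) (.load newDistArr (.load atArr (.var 0))) * 8 * n)
      (X.Holds [18, 17, 14, 13, 3, 2, 1, 0]) (X.Holds [19, 18, 17, 14, 13, 3, 2, 1, 0]) := by
  have hn : 0 < n := Nat.pos_of_ne_zero (NeZero.ne n)
  refine computes_fillCells hw (N₀ := n) (R := fun i x => x = X.D i) (by decide) (by omega)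
    (fun L M _ _ hX => eval_sizeTerm (hX 0 (by decide))) (fun L M i hL hM hX hi hi0 _ => ?_)
    (fun r hr => hr)
  rw [eval_load ((eval_load hi0).trans (hX 18 (by decide) i hi))]
  exact hX 13 (by decide) _

theorem computes_par (hw : 64 * n ≤ 2 ^ w) :
    Computes P w (fillCells parArr sizeTerm (.ite (.op .eq (.var 0) (.const 0)) (.const 0)
        (.load idxArr (.load parentArr (.load atArr (.var 0))))))
      (fillCost sizeTerm (.var 0) (.ite (.op .eq (.var 0) (.const 0)) (.const 0)
        (.load idxArr (.load parentArr (.load atArr (.var 0))))) * 8 * n)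
      (X.Holds [19, 18, 17, 14, 13, 3, 2, 1, 0])
      (X.Holds [20, 19, 18, 17, 14, 13, 3, 2, 1, 0]) := by
  have hn : 0 < n := Nat.pos_of_ne_zero (NeZero.ne n)
  refine computes_fillCells hw (N₀ := n) (R := fun i x => x = X.par i) (by decide) (by omega)
    (fun L M _ _ hX => eval_sizeTerm (hX 0 (by decide))) (fun L M i hL hM hX hi hi0 _ => ?_)
    (fun r hr => hr)
  have hz : (Term.const 0).eval w L M = 0 := eval_const (by omega)
  -- The parent pointer of the root is `0`, which is no node, so position `0` needs its own branch.
  refine eval_ite (by omega) hL hM (eval_eq hi0 hz) (fun h => ?_) (fun h => ?_)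
  · rw [hz, h, X.depthSeq.par_zero]
  · rw [eval_load ((eval_load ((eval_load hi0).trans (hX 18 (by decide) i hi))).trans
      ((hX 1 (by decide)).2 _ (X.at_ne_zero (by omega) hi)))]
    exact hX 17 (by decide) _

theorem computes_log (hw : 64 * n ≤ 2 ^ w) :
    Computes P w (fillCells logArr (.op .add sizeTerm (.const 1))
        (.ite (.op .lt (.var 0) (.const 2)) (.const 0)
          (.op .add (.load logArr (.op .div (.var 0) (.const 2))) (.const 1))))
      (fillCost (.op .add sizeTerm (.const 1)) (.var 0)
        (.ite (.op .lt (.var 0) (.const 2)) (.const 0)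
          (.op .add (.load logArr (.op .div (.var 0) (.const 2))) (.const 1))) * 8 * n)
      (X.Holds [20, 19, 18, 17, 14, 13, 3, 2, 1, 0])
      (X.Holds [21, 20, 19, 18, 17, 14, 13, 3, 2, 1, 0]) := by
  have hn : 0 < n := Nat.pos_of_ne_zero (NeZero.ne n)
  refine computes_fillCells hw (N₀ := n + 1) (R := fun i x => x = Nat.log 2 i) (by decide)
    (by omega) (fun L M _ _ hX => eval_add (eval_sizeTerm (hX 0 (by decide)))
      (eval_const (by omega)) (by omega)) (fun L M i hL hM hX hi hi0 hR => ?_)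
    (fun r hr i hi => hr i (by omega))
  have hz : (Term.const 0).eval w L M = 0 := eval_const (by omega)
  have h2 : (Term.const 2).eval w L M = 2 := eval_const (by omega)
  refine eval_ite (by omega) hL hM (eval_lt hi0 h2) (fun h => ?_) (fun h => ?_)
  · rw [hz, Nat.log_of_lt h]
  · rw [Nat.log_of_one_lt_of_le (by omega) (by omega)]
    have := Nat.log_le_self 2 (i / 2)
    exact eval_add ((eval_load (eval_div hi0 h2)).trans (hR (i / 2) (by omega)))
      (eval_const (by omega)) (by omega)

/-! #### Blocks and ladders -/

/-- The recursion of `selBit` passes from `m` to `m / 2`. For `m ≠ 0` that row is complete when row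
`m` is filled. -/
theorem computes_sel (hw : 64 * n ≤ 2 ^ w) :
    Computes P w (fillCells selArr (.op .mul (.op .shl (.const 1) blockTerm) blockTerm)
        (selValTerm (.op .div (.var 0) blockTerm) (.op .mod (.var 0) blockTerm)))
      (fillCost (.op .mul (.op .shl (.const 1) blockTerm) blockTerm) (.var 0)
        (selValTerm (.op .div (.var 0) blockTerm) (.op .mod (.var 0) blockTerm)) * 8 * n)
      (X.Holds [21, 20, 19, 18, 17, 14, 13, 3, 2, 1, 0])
      (X.Holds [22, 21, 20, 19, 18, 17, 14, 13, 3, 2, 1, 0]) := by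
  have hn : 0 < n := Nat.pos_of_ne_zero (NeZero.ne n)
  obtain ⟨b1, b2⟩ := two_pow_blockLen_bounds n
  have hb := blockLen_pos n
  refine computes_fillCells hw (N₀ := 2 ^ blockLen n * blockLen n)
    (R := fun i x => x = selBit (i / blockLen n) (i % blockLen n)) (by decide)
    (by omega) (fun L M _ _ hX => ?_) (fun L M i hL hM hX hi hi0 hR => ?_)
    (fun r hr m k hm hk => ?_)
  · have hbt := eval_blockTerm (L := L) hw (hX 0 (by decide)) (hX 21 (by decide))
    exact eval_mul (eval_shl_one hbt (by omega)) hbt (by omega)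
  · have hbt := eval_blockTerm (L := L) hw (hX 0 (by decide)) (hX 21 (by decide))
    have hz : (Term.const 0).eval w L M = 0 := eval_const (by omega)
    have hone : (Term.const 1).eval w L M = 1 := eval_const (by omega)
    have h2 : (Term.const 2).eval w L M = 2 := eval_const (by omega)
    have hm := eval_div hi0 hbt
    have hk := eval_mod hi0 hbt
    have hmod := Nat.mod_lt i hb
    have hdm := Nat.div_add_mod' i (blockLen n)
    have hdi := Nat.div_le_self i (blockLen n)
    have hload : i / blockLen n ≠ 0 → ∀ k t, k < blockLen n → k ≤ i % blockLen n →
        Term.eval w L M t = k →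
        (Term.op .add (.load selArr (.op .add (.op .mul (.op .div (.op .div (.var 0) blockTerm)
          (.const 2)) blockTerm) t)) (.const 1)).eval w L M =
          selBit (i / blockLen n / 2) k + 1 := by
      intro h0 k t hkb hki ht
      have hlt : (i / blockLen n / 2) * blockLen n + blockLen n ≤
          i / blockLen n * blockLen n := by
        rw [← Nat.succ_mul]
        exact Nat.mul_le_mul_right _ (by omega)
      have hs := selBit_le (i / blockLen n / 2) k
      refine eval_add ?_ hone (by omega)
      rw [eval_load (eval_add (eval_mul (eval_div hm h2) hbt (by omega)) ht (by omega))]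
      have := hR (i / blockLen n / 2 * blockLen n + k) (by omega)
      rwa [(mul_add_div_mod _ hkb).1, (mul_add_div_mod _ hkb).2] at this
    refine eval_ite (by omega) hL hM (eval_eq hm hz) (fun h => ?_) (fun h => ?_)
    · rw [hz, h, selBit, if_pos rfl]
    rw [selBit, if_neg h]
    refine eval_ite (by omega) hL hM (eval_eq (eval_mod hm h2) hone) (fun h' => ?_)
      (fun h' => ?_)
    · rw [if_pos h']
      refine eval_ite (by omega) hL hM (eval_eq hk hz) (fun h'' => ?_) (fun h'' => ?_)
      · rw [if_pos h'', hz]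
      · rw [if_neg h'']
        exact hload h _ _ (by omega) (by omega) (eval_sub hk hone (by omega) (by omega))
    · rw [if_neg h']
      exact hload h _ _ hmod le_rfl hk
  · have := hr (m * blockLen n + k) (mul_blockLen_add_lt hm hk)
    rwa [(mul_add_div_mod _ hk).1, (mul_add_div_mod _ hk).2] at this

theorem computes_mask (hw : 64 * n ≤ 2 ^ w) :
    Computes P w (fillCells maskArr sizeTerm (maskValTerm (.var 0) (.load parArr (.var 0))))
      (fillCost sizeTerm (.var 0) (maskValTerm (.var 0) (.load parArr (.var 0))) * 8 * n)
      (X.Holds [22, 21, 20, 19, 18, 17, 14, 13, 3, 2, 1, 0])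
      (X.Holds [23, 22, 21, 20, 19, 18, 17, 14, 13, 3, 2, 1, 0]) := by
  have hn : 0 < n := Nat.pos_of_ne_zero (NeZero.ne n)
  obtain ⟨b1, b2⟩ := two_pow_blockLen_bounds n
  have hb := blockLen_pos n
  refine computes_fillCells hw (N₀ := n) (R := fun i x => x = ancMask (blockLen n) X.par i)
    (by decide) (by omega) (fun L M _ _ hX => eval_sizeTerm (hX 0 (by decide)))
    (fun L M i hL hM hX hi hi0 hR => ?_) (fun r hr => hr)
  have hbt := eval_blockTerm (L := L) hw (hX 0 (by decide)) (hX 21 (by decide))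
  have hp := (eval_load (A := parArr) hi0).trans (hX 20 (by decide) i hi)
  have hs := eval_blockStartTerm (L := L) hw (hX 0 (by decide)) (hX 21 (by decide)) hi0 (by omega)
  have hpow : 2 ^ (i % blockLen n) < 2 ^ blockLen n :=
    Nat.pow_lt_pow_right (by omega) (Nat.mod_lt i hb)
  have hbit := eval_shl_one (eval_mod hi0 hbt) (by omega)
  refine eval_ite (by omega) hL hM (eval_lt hp hs) (fun h => ?_) (fun h => ?_)
  · rw [hbit, ancMask, if_neg (by omega)]
  -- Only the root fails this test, because `par 0 = 0`.
  refine eval_ite (by omega) hL hM (eval_lt hp hi0) (fun h' => ?_) (fun h' => ?_)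
  · rw [ancMask, if_pos ⟨by omega, h'⟩]
    have := ancMask_lt (n := n) X.par (X.par i)
    exact eval_add ((eval_load hp).trans (hR _ h')) hbit (by omega)
  · rw [hbit, ancMask, if_neg (by omega)]

theorem eval_rowTerm (hw : 64 * n ≤ 2 ^ w) {L : Locals} {M : Memory} (h0 : X.Spec 0 (M 0))
    (h21 : X.Spec 21 (M 21)) : rowTerm.eval w L M = 2 * blockLen n := by
  have hn : 0 < n := Nat.pos_of_ne_zero (NeZero.ne n)
  have := two_mul_blockLen_le hn
  exact eval_mul (eval_const (by omega)) (eval_blockTerm hw h0 h21) (by omega)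

theorem sub_one_div_mod {i c : ℕ} (h : i % c ≠ 0) :
    (i - 1) / c = i / c ∧ (i - 1) % c = i % c - 1 := by
  rcases Nat.eq_zero_or_pos c with rfl | hc
  · simp
  · have h1 := Nat.div_add_mod' i c
    have h2 := Nat.mod_lt i hc
    rw [show i - 1 = i / c * c + (i % c - 1) by omega]
    exact mul_add_div_mod _ (by omega)

/-- A window of `2 ^ k` blocks ending in `q` is the union of two windows of half the length. One is
the previous cell of the same row, the other lies in an earlier row. Only complete blocks get a row.
-/
theorem computes_min (hw : 64 * n ≤ 2 ^ w) :
    Computes P w (fillCells minArr (.op .mul (.op .div sizeTerm blockTerm) rowTerm)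
        (minValTerm (.var 0) (.op .div (.var 0) rowTerm) (.op .mod (.var 0) rowTerm)))
      (fillCost (.op .mul (.op .div sizeTerm blockTerm) rowTerm) (.var 0)
        (minValTerm (.var 0) (.op .div (.var 0) rowTerm) (.op .mod (.var 0) rowTerm)) * 8 * n)
      (X.Holds [23, 22, 21, 20, 19, 18, 17, 14, 13, 3, 2, 1, 0])
      (X.Holds [24, 23, 22, 21, 20, 19, 18, 17, 14, 13, 3, 2, 1, 0]) := by
  have hn : 0 < n := Nat.pos_of_ne_zero (NeZero.ne n)
  have hb := blockLen_pos n
  have hb4 := two_pow_blockLen_le hn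
  have hN : n / blockLen n * (2 * blockLen n) ≤ 2 * n := by
    have := Nat.div_mul_le_self n (blockLen n)
    rw [mul_left_comm]
    omega
  refine computes_fillCells hw (N₀ := n / blockLen n * (2 * blockLen n))
    (R := fun i x => IsMin X.D
      ((i / (2 * blockLen n) + 1 - 2 ^ (i % (2 * blockLen n))) * blockLen n)
      (i / (2 * blockLen n) * blockLen n + blockLen n - 1) x) (by decide) (by omega)
    (fun L M _ _ hX => eval_mul (eval_div (eval_sizeTerm (hX 0 (by decide)))
      (eval_blockTerm hw (hX 0 (by decide)) (hX 21 (by decide))))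
      (eval_rowTerm hw (hX 0 (by decide)) (hX 21 (by decide))) (by omega))
    (fun L M i hL hM hX hi hi0 hR => ?_) (fun r hr q k hq hk => ?_)
  · have hbt := eval_blockTerm (L := L) hw (hX 0 (by decide)) (hX 21 (by decide))
    have hrt := eval_rowTerm (L := L) hw (hX 0 (by decide)) (hX 21 (by decide))
    have hz : (Term.const 0).eval w L M = 0 := eval_const (by omega)
    have hone : (Term.const 1).eval w L M = 1 := eval_const (by omega)
    have hq := eval_div hi0 hrt
    have hk := eval_mod hi0 hrt
    have hqlt : i / (2 * blockLen n) < n / blockLen n := Nat.div_lt_of_lt_mul (by rwa [mul_comm])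
    have hkb := Nat.mod_lt i (show 0 < 2 * blockLen n by omega)
    have hprev := sub_one_div_mod (i := i) (c := 2 * blockLen n)
    have hdm := Nat.div_add_mod' i (2 * blockLen n)
    set q := i / (2 * blockLen n)
    set k := i % (2 * blockLen n)
    have hqb : q * blockLen n + blockLen n ≤ n := by
      rw [← Nat.succ_mul]
      exact (Nat.mul_le_mul_right _ hqlt).trans (Nat.div_mul_le_self _ _)
    have hqn : q ≤ q * blockLen n := Nat.le_mul_of_pos_right q hb
    have hqm := eval_mul hq hbt (by omega)
    by_cases hk0 : k = 0
    · rw [minValTerm, eval_ite (by omega) hL hM (eval_eq hk hz) (fun _ => rfl)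
        (fun h => absurd hk0 h), hk0, pow_zero, Nat.add_sub_cancel]
      refine eval_blockMinTerm hw (hX 0 (by decide)) (hX 19 (by decide)) (hX 21 (by decide))
        (hX 22 (by decide)) (hX 23 (by decide)) hqm
        (eval_sub (eval_add hqm hbt (by omega)) hone (by omega) (by omega)) (by omega) (by omega) ?_
      rw [Nat.mul_div_cancel _ hb, Nat.add_sub_assoc hb,
        (mul_add_div_mod _ (show blockLen n - 1 < blockLen n by omega)).1]
    · obtain ⟨p1, p2⟩ := hprev hk0
      have hk1 := eval_sub hk hone (by omega) (by omega)
      have hpow : 2 ^ (k - 1) < 2 ^ (2 * blockLen n) := Nat.pow_lt_pow_right (by omega) (by omega)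
      have hp := eval_shl_one hk1 (by omega)
      have hpk : 2 ^ k = 2 * 2 ^ (k - 1) := by
        rw [← pow_succ']; congr 1; omega
      have h1 := hR (i - 1) (by omega)
      rw [p1, p2] at h1
      have hld : (Term.load minArr (.op .sub (.var 0) (.const 1))).eval w L M = M minArr (i - 1) :=
        eval_load (eval_sub hi0 hone (by omega) (by omega))
      rw [minValTerm, eval_ite (by omega) hL hM (eval_eq hk hz) (fun h => absurd h hk0)
        (fun _ => rfl)]
      by_cases hqp : q < 2 ^ (k - 1)
      · rw [eval_ite (by omega) hL hM (eval_lt hq hp) (fun _ => hld) (fun h => absurd hqp h)]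
        rwa [show q + 1 - 2 ^ k = q + 1 - 2 ^ (k - 1) by omega]
      · have hqs := eval_sub hq hp (by omega) (by omega)
        have hqs' : (q - 2 ^ (k - 1)) * blockLen n ≤ q * blockLen n :=
          Nat.mul_le_mul_right _ (by omega)
        have hcell := eval_cellTerm (A := minArr) hw (hX 0 (by decide)) (hX 21 (by decide)) hqs hk1
          (by omega) (by omega)
        rw [eval_ite (by omega) hL hM (eval_lt hq hp) (fun h => absurd h hqp) (fun _ => rfl),
          eval_min (by omega) hL hM hld hcell, min_comm]
        have hrow : (q - 2 ^ (k - 1)) * (2 * blockLen n) ≤ q * (2 * blockLen n) :=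
          Nat.mul_le_mul_right _ (by omega)
        have h2 := hR ((q - 2 ^ (k - 1)) * (2 * blockLen n) + (k - 1)) (by omega)
        rw [(mul_add_div_mod _ (by omega)).1, (mul_add_div_mod _ (by omega)).2] at h2
        rw [show q - 2 ^ (k - 1) + 1 - 2 ^ (k - 1) = q + 1 - 2 ^ k by omega] at h2
        have e1 : (q + 1 - 2 ^ (k - 1)) * blockLen n =
            (q - 2 ^ (k - 1)) * blockLen n + blockLen n := by
          rw [← Nat.succ_mul]
          congr 1
          omega
        refine h2.union h1 (Nat.mul_le_mul_right _ (by omega)) (by omega) (by omega)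
  · have hlt : q * (2 * blockLen n) + 2 * blockLen n ≤ n / blockLen n * (2 * blockLen n) := by
      rw [← Nat.succ_mul]
      exact Nat.mul_le_mul_right _ hq
    have := hr (q * (2 * blockLen n) + k) (by omega)
    rwa [(mul_add_div_mod _ hk).1, (mul_add_div_mod _ hk).2] at this

theorem computes_run (hw : 64 * n ≤ 2 ^ w) :
    Computes P w (fillCells runArr sizeTerm
        (.ite (.op .eq (.op .add (.load parArr (.var 0)) (.const 1)) (.var 0))
          (.load runArr (.op .sub (.var 0) (.const 1))) (.var 0)))
      (fillCost sizeTerm (.var 0)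
        (.ite (.op .eq (.op .add (.load parArr (.var 0)) (.const 1)) (.var 0))
          (.load runArr (.op .sub (.var 0) (.const 1))) (.var 0)) * 8 * n)
      (X.Holds [24, 23, 22, 21, 20, 19, 18, 17, 14, 13, 3, 2, 1, 0])
      (X.Holds [25, 24, 23, 22, 21, 20, 19, 18, 17, 14, 13, 3, 2, 1, 0]) := by
  have hn : 0 < n := Nat.pos_of_ne_zero (NeZero.ne n)
  refine computes_fillCells hw (N₀ := n) (R := fun i x => x = runStart X.par i)
    (by decide) (by omega) (fun L M _ _ hX => eval_sizeTerm (hX 0 (by decide)))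
    (fun L M i hL hM hX hi hi0 hR => ?_) (fun r hr => hr)
  have hone : (Term.const 1).eval w L M = 1 := eval_const (by omega)
  have hp := (eval_load (A := parArr) hi0).trans (hX 20 (by decide) i hi)
  have hlt := X.par_lt hi
  refine eval_ite (by omega) hL hM (eval_eq (eval_add hp hone (by omega)) hi0) (fun h => ?_)
    (fun h => ?_)
  · rw [runStart, if_pos ⟨by omega, h⟩, eval_load (eval_sub hi0 hone (by omega) (by omega))]
    exact hR _ (by omega)
  · rw [runStart, if_neg (fun h' => h h'.2), hi0]

theorem computes_ladder (hw : 64 * n ≤ 2 ^ w) :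
    Computes P w (fillCells ladderArr sizeTerm
        (.ite (.op .eq (.op .add (.load parArr (.var 0)) (.const 1)) (.var 0))
          (.load parArr (.load ladderArr (.op .sub (.var 0) (.const 1))))
          (.load parArr (.var 0))))
      (fillCost sizeTerm (.var 0)
        (.ite (.op .eq (.op .add (.load parArr (.var 0)) (.const 1)) (.var 0))
          (.load parArr (.load ladderArr (.op .sub (.var 0) (.const 1))))
          (.load parArr (.var 0))) * 8 * n)
      (X.Holds [25, 24, 23, 22, 21, 20, 19, 18, 17, 14, 13, 3, 2, 1, 0])
      (X.Holds [26, 25, 24, 23, 22, 21, 20, 19, 18, 17, 14, 13, 3, 2, 1, 0]) := by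
  have hn : 0 < n := Nat.pos_of_ne_zero (NeZero.ne n)
  refine computes_fillCells hw (N₀ := n) (R := fun i x => x = ladder X.par i)
    (by decide) (by omega) (fun L M _ _ hX => eval_sizeTerm (hX 0 (by decide)))
    (fun L M i hL hM hX hi hi0 hR => ?_) (fun r hr => hr)
  have hone : (Term.const 1).eval w L M = 1 := eval_const (by omega)
  have hp := (eval_load (A := parArr) hi0).trans (hX 20 (by decide) i hi)
  have hlt := X.par_lt hi
  refine eval_ite (by omega) hL hM (eval_eq (eval_add hp hone (by omega)) hi0) (fun h => ?_)
    (fun h => ?_)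
  · rw [ladder_rec, if_pos ⟨by omega, h⟩, eval_load ((eval_load (eval_sub hi0 hone (by omega)
      (by omega))).trans (hR _ (by omega)))]
    exact hX 20 (by decide) _ (X.ladder_lt (by omega))
  · rw [ladder_rec, if_neg (fun h' => h h'.2), hp]

/-- A jump is doubled by climbing from its end point along a run and its ladder, so no jumps from
positions inside blocks are needed. Unlike for the minima, the incomplete last block needs a row,
hence `(n - 1) / b + 1` rows. -/
theorem computes_jump (hw : 64 * n ≤ 2 ^ w) :
    Computes P w (fillCells jumpArr (.op .mul (.op .add (.op .div (.op .sub sizeTerm (.const 1))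
        blockTerm) (.const 1)) rowTerm)
        (jumpValTerm (.var 0) (.op .div (.var 0) rowTerm) (.op .mod (.var 0) rowTerm)))
      (fillCost (.op .mul (.op .add (.op .div (.op .sub sizeTerm (.const 1))
        blockTerm) (.const 1)) rowTerm) (.var 0)
        (jumpValTerm (.var 0) (.op .div (.var 0) rowTerm) (.op .mod (.var 0) rowTerm)) * 8 * n)
      (X.Holds [26, 25, 24, 23, 22, 21, 20, 19, 18, 17, 14, 13, 3, 2, 1, 0])
      (X.Holds [27, 26, 25, 24, 23, 22, 21, 20, 19, 18, 17, 14, 13, 3, 2, 1, 0]) := by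
  have hn : 0 < n := Nat.pos_of_ne_zero (NeZero.ne n)
  have hb := blockLen_pos n
  have hb4 := two_pow_blockLen_le hn
  have hb5 := two_mul_blockLen_le hn
  have hN : ((n - 1) / blockLen n + 1) * (2 * blockLen n) ≤ 2 * (n - 1) + 2 * blockLen n := by
    have := Nat.div_mul_le_self (n - 1) (blockLen n)
    rw [add_mul, one_mul, mul_left_comm]
    omega
  refine computes_fillCells hw (N₀ := ((n - 1) / blockLen n + 1) * (2 * blockLen n))
    (R := fun i x => x = X.par^[2 ^ (i % (2 * blockLen n))] (i / (2 * blockLen n) * blockLen n))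
    (by decide) (by omega)
    (fun L M _ _ hX => eval_mul (eval_add (eval_div (eval_sub (eval_sizeTerm (hX 0 (by decide)))
      (eval_const (by omega)) (by omega) (by omega))
      (eval_blockTerm hw (hX 0 (by decide)) (hX 21 (by decide)))) (eval_const (by omega))
        (by have := Nat.div_le_self (n - 1) (blockLen n); omega))
      (eval_rowTerm hw (hX 0 (by decide)) (hX 21 (by decide))) (by omega))
    (fun L M i hL hM hX hi hi0 hR => ?_) (fun r hr q k hq hk => ?_)
  · have hbt := eval_blockTerm (L := L) hw (hX 0 (by decide)) (hX 21 (by decide))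
    have hrt := eval_rowTerm (L := L) hw (hX 0 (by decide)) (hX 21 (by decide))
    have hz : (Term.const 0).eval w L M = 0 := eval_const (by omega)
    have hone : (Term.const 1).eval w L M = 1 := eval_const (by omega)
    have hq := eval_div hi0 hrt
    have hk := eval_mod hi0 hrt
    have hqlt : i / (2 * blockLen n) < (n - 1) / blockLen n + 1 :=
      Nat.div_lt_of_lt_mul (by rwa [mul_comm])
    have hkb := Nat.mod_lt i (show 0 < 2 * blockLen n by omega)
    have hprev := sub_one_div_mod (i := i) (c := 2 * blockLen n)
    set q := i / (2 * blockLen n)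
    set k := i % (2 * blockLen n)
    have hqb : q * blockLen n < n := by
      have h1 : q * blockLen n ≤ (n - 1) / blockLen n * blockLen n :=
        Nat.mul_le_mul_right _ (by omega)
      have := Nat.div_mul_le_self (n - 1) (blockLen n)
      omega
    have hqm := eval_mul hq hbt (by omega)
    refine eval_ite (by omega) hL hM (eval_eq hk hz) (fun hk0 => ?_) (fun hk0 => ?_)
    · rw [hk0, pow_zero, Function.iterate_one, eval_load hqm]
      exact hX 20 (by decide) _ hqb
    · obtain ⟨p1, p2⟩ := hprev hk0
      have hk1 := eval_sub hk hone (by omega) (by omega)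
      have hpow : 2 ^ (k - 1) < 2 ^ (2 * blockLen n) := Nat.pow_lt_pow_right (by omega) (by omega)
      have hp := eval_shl_one hk1 (by omega)
      have hi1 : 0 < i := by
        rcases Nat.eq_zero_or_pos i with h | h
        · exact absurd (show k = 0 by simp [k, h]) hk0
        · exact h
      have h1 := hR (i - 1) (by omega)
      rw [p1, p2] at h1
      have hx := (eval_load (A := jumpArr) (eval_sub hi0 hone (by omega) (by omega))).trans h1
      have hkk : k = k - 1 + 1 := by omega
      -- A jump that has arrived at the root stays there. Otherwise it did not overshoot, so the
      -- node reached is high enough for the climb.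
      refine eval_ite (by omega) hL hM (eval_eq hx hz) (fun h0 => ?_) (fun h0 => ?_)
      · rw [hz, hkk, pow_succ, mul_two, Function.iterate_add_apply, h0,
          X.depthSeq.iterate_zero_eq]
      · obtain ⟨j1, j2⟩ := X.depthSeq.jump_succ hqb h0
        rw [eval_climbTerm hw hL hM (hX 25 (by decide)) (hX 26 (by decide)) hx hp
          ((X.depthSeq.iterate_le hqb _).1.trans_lt hqb) j1, j2, ← hkk]
  · have hq' : q ≤ (n - 1) / blockLen n := (Nat.le_div_iff_mul_le hb).2 (by omega)
    have hlt : q * (2 * blockLen n) + 2 * blockLen n ≤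
        ((n - 1) / blockLen n + 1) * (2 * blockLen n) := by
      rw [← Nat.succ_mul]
      exact Nat.mul_le_mul_right _ (by omega)
    have := hr (q * (2 * blockLen n) + k) (by omega)
    rwa [(mul_add_div_mod _ hk).1, (mul_add_div_mod _ hk).2] at this

end Phases

end RootedTree

namespace RootedTree

/-! ### The rooted tree as an ordered tree -/

section Tree

variable {n : ℕ} [NeZero n] {T : SimpleGraph (Fin n)} (hT : T.IsTree)

/-- The path from a node to the root. -/
noncomputable def rootPath (v : Fin n) : T.Walk v 0 := (hT.connected.exists_path_of_dist v 0).choose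

/-- The parent of a node, where the root is its own parent. -/
noncomputable def parentOf (v : Fin n) : Fin n := (rootPath hT v).snd

theorem rootPath_isPath (v : Fin n) : (rootPath hT v).IsPath :=
  (hT.connected.exists_path_of_dist v 0).choose_spec.1

theorem rootPath_length (v : Fin n) : (rootPath hT v).length = T.dist 0 v := by
  rw [SimpleGraph.dist_comm]
  exact (hT.connected.exists_path_of_dist v 0).choose_spec.2

theorem eq_rootPath {v : Fin n} {q : T.Walk v 0} (hq : q.IsPath) : q = rootPath hT v :=
  (hT.existsUnique_path v 0).unique hq (rootPath_isPath hT v)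

theorem rootPath_zero : rootPath hT 0 = .nil := (eq_rootPath hT .nil).symm

theorem parentOf_zero : parentOf hT 0 = 0 := by
  rw [parentOf, rootPath_zero]
  rfl

/-- By uniqueness of paths, what follows `v` on its path to the root is the root path of the next
node. This turns statements about paths into recursions over parents. -/
theorem rootPath_eq_cons {v : Fin n} (hv : v ≠ 0) :
    ∃ h : T.Adj v (parentOf hT v), rootPath hT v = .cons h (rootPath hT (parentOf hT v)) := by
  have hp := rootPath_isPath hT v
  obtain ⟨p, h, hc, hs⟩ : ∃ (p : Fin n) (h : T.Adj v p),
      rootPath hT v = .cons h (rootPath hT p) ∧ (rootPath hT v).snd = p := by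
    generalize rootPath hT v = q at hp ⊢
    cases q with
    | nil => exact absurd rfl hv
    | cons h q =>
      rw [SimpleGraph.Walk.cons_isPath_iff] at hp
      exact ⟨_, h, congrArg _ (eq_rootPath hT hp.1), SimpleGraph.Walk.snd_cons _ _⟩
  obtain rfl : parentOf hT v = p := hs
  exact ⟨h, hc⟩

theorem dist_parentOf {v : Fin n} (hv : v ≠ 0) : T.dist 0 v = T.dist 0 (parentOf hT v) + 1 := by
  obtain ⟨h, hc⟩ := rootPath_eq_cons hT hv
  rw [← rootPath_length hT v, hc, SimpleGraph.Walk.length_cons, rootPath_length]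

theorem isParent_iff {p v : Fin n} : IsParent T 0 p v ↔ v ≠ 0 ∧ parentOf hT v = p := by
  constructor
  · rintro ⟨q, hq, hnil, rfl⟩
    obtain rfl := eq_rootPath hT hq
    refine ⟨?_, rfl⟩
    rintro rfl
    rw [rootPath_zero] at hnil
    exact hnil SimpleGraph.Walk.Nil.nil
  · rintro ⟨hv, rfl⟩
    refine ⟨rootPath hT v, rootPath_isPath hT v, ?_, rfl⟩
    obtain ⟨h, hc⟩ := rootPath_eq_cons hT hv
    rw [hc]
    exact SimpleGraph.Walk.not_nil_cons

theorem isAncestor_iff_mem {a v : Fin n} :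
    IsAncestor T 0 a v ↔ a ∈ (rootPath hT v).support := by
  constructor
  · rintro ⟨p, hp, ha⟩
    rw [← eq_rootPath hT hp.reverse, SimpleGraph.Walk.support_reverse]
    exact List.mem_reverse.2 ha
  · intro ha
    refine ⟨(rootPath hT v).reverse, (rootPath_isPath hT v).reverse, ?_⟩
    rw [SimpleGraph.Walk.support_reverse]
    exact List.mem_reverse.2 ha

theorem isAncestor_iff_parent {a v : Fin n} (hv : v ≠ 0) :
    IsAncestor T 0 a v ↔ a = v ∨ IsAncestor T 0 a (parentOf hT v) := by
  obtain ⟨h, hc⟩ := rootPath_eq_cons hT hv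
  rw [isAncestor_iff_mem hT, isAncestor_iff_mem hT, hc, SimpleGraph.Walk.support_cons,
    List.mem_cons]

theorem isAncestor_zero (hT : T.IsTree) {a : Fin n} : IsAncestor T 0 a 0 ↔ a = 0 := by
  rw [isAncestor_iff_mem hT, rootPath_zero]
  simp

variable {ch : Fin n → List (Fin n)}

theorem oTree_of_isTree (hnd : ∀ v, (ch v).Nodup) (hmem : ∀ v u, u ∈ ch v ↔ IsParent T 0 v u) :
    OTree ch (parentOf hT) (T.dist 0) where
  nodup := hnd
  mem v u := (hmem v u).trans (isParent_iff hT)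
  pa_zero := parentOf_zero hT
  dp_zero := SimpleGraph.dist_self
  dp_succ _ hu := dist_parentOf hT hu

theorem isAncestor_iff_anc (h : OTree ch (parentOf hT) (T.dist 0)) {a v : Fin n} :
    IsAncestor T 0 a v ↔ Anc (parentOf hT) a v := by
  refine h.induction_up (p := fun v => IsAncestor T 0 a v ↔ Anc (parentOf hT) a v) ?_
    (fun u hu ih => ?_) v
  · rw [isAncestor_zero hT]
    constructor
    · rintro rfl; exact Anc.refl _ _
    · intro h0
      have := h.dp_le_of_anc h0
      rw [h.dp_zero] at this
      exact h.eq_zero_of_dp (by omega)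
  · rw [isAncestor_iff_parent hT hu, ih]
    constructor
    · rintro (rfl | h')
      · exact Anc.refl _ _
      · exact h'.trans (Anc.parent _ _)
    · intro h'
      by_cases hau : a = u
      · exact Or.inl hau
      · exact Or.inr (h'.of_ne hau)

theorem dist_iterate_le (v : Fin n) (k : ℕ) : T.dist ((parentOf hT)^[k] v) v ≤ k := by
  induction k with
  | zero => simp
  | succ k ih =>
    rw [Function.iterate_succ_apply']
    refine (hT.connected.dist_triangle (v := (parentOf hT)^[k] v)).trans ?_
    rw [add_comm]
    refine add_le_add ih ?_
    by_cases h0 : (parentOf hT)^[k] v = 0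
    · rw [h0, parentOf_zero]; simp
    · obtain ⟨h, -⟩ := rootPath_eq_cons hT h0
      exact (SimpleGraph.dist_eq_one_iff_adj.2 h.symm).le

/-- Climbing bounds the distance from above, and the triangle inequality from the root bounds it
from below. -/
theorem dist_of_anc (h : OTree ch (parentOf hT) (T.dist 0)) {z v : Fin n}
    (hz : Anc (parentOf hT) z v) : T.dist z v = T.dist 0 v - T.dist 0 z := by
  have h1 := dist_iterate_le hT v (T.dist 0 v - T.dist 0 z)
  rw [← h.eq_iterate_of_anc hz] at h1
  have h2 := hT.connected.dist_triangle (u := 0) (v := z) (w := v)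
  omega

theorem isLCA_of_anc (h : OTree ch (parentOf hT) (T.dist 0)) {u v z : Fin n}
    (hu : Anc (parentOf hT) z u) (hv : Anc (parentOf hT) z v)
    (hz : ∀ z', Anc (parentOf hT) z' u → Anc (parentOf hT) z' v → Anc (parentOf hT) z' z) :
    IsLCA T 0 u v z := by
  refine ⟨(isAncestor_iff_anc hT h).2 hu, (isAncestor_iff_anc hT h).2 hv, fun z' h1 h2 => ?_⟩
  rw [isAncestor_iff_anc hT h] at h1 h2
  have := h.dp_le_of_anc (hz z' h1 h2)
  rw [dist_of_anc hT h hu, dist_of_anc hT h hv, dist_of_anc hT h h1, dist_of_anc hT h h2]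
  omega

/-- The data of a rooted tree with ordered lists of children. -/
noncomputable def treeData (hnd : ∀ v, (ch v).Nodup)
    (hmem : ∀ v u, u ∈ ch v ↔ IsParent T 0 v u) : TreeData n :=
  ⟨ch, parentOf hT, T.dist 0, oTree_of_isTree hT hnd hmem⟩

variable {hnd : ∀ v, (ch v).Nodup} {hmem : ∀ v u, u ∈ ch v ↔ IsParent T 0 v u}

theorem Represents.holds {M : Memory} (h : Represents T ch M) :
    (treeData hT hnd hmem).Holds [3, 2, 1, 0] M := by
  intro A hA
  simp only [List.mem_cons, List.not_mem_nil, or_false] at hA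
  rcases hA with rfl | rfl | rfl | rfl
  · intro v
    by_cases hv : v = 0
    · subst hv
      rw [TreeData.sibs, laterSibs_zero]
      exact h.nextSibling_root
    · obtain ⟨l, hl⟩ := (treeData hT hnd hmem).isTree.exists_laterSibs hv
      exact h.nextSibling _ l v _ hl
  · exact h.firstChild
  · exact ⟨h.parent_root, fun v hv => h.parent _ v ((isParent_iff hT).2 ⟨hv, rfl⟩)⟩
  · exact h.size

theorem represents_of_holds {M : Memory} (h : (treeData hT hnd hmem).Holds [3, 2, 1, 0] M) :
    Represents T ch M where
  nodup := hnd
  mem_children := hmem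
  size := h 0 (by decide)
  parent v u hu := by
    obtain ⟨h0, rfl⟩ := (isParent_iff hT).1 hu
    exact (h 1 (by decide)).2 u h0
  parent_root := (h 1 (by decide)).1
  firstChild := h 2 (by decide)
  nextSibling v l u l' hl := by
    have := (treeData hT hnd hmem).isTree.laterSibs_eq (v := u) hl
    rw [← this]
    exact h 3 (by decide) u
  nextSibling_root := by
    have : headNode ((treeData hT hnd hmem).sibs 0) = 0 := by
      rw [TreeData.sibs, laterSibs_zero]
      rfl
    rw [← this]
    exact h 3 (by decide) 0

end Tree

/-! ### The procedures -/

/-- The second depth-first search. -/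
def newDfs : Cmd := dfsCmd 7 newFirstArr newNextArr newDistArr newTinArr newToutArr newTimerArr

/-- The preprocessing for both problems. -/
def tablesCmd : Cmd :=
  .call 0 computeDistanceProc [.const 1] ;;
  fill orderArr sizeTerm (preIdxTerm tinArr distArr nodeTerm) nodeTerm ;;
  fillRev heightArr (.ite (.op .lt (belowTerm revTerm) (laterTerm revTerm))
    (laterTerm revTerm) (belowTerm revTerm)) ;;
  fillRev bestArr (.ite (.op .lt (belowTerm revTerm) (laterTerm revTerm))
    (.load bestArr (.load nextSiblingArr revTerm)) revTerm) ;;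
  fillNodes newFirstArr (.ite (.op .eq (.load firstChildArr nodeTerm) (.const 0))
    (.const 0) (.load bestArr (.load firstChildArr nodeTerm))) ;;
  fillNodes newNextArr (newNextTerm nodeTerm (.load parentArr nodeTerm)
    (.load newFirstArr (.load parentArr nodeTerm))) ;;
  (.store newTimerArr (.const 0) (.const 0) ;; .store newDistArr (.const 1) (.const 0) ;;
    .call 0 7 [.const 1]) ;;
  fillNodes idxArr (preIdxTerm newTinArr newDistArr nodeTerm) ;;
  fill atArr sizeTerm (.load idxArr nodeTerm) nodeTerm ;;
  fillCells depthArr sizeTerm (.load newDistArr (.load atArr (.var 0))) ;;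
  fillCells parArr sizeTerm (.ite (.op .eq (.var 0) (.const 0)) (.const 0)
    (.load idxArr (.load parentArr (.load atArr (.var 0))))) ;;
  fillCells logArr (.op .add sizeTerm (.const 1)) (.ite (.op .lt (.var 0) (.const 2)) (.const 0)
    (.op .add (.load logArr (.op .div (.var 0) (.const 2))) (.const 1))) ;;
  fillCells selArr (.op .mul (.op .shl (.const 1) blockTerm) blockTerm)
    (selValTerm (.op .div (.var 0) blockTerm) (.op .mod (.var 0) blockTerm)) ;;
  fillCells maskArr sizeTerm (maskValTerm (.var 0) (.load parArr (.var 0))) ;;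
  fillCells minArr (.op .mul (.op .div sizeTerm blockTerm) rowTerm)
    (minValTerm (.var 0) (.op .div (.var 0) rowTerm) (.op .mod (.var 0) rowTerm)) ;;
  fillCells runArr sizeTerm
    (.ite (.op .eq (.op .add (.load parArr (.var 0)) (.const 1)) (.var 0))
      (.load runArr (.op .sub (.var 0) (.const 1))) (.var 0)) ;;
  fillCells ladderArr sizeTerm
    (.ite (.op .eq (.op .add (.load parArr (.var 0)) (.const 1)) (.var 0))
      (.load parArr (.load ladderArr (.op .sub (.var 0) (.const 1))))
      (.load parArr (.var 0))) ;;
  fillCells jumpArr (.op .mul (.op .add (.op .div (.op .sub sizeTerm (.const 1))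
    blockTerm) (.const 1)) rowTerm)
    (jumpValTerm (.var 0) (.op .div (.var 0) rowTerm) (.op .mod (.var 0) rowTerm))

/-- The value that `LCA(u, v)` returns. -/
def lcaResult : Term := .load atArr (lcaTerm (.load idxArr (.var 0)) (.load idxArr (.var 1)))

/-- The value that `LA(v, d)` returns. -/
def laResult : Term := .load atArr (levelTerm (.load idxArr (.var 0)) (.var 1))

/-- The whole program. -/
def treeProgram : Program :=
  program tablesCmd tablesCmd (.assign 0 lcaResult) (.assign 0 laResult) [newDfs]

/-- The arrays that hold the tree and the tables for the queries. -/
def tableArrays : List ℕ :=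
  [27, 26, 25, 24, 23, 22, 21, 20, 19, 18, 17, 3, 2, 1, 0]

/-! ### Correctness and running time of the procedures -/

section Correctness

variable {n : ℕ} [NeZero n] {X : TreeData n} {w : ℕ}

theorem computes_computeDistance {P : Program} (hP : P[0]? = some computeDistanceBase)
    (hw : 64 * n ≤ 2 ^ w) {l : List ℕ} (h2 : 2 ∈ l) (h3 : 3 ∈ l)
    (hl : ∀ A ∈ l, A ≠ 4 ∧ A ≠ 5 ∧ A ≠ 6 ∧ A ≠ 7) :
    Computes P w computeDistance (100 * n) (X.Holds l) (X.Holds (6 :: 5 :: 4 :: l)) := by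
  have hn : 0 < n := Nat.pos_of_ne_zero (NeZero.ne n)
  refine (computes_dfs (tm := 7) hP (by decide) (by omega) X.isTree (I := X.Holds l)
    (fun M hM => ⟨hM 2 h2, fun v l u l' hv => ?_⟩)
    (fun M M' h hM => hM.congr fun A hA => ?_)).mono le_rfl (fun _ h => h)
    (fun M h => ((h.1.cons (A := 4) fun v => (h.2 v).dist).cons (A := 5)
      fun v => (h.2 v).tin).cons (A := 6) fun v => (h.2 v).tout)
  · rw [← X.isTree.laterSibs_eq hv]
    exact hM 3 h3 u
  · obtain ⟨a, b, c, d⟩ := hl A hA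
    exact h A a b c d

/-- The search of the reordered tree writes only to its own arrays `13` to `16`, so the stored
pointers survive. -/
theorem computes_newDfs {P : Program} (hP : P[7]? = some newDfs) (hw : 64 * n ≤ 2 ^ w) :
    Computes P w (.store newTimerArr (.const 0) (.const 0) ;;
      .store newDistArr (.const 1) (.const 0) ;; .call 0 7 [.const 1]) (100 * n)
      (X.Holds [12, 11, 10, 9, 8, 6, 5, 4, 3, 2, 1, 0]) (X.Holds [14, 13, 3, 2, 1, 0]) := by
  have hn : 0 < n := Nat.pos_of_ne_zero (NeZero.ne n)
  refine (computes_dfs hP (by decide) (by omega) X.isTree'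
    (I := X.Holds [12, 11, 10, 9, 8, 6, 5, 4, 3, 2, 1, 0])
    (fun M hM => ⟨hM 11 (by decide), fun v l u l' hv => hM 12 (by decide) v l u l' hv⟩)
    (fun M M' h hM => hM.congr fun A hA => ?_)).mono le_rfl (fun _ h => h)
    (fun M h => ((h.1.mono (l' := [3, 2, 1, 0]) (by decide)).cons (A := 13)
      fun v => (h.2 v).dist).cons (A := 14) fun v => (h.2 v).tin)
  have hne : ∀ B ∈ [12, 11, 10, 9, 8, 6, 5, 4, 3, 2, 1, 0], B ≠ 13 ∧ B ≠ 14 ∧ B ≠ 15 ∧ B ≠ 16 := by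
    decide
  obtain ⟨a, b, c, d⟩ := hne A hA
  exact h A a b c d

theorem exists_computes_tables : ∃ K : ℕ, ∀ (n : ℕ) [NeZero n] (X : TreeData n) (w : ℕ),
    64 * n ≤ 2 ^ w →
    Computes treeProgram w tablesCmd (K * n) (X.Holds [3, 2, 1, 0]) (X.Holds tableArrays) := by
  -- The constant is left open here, before `n` is introduced; the closing `exact` determines it as
  -- the sum of the factors of all phases.
  apply Exists.intro
  intro n _ X w hw
  have hn : 0 < n := Nat.pos_of_ne_zero (NeZero.ne n)
  have hw1 : 1 < 2 ^ w := by omega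
  have first : Computes treeProgram w (.call 0 computeDistanceProc [.const 1]) (102 * n)
      (X.Holds [3, 2, 1, 0]) (X.Holds [6, 5, 4, 3, 2, 1, 0]) :=
    (Computes.call hw1 rfl (computes_computeDistance rfl hw (by decide) (by decide)
      (by decide))).mono (by simp [Term.cost]; omega) (fun _ h => h) (fun _ h => h)
  have last := computes_jump (X := X) (P := treeProgram) hw
  replace last := last.mono le_rfl (fun _ h => h)
    (fun M h => h.mono (l' := tableArrays) (by decide))
  exact first.seq_mul hw1 <| (computes_order hw).seq_mul hw1 <| (computes_height hw).seq_mul hw1 <|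
    (computes_best hw).seq_mul hw1 <| (computes_newFirst hw).seq_mul hw1 <|
    (computes_newNext hw).seq_mul hw1 <| (computes_newDfs rfl hw).seq_mul hw1 <|
    (computes_idx hw).seq_mul hw1 <| (computes_at hw).seq_mul hw1 <|
    (computes_depth hw).seq_mul hw1 <| (computes_par hw).seq_mul hw1 <|
    (computes_log hw).seq_mul hw1 <| (computes_sel hw).seq_mul hw1 <|
    (computes_mask hw).seq_mul hw1 <| (computes_min hw).seq_mul hw1 <|
    (computes_run hw).seq_mul hw1 <| (computes_ladder hw).seq_mul hw1 last

/-- The tables are simply built twice, as the second run needs only the stored tree. The final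
search writes to the arrays `4` to `7`, which are not in `tableArrays`. Its `100 * n` steps and the
`7` steps for calls and the store give `107`. -/
theorem computes_preprocessing {K : ℕ} (hw : 64 * n ≤ 2 ^ w)
    (h : Computes treeProgram w tablesCmd (K * n) (X.Holds [3, 2, 1, 0]) (X.Holds tableArrays)) :
    Computes treeProgram w preprocessing ((2 * K + 107) * n) (X.Holds [3, 2, 1, 0])
      (X.Holds (6 :: 5 :: 4 :: tableArrays)) := by
  have hn : 0 < n := Nat.pos_of_ne_zero (NeZero.ne n)
  have hw1 : 1 < 2 ^ w := by omega
  have h1 := (Computes.call (P := treeProgram) (x := 0) (args := []) hw1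
    (p := lcaPreprocessingProc) rfl h).mono le_rfl (fun _ h => h)
    (fun M h => h.mono (l' := [3, 2, 1, 0]) (by decide))
  have h2 := Computes.call (P := treeProgram) (x := 0) (args := []) hw1
    (p := laPreprocessingProc) rfl h
  have h3 : Computes treeProgram w (.store distArr (.const 1) (.const 0)) 3
      (X.Holds tableArrays) (X.Holds tableArrays) :=
    Computes.store fun L M hM => hM.congr fun A hA => Memory.write_row_ne _ _ _ (by
      rintro rfl
      revert hA
      decide)
  have h4 := Computes.call (P := treeProgram) (x := 0) (args := [.const 1]) hw1
    (p := computeDistanceProc) rfl (computes_computeDistance (X := X) (l := tableArrays) rfl hw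
      (by decide) (by decide) (by decide))
  refine (h1.seq hw1 (h2.seq hw1 (h3.seq hw1 h4))).mono ?_ (fun _ h => h) (fun _ h => h)
  simp only [Term.cost, List.map_cons, List.map_nil, List.sum_cons, List.sum_nil]
  rw [add_mul, mul_assoc]
  omega

theorem TreeData.idx_iterate (X : TreeData n) (v : Fin n) (k : ℕ) :
    X.idx (X.pa^[k] v) = X.par^[k] (X.idx v) := by
  induction k with
  | zero => rfl
  | succ k ih =>
    rw [Function.iterate_succ_apply', Function.iterate_succ_apply', ← ih, par, at_idx]

theorem TreeData.anc_idx (X : TreeData n) {a v : Fin n} (h : Anc X.pa a v) :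
    Anc X.par (X.idx a) (X.idx v) := by
  obtain ⟨k, rfl⟩ := h
  exact ⟨k, (X.idx_iterate v k).symm⟩

theorem isWordLocals_pair {x y : ℕ} (hx : x < 2 ^ w) (hy : y < 2 ^ w) :
    IsWordLocals w (frame [x, y]) :=
  isWordLocals_frame (by simp [hx, hy])

omit [NeZero n] in
theorem node_lt (hw : 64 * n ≤ 2 ^ w) (v : Fin n) : node v < 2 ^ w := by
  have := v.2
  rw [node]
  omega

/-- The maps `idx` and `at'` between nodes and positions respect ancestors, so the answer for
positions carries over to nodes. -/
theorem runs_lca (hw : 64 * n ≤ 2 ^ w) {M : Memory} (hM : IsWords w M)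
    (hX : X.Holds tableArrays M) (u v : Fin n) :
    ∃ z, Runs treeProgram w lcaProc [node u, node v] M (lcaResult.cost + 1) (node z) M ∧
      Anc X.pa z u ∧ Anc X.pa z v ∧ ∀ z', Anc X.pa z' u → Anc X.pa z' v → Anc X.pa z' z := by
  set L := frame [node u, node v] with hL
  have hi : (Term.load idxArr (.var 0)).eval w L M = X.idx u :=
    (eval_load rfl).trans (hX 17 (by decide) u)
  have hj : (Term.load idxArr (.var 1)).eval w L M = X.idx v :=
    (eval_load rfl).trans (hX 17 (by decide) v)
  obtain ⟨h1, h2, h3, h4⟩ := eval_lcaTerm hw (isWordLocals_pair (node_lt hw u) (node_lt hw v)) hM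
    (hX.mono (by decide)) hi hj (X.idx_lt u) (X.idx_lt v)
  set z := (lcaTerm (.load idxArr (.var 0)) (.load idxArr (.var 1))).eval w L M with hz
  refine ⟨X.at' z, ⟨_, _, rfl, .assign 0 lcaResult L M, ?_⟩, ?_, ?_, fun z' hu hv => ?_⟩
  · rw [Function.update_self, lcaResult, eval_load hz.symm]
    exact hX 18 (by decide) z h1
  · simpa only [X.at_idx] using X.anc_at h2
  · simpa only [X.at_idx] using X.anc_at h3
  · simpa only [X.at_idx] using X.anc_at (h4 _ (X.anc_idx hu) (X.anc_idx hv))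

theorem runs_la (hw : 64 * n ≤ 2 ^ w) {M : Memory} (hM : IsWords w M)
    (hX : X.Holds tableArrays M) (v : Fin n) (d : ℕ) (hd : d ≤ X.dp v) :
    ∃ z, Runs treeProgram w laProc [node v, d] M (laResult.cost + 1) (node z) M ∧
      Anc X.pa z v ∧ X.dp z = d := by
  set L := frame [node v, d] with hL
  have hdn := X.isTree.dp_lt v
  have hi : (Term.load idxArr (.var 0)).eval w L M = X.idx v :=
    (eval_load rfl).trans (hX 17 (by decide) v)
  have h1 := eval_levelTerm hw (isWordLocals_pair (node_lt hw v) (show d < 2 ^ w by omega)) hM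
    (hX 0 (by decide)) (hX 19 (by decide)) (hX 21 (by decide)) (hX 22 (by decide))
    (hX 23 (by decide)) (hX 25 (by decide)) (hX 26 (by decide)) (hX 27 (by decide))
    (d := .var 1) hi rfl (X.idx_lt v) (show d ≤ X.D (X.idx v) by rwa [X.D_idx])
  have h2 := (X.depthSeq.iterate_le (X.idx_lt v) (X.D (X.idx v) - d)).1
  refine ⟨X.pa^[X.dp v - d] v, ⟨_, _, rfl, .assign 0 laResult L M, ?_⟩, ⟨_, rfl⟩, ?_⟩
  · rw [Function.update_self, laResult, eval_load h1, X.D_idx]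
    rw [X.D_idx] at h2
    refine (hX 18 (by decide) _ (h2.trans_lt (X.idx_lt v))).trans ?_
    rw [X.at_iterate, X.at_idx]
  · rw [X.isTree.dp_iterate]
    omega

end Correctness

end RootedTree

/-! ### The main theorem -/

theorem mainTheorem2 :
    ∃ (lcaPre laPre lca la : Cmd) (aux : List Cmd) (C : ℕ),
      ∀ (n : ℕ) [NeZero n] (T : SimpleGraph (Fin n)), T.IsTree →
      ∀ (children : Fin n → List (Fin n)) (w : ℕ), C * n ≤ 2 ^ w →
      ∀ M : Memory, IsWords w M → Represents T children M →
        -- `LCA_Preprocessing()` alone takes `O(n)` steps and makes `LCA(u, v)` take `O(1)` steps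
        (∃ t r M', Runs (program lcaPre laPre lca la aux) w lcaPreprocessingProc [] M t r M' ∧
          t ≤ C * n ∧ Represents T children M' ∧
          AnswersLCA (program lcaPre laPre lca la aux) w C T M') ∧
        -- `LA_Preprocessing()` alone takes `O(n)` steps and makes `LA(v, d)` take `O(1)` steps
        (∃ t r M', Runs (program lcaPre laPre lca la aux) w laPreprocessingProc [] M t r M' ∧
          t ≤ C * n ∧ Represents T children M' ∧
          AnswersLA (program lcaPre laPre lca la aux) w C T M') ∧
        -- `Preprocessing()` takes `O(n)` steps and provides everything
        (∃ t r M', Runs (program lcaPre laPre lca la aux) w preprocessingProc [] M t r M' ∧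
          t ≤ C * n ∧ Represents T children M' ∧
          AnswersLCA (program lcaPre laPre lca la aux) w C T M' ∧
          AnswersLA (program lcaPre laPre lca la aux) w C T M' ∧
          (∀ v : Fin n, M' distArr (node v) = T.dist 0 v) ∧
          IsDFSTimes 0 children (fun v => M' tinArr (node v)) (fun v => M' toutArr (node v))) := by
  obtain ⟨K, hK⟩ := exists_computes_tables
  refine ⟨tablesCmd, tablesCmd, .assign 0 lcaResult, .assign 0 laResult, [newDfs],
    2 * K + 107 + (lcaResult.cost + 1) + (laResult.cost + 1), ?_⟩
  intro n _ T hT children w hC M hM hR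
  set C := 2 * K + 107 + (lcaResult.cost + 1) + (laResult.cost + 1) with hCdef
  have hn : 0 < n := Nat.pos_of_ne_zero (NeZero.ne n)
  have hCn : ∀ k, k ≤ C → k * n ≤ C * n := fun k hk => Nat.mul_le_mul_right n hk
  -- The summand `107` already makes `C` large enough for the room of `64 * n` that rules out
  -- overflow.
  have hw : 64 * n ≤ 2 ^ w := (hCn 64 (by omega)).trans hC
  have hw1 : 1 < 2 ^ w := by omega
  set X := treeData hT hR.nodup hR.mem_children with hXdef
  have hX : X.Holds [3, 2, 1, 0] M := hR.holds hT
  have htab := hK n X w hw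
  have lca : ∀ M', IsWords w M' → X.Holds tableArrays M' → AnswersLCA treeProgram w C T M' := by
    intro M' hM' hX' u v
    obtain ⟨z, h1, h2, h3, h4⟩ := runs_lca hw hM' hX' u v
    exact ⟨_, z, h1, by omega, isLCA_of_anc hT X.isTree h2 h3 h4⟩
  have la : ∀ M', IsWords w M' → X.Holds tableArrays M' → AnswersLA treeProgram w C T M' := by
    intro M' hM' hX' v d hd
    obtain ⟨z, h1, h2, h3⟩ := runs_la hw hM' hX' v d hd
    exact ⟨_, z, h1, by omega, (isAncestor_iff_anc hT X.isTree).2 h2, h3⟩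
  have rep : ∀ M', X.Holds tableArrays M' → Represents T children M' := fun M' h =>
    represents_of_holds hT (h.mono (by decide))
  refine ⟨?_, ?_, ?_⟩
  · obtain ⟨t, r, M', h1, h2, h3, h4⟩ := htab.runs (p := lcaPreprocessingProc) rfl hw1 hM hX
    exact ⟨t, r, M', h1, h2.trans (hCn K (by omega)), rep M' h3, lca M' h4 h3⟩
  · obtain ⟨t, r, M', h1, h2, h3, h4⟩ := htab.runs (p := laPreprocessingProc) rfl hw1 hM hX
    exact ⟨t, r, M', h1, h2.trans (hCn K (by omega)), rep M' h3, la M' h4 h3⟩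
  · obtain ⟨t, r, M', h1, h2, h3, h4⟩ := (computes_preprocessing hw htab).runs
      (p := preprocessingProc) rfl hw1 hM hX
    have h5 : X.Holds tableArrays M' := h3.mono (by decide)
    refine ⟨t, r, M', h1, h2.trans (hCn _ (by omega)), rep M' h5, lca M' h4 h5, la M' h4 h5,
      h3 4 (by decide), ?_⟩
    have e1 : (fun v => M' tinArr (node v)) = tinOf children (T.dist 0) := funext (h3 5 (by decide))
    have e2 : (fun v => M' toutArr (node v)) = toutOf children (T.dist 0) :=
      funext (h3 6 (by decide))
    rw [e1, e2]
    exact X.isTree.isDFSTimes
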